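/- Let $N\ge 1$, let $G\subseteq\mathbb R^N$ be open, and let $V:G\to\mathbb R$ be a real-analytic Morse function (its Hessian $\mathfrak H_V$ is nondegenerate at every critical point) with exactly one critical point $q_c\in G$. Let $V(q_c)=0$ and let $k$ be the index of $q_c$, i.e. the number of negative eigenvalues of $\mathfrak H_V(q_c)$. For a region $U\subseteq G$ the density of states is $\Omega_{N,U}(v)=\int_U\delta[V(q)-Nv]\,dq$, that is, the function (determined up to null sets) with $\int_A\Omega_{N,U}(v)\,dv=\frac1N\operatorname{vol}\{q\in U: V(q)/N\in A\}$ for Borel sets $A$. There is an analytic Morse chart at $q_c$: an analytic diffeomorphism $x\mapsto q(x)$ from an open neighbourhood of $0$ in $\mathbb R^N$ onto an open subset of $G$, with analytic inverse and $q(0)=q_c$, such that $V(q(x))=-\sum_{i\le k}x_i^2+\sum_{i>k}x_i^2$. For every such chart let $J(x)=|\det Dq(x)|$ and, for multi-indices $I=(i_1,\dots,i_N)$, let $a_I=\partial^IJ(0)/I!$. Then: (a) $J(x)=\sum_I a_Ix^I$ near $x=0$, and $a_0=|\det[\mathfrak H_V(q_c)/2]|^{-1/2}$. (b) With $I_1=i_1+\dots+i_k$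 and $|I|=i_1+\dots+i_N$, the function $$h^{\rm a}_{N,k,J}(v)=\sum_{I}(-1)^{I_1}a_{2I}\,\frac{\pi^{N/2}N^{N/2+|I|-1}\prod_{j=1}^N(2i_j)!}{\Gamma(N/2+|I|)\prod_{j=1}^N i_j!}\left(\frac v4\right)^{|I|}$$ is analytic at $v=0$. More precisely, if $R>0$ and $\sum_I a_Ix^I$ converges absolutely whenever $|x_i|<R$ for all $i$, then the series for $h^{\rm a}_{N,k,J}(v)$ converges absolutely for $|v|<R^2/N$ and its sum is analytic there; i.e. its radius of convergence is at least $R^2/N$. (c) Put $$h^{\rm na}_{N,k\bmod 4}(v)=\begin{cases}(-1)^{k/2}\,v^{(N-2)/2}\,\Theta(v)& k\text{ even},\\(-1)^{(k+1)/2}\,v^{(N-2)/2}\,\pi^{-1}\ln|v|& N\text{ even},\ k\text{ odd},\\(-1)^{(N-k)/2}\,(-v)^{(N-2)/2}\,\Theta(-v)& N,k\text{ odd},\end{cases}$$ where $\Theta$ is the Heaviside function; this depends on $k$ only through $k\bmod 4$. Put $\Omega_N^{\rm na}(v)=h^{\rm a}_{N,k,J}(v)\,h^{\rm na}_{N,k\bmod4}(v)$.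 Then $\Omega_N^{\rm na}$ does not agree on any punctured neighbourhood of $0$ with a function analytic at $0$. (d) Let $r>0$ be such that the closed ball $\{|x|\le r\}$ lies in the domain of the chart, and let $U$ be its image. Then near $v=0$ $$\Omega_{N,U}=\Omega_N^{\rm a}+\Omega_N^{\rm na}$$ with $\Omega_N^{\rm a}$ analytic in a neighbourhood of $v=0$. The same holds, with the same $\Omega_N^{\rm na}$, for every Borel set $U$ with $q(\{|x|\le r\})\subseteq U\subseteq G$ for which the density of states of $U\setminus q(\{|x|\le r\})$ exists and is analytic near $v=0$ (so that the boundary of $U$ and infinity contribute no singularity at $v=0$). -/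

import Mathlib

open MeasureTheory Filter Topology Set

noncomputable section

/-- The configuration space `ℝ^N` with its Euclidean structure. -/
abbrev Conf (N : ℕ) : Type := EuclideanSpace ℝ (Fin N)

/-- The partial derivative `∂f/∂x_j`. -/
def partialDeriv {N : ℕ} (j : Fin N) (f : Conf N → ℝ) : Conf N → ℝ :=
  fun x => fderiv ℝ f x (EuclideanSpace.single j 1)

/-- The mixed partial derivative `∂₁^{i₁} ⋯ ∂_N^{i_N} f` for the multi-index `I = (i₁, …, i_N)`. -/
def mixedPartial {N : ℕ} (I : Fin N → ℕ) (f : Conf N → ℝ) : Conf N → ℝ :=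
  (List.finRange N).foldr (fun j g => (partialDeriv j)^[I j] g) f

/-- The Taylor coefficient `a_I = ∂^I f (0) / I!` of `f` at the origin. -/
def taylorCoeff {N : ℕ} (f : Conf N → ℝ) (I : Fin N → ℕ) : ℝ :=
  mixedPartial I f 0 / ∏ j, ((I j).factorial : ℝ)

/-- The monomial `x^I`. -/
def monom {N : ℕ} (x : Conf N) (I : Fin N → ℕ) : ℝ := ∏ j, x j ^ I j

/-- The Hessian matrix of `V` at `q`. -/
def hessian {N : ℕ} (V : Conf N → ℝ) (q : Conf N) : Matrix (Fin N) (Fin N) ℝ :=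
  Matrix.of fun i j => partialDeriv i (partialDeriv j V) q

/-- The Morse index: the number of negative eigenvalues of the Hessian, with multiplicity. -/
def morseIndex {N : ℕ} (V : Conf N → ℝ) (q : Conf N) : ℕ :=
  (hessian V q).charpoly.roots.countP (fun t => t < 0)

/-- A (real-analytic) Morse function on `G`: all critical points in `G` are non-degenerate. -/
structure IsMorseOn {N : ℕ} (V : Conf N → ℝ) (G : Set (Conf N)) : Prop where
  analytic : AnalyticOnNhd ℝ V G
  nondegenerate : ∀ q ∈ G, fderiv ℝ V q = 0 → (hessian V q).det ≠ 0

/-- The local coordinates `x ↦ q(x)` form an analytic Morse chart of `V` in `G` at `qc`,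
with `k` negative squares. -/
structure IsMorseChart {N : ℕ} (V : Conf N → ℝ) (G : Set (Conf N)) (qc : Conf N) (k : ℕ)
    (q : OpenPartialHomeomorph (Conf N) (Conf N)) : Prop where
  zero_mem : (0 : Conf N) ∈ q.source
  map_zero : q 0 = qc
  target_subset : q.target ⊆ G
  analytic : AnalyticOnNhd ℝ q q.source
  analytic_symm : AnalyticOnNhd ℝ q.symm q.target
  normal_form : ∀ x ∈ q.source,
    V (q x) = -(∑ i : Fin N with i.val < k, x i ^ 2) + ∑ i : Fin N with k ≤ i.val, x i ^ 2

/-- The Jacobian determinant `J(x)` (in absolute value) of the coordinate change `x ↦ q(x)`. -/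
def jacobianDet {N : ℕ} (q : Conf N → Conf N) (x : Conf N) : ℝ := |(fderiv ℝ q x).det|

/-- `Ω` is, for `v ∈ S`, the configurational density of states
`Ω(v) = ∫_U δ[V(q) - N v] dq` of the region `U`, that is
`∫_A Ω(v) dv = ∫_U ∫_A δ[V(q) - N v] dv dq = vol {q ∈ U | V(q)/N ∈ A} / N`
for all Borel sets `A ⊆ S`. -/
structure IsDensityOfStates {N : ℕ} (V : Conf N → ℝ) (U : Set (Conf N)) (S : Set ℝ)
    (Ω : ℝ → ℝ) : Prop where
  integrable : IntegrableOn Ω S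
  volume_ne_top : volume {q ∈ U | V q / N ∈ S} ≠ ⊤
  integral_eq : ∀ A ⊆ S, MeasurableSet A →
    ∫ v in A, Ω v = volume.real {q ∈ U | V q / N ∈ A} / N

/-- The Heaviside step function. -/
def heaviside (t : ℝ) : ℝ := if 0 ≤ t then 1 else 0

/-- The universal nonanalytic factor; `κ` is the remainder of the index modulo `4`. -/
def hNonanalytic (N κ : ℕ) (v : ℝ) : ℝ :=
  if Even κ then
    (-1) ^ (κ / 2) * v ^ (((N : ℝ) - 2) / 2) * heaviside v
  else if Even N then
    (-1) ^ ((κ + 1) / 2) * v ^ ((N - 2) / 2 : ℕ) * (Real.log |v| / Real.pi)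
  else
    (-1 : ℝ) ^ (((N : ℤ) - κ) / 2) * (-v) ^ (((N : ℝ) - 2) / 2) * heaviside (-v)

/-- The term of multi-index `I` in the expansion of the analytic factor. -/
def hAnalyticTerm (N k : ℕ) (J : Conf N → ℝ) (v : ℝ) (I : Fin N → ℕ) : ℝ :=
  (-1) ^ (∑ j : Fin N with j.val < k, I j) * taylorCoeff J (fun j => 2 * I j) *
    (Real.pi ^ ((N : ℝ) / 2) * (N : ℝ) ^ ((N : ℝ) / 2 + (∑ j, I j : ℕ) - 1) *
        ∏ j, ((2 * I j).factorial : ℝ)) /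
      (Real.Gamma ((N : ℝ) / 2 + (∑ j, I j : ℕ)) * ∏ j, ((I j).factorial : ℝ)) *
    (v / 4) ^ (∑ j, I j)

/-- The analytic factor, depending on `N`, `k`, the Jacobian determinant `J`, and `v`. -/
def hAnalytic (N k : ℕ) (J : Conf N → ℝ) (v : ℝ) : ℝ :=
  ∑' I : Fin N → ℕ, hAnalyticTerm N k J v I

/-- The nonanalytic part of the density of states. -/
def omegaNonanalytic (N k : ℕ) (J : Conf N → ℝ) (v : ℝ) : ℝ :=
  hAnalytic N k J v * hNonanalytic N (k % 4) v

end

/-! Everything happens at the critical point. In a Morse chart V becomes t - s, where s and t are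
the squared norms of the first k and of the last m = N - k coordinates, and volume becomes J dx. In
bipolar coordinates (`lintegral_closedBall_eq_level`) a ball of radius r has, at energy w = N v, the
density ∫ s^(k/2-1) (s+w)^(m/2-1) M(s, s+w) ds over s > 0, s + w > 0, 2s + w ≤ r². Here M
(`shellIntegral`) is a quarter of the integral of J over a product of two unit spheres. Monomials
with an odd exponent integrate to zero over a sphere, so near 0 the function M is a power series in
s and t themselves, not merely in √s and √t.

The heart is the model integral of s^(α-1) (s+w)^(β-1). The relation t - s = w and one integration
by parts express the integral with α or β raised by one as a multiple of w times the original one,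
up to a term from the cut-off s + t = ρ that is analytic in w. After normalization by
Γ(α+β)/(Γ(α)Γ(β)), raising α by a and β by b multiplies the singular part by exactly (-1)^a w^(a+b)
(`exists_modelIntegral_add_nat_decomposition`). Half-integer exponents thus reduce to the pairs
formed from 1 and 1/2, which are elementary integrals producing a step, a one-sided square root or a
logarithm. Hence all monomials of J share one singular function, `hNonanalytic`, and their weights
add up to the analytic factor: this is why the singular part is a product. The analytic remainders
can be summed because the cut-off terms grow no faster than R^(a+b) on a complex disc
(`norm_cutoffPoly_le`, `exists_series_integral_decomposition`).

The Taylor series of J is needed only for s + t ≤ ρ₀. On the remaining shell, s + t serves as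
integration variable, w enters only the integrand, and the integral over a compact set is analytic
(`analyticOnNhd_outer`). For k = 0 and k = N one of the spheres is missing and ordinary polar
coordinates suffice; `exists_energy_density` unites the cases. Passing from w to v costs at most a
polynomial, coming from log N.

The sphere moments are bounded independently of the multi-index, so the analytic factor converges at
w as soon as the series of J converges absolutely at the point with all coordinates √|w|; this gives
R² in w and R²/N in v. The factor is nonzero at 0 because J(0) is; dividing by it reduces
nonanalyticity to that of `hNonanalytic`, which follows from isolated zeros or from the
unboundedness of the logarithm.

The chart exists because two applications of Hadamard's lemma write V as ⟪S(y) y, y⟫ with S(y)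
symmetric, and the square root of S(0)⁻¹ S(y) carries this form into that of S(0)
(`exists_congruence`). In any chart, the second-order terms give L* S(0) L = diag(±1) for L = Dq(0);
since S(0) is half the Hessian, taking determinants gives J(0). -/

/-! ### Parametric integrals of analytic functions -/

section ParametricIntegral

open scoped NNReal ENNReal

variable {E : Type*} [NormedAddCommGroup E] [NormedSpace ℝ E]

/-- A one-variable function given by a convergent power series near a point is analytic there. -/
theorem analyticAt_of_eventually_hasSum {f : ℝ → ℝ} {y : ℝ} {c : ℕ → ℝ}
    (h : ∀ᶠ z in 𝓝 (0 : ℝ), HasSum (fun n => z ^ n * c n) (f (y + z))) : AnalyticAt ℝ f y := by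
  refine ⟨fun n => ContinuousMultilinearMap.mkPiRing ℝ (Fin n) (c n), ?_⟩
  refine hasFPowerSeriesAt_iff.2 ?_
  simpa [FormalMultilinearSeries.coeff] using h

/-- Near a point, a jointly analytic function expands in powers of its last (real) variable, with
uniformly bounded coefficients depending continuously on the other variables. -/
theorem AnalyticAt.exists_expansion_snd {F : E × ℝ → ℝ} {z : E} {y : ℝ}
    (hF : AnalyticAt ℝ F (z, y)) :
    ∃ r > 0, ∃ C : ℝ, ∃ f : ℕ → E → ℝ, (∀ n, ContinuousOn (f n) (Metric.ball z r)) ∧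
      (∀ n, ∀ x ∈ Metric.ball z r, |f n x| * r ^ n ≤ C) ∧
      ∀ x ∈ Metric.ball z r, ∀ h : ℝ, |h| < r → HasSum (fun n => h ^ n * f n x) (F (x, y + h)) := by
  obtain ⟨p, R, hp⟩ := hF
  obtain ⟨ρ, hρ0, hρ⟩ := ENNReal.lt_iff_exists_nnreal_btwn.1 hp.r_pos
  have hρ0' : 0 < ρ := by simpa using hρ0
  -- This radius leaves room twice: for moving the centre from (z, y) to (x, y), and for the
  -- increment h.
  set r : ℝ≥0 := ρ / 3 with hr
  have hr0 : 0 < r := by positivity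
  have h3r : (r : ℝ≥0∞) + r < R := by
    refine lt_of_le_of_lt ?_ hρ
    rw [← ENNReal.coe_add]
    refine ENNReal.coe_le_coe.2 ?_
    rw [← NNReal.coe_le_coe, hr]; push_cast; linarith [ρ.2]
  have hsum := p.changeOriginSeries_summable_aux₁ (h3r.trans_le hp.r_le)
  set emb : E → E × ℝ := fun x => (x - z, 0) with hemb
  have hnorm : ∀ x, ‖emb x‖ = dist x z := fun x => by
    simp [hemb, Prod.norm_def, dist_eq_norm]
  have hlt : ∀ x ∈ Metric.ball z (r : ℝ), (‖emb x‖₊ : ℝ≥0∞) < r := fun x hx => by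
    rw [ENNReal.coe_lt_coe, ← NNReal.coe_lt_coe, coe_nnnorm, hnorm]; exact hx
  have hrR : (r : ℝ≥0∞) < R := lt_of_le_of_lt (by simp) h3r
  -- The coefficient of h^n is the n-th term of the series recentred at (x, y), evaluated on the
  -- vector (0, 1). The absolutely convergent sum of all recentring terms bounds these coefficients
  -- for all n and x at once.
  refine ⟨r, by exact_mod_cast hr0, ((∑' s : Σ k l : ℕ, { s : Finset (Fin (k + l)) // s.card = l },
      ‖p (s.1 + s.2.1)‖₊ * r ^ s.2.1 * r ^ s.1 : ℝ≥0) : ℝ),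
      fun n x => p.changeOrigin (emb x) n (fun _ => ((0 : E), (1 : ℝ))), fun n => ?_, fun n x hx => ?_,
      fun x hx h hh => ?_⟩
  · have h1 := (p.hasFPowerSeriesOnBall_changeOrigin n (hp.r_pos.trans_le hp.r_le)).continuousOn
    have h2 : ContinuousOn (fun x => p.changeOrigin (emb x) n) (Metric.ball z r) := by
      refine h1.comp (by fun_prop) fun x hx => ?_
      rw [mem_eball_zero_iff]
      exact ((hlt x hx).trans hrR).trans_le hp.r_le
    exact (ContinuousMultilinearMap.apply ℝ (fun _ : Fin n => E × ℝ) ℝ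
      (fun _ => ((0 : E), (1 : ℝ)))).continuous.comp_continuousOn h2
  · have h1 := p.nnnorm_changeOrigin_le n (((hlt x hx).trans hrR).trans_le hp.r_le)
    have h2 : |p.changeOrigin (emb x) n (fun _ => ((0 : E), (1 : ℝ)))| ≤ ‖p.changeOrigin (emb x) n‖ := by
      have := (p.changeOrigin (emb x) n).le_opNorm (fun _ => ((0 : E), (1 : ℝ)))
      simpa [Prod.norm_def] using this
    have hle : ‖p.changeOrigin (emb x) n‖₊ * r ^ n ≤
        ∑' s : Σ k l : ℕ, { s : Finset (Fin (k + l)) // s.card = l },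
          ‖p (s.1 + s.2.1)‖₊ * r ^ s.2.1 * r ^ s.1 := by
      rw [Summable.tsum_sigma' (NNReal.summable_sigma.1 hsum).1 hsum]
      refine le_trans ?_ ((NNReal.summable_sigma.1 hsum).2.le_tsum n fun _ _ => zero_le)
      refine le_trans ?_ (NNReal.tsum_mul_right (fun s : Σ l : ℕ, { s : Finset (Fin (n + l)) //
        s.card = l } => ‖p (n + s.1)‖₊ * r ^ s.1) (r ^ n)).ge
      refine mul_le_mul_left ?_ _
      refine h1.trans ?_
      refine (p.changeOriginSeries_summable_aux₂
        (((hlt x hx).trans hrR).trans_le hp.r_le) n).tsum_le_tsum (fun s => ?_)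
        (p.changeOriginSeries_summable_aux₂ (hrR.trans_le hp.r_le) n)
      gcongr
      exact_mod_cast (hlt x hx).le
    calc _ ≤ ‖p.changeOrigin (emb x) n‖ * (r : ℝ) ^ n := by gcongr
      _ ≤ _ := by exact_mod_cast hle
  · have h1 := hp.changeOrigin ((hlt x hx).trans hrR)
    have h2 : ((0 : E), h) ∈ Metric.eball (0 : E × ℝ) (R - ‖emb x‖₊) := by
      rw [mem_eball_zero_iff, lt_tsub_iff_right]
      refine lt_of_lt_of_le ?_ h3r.le
      refine ENNReal.add_lt_add ?_ (hlt x hx)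
      change ((‖((0 : E), h)‖₊ : ℝ≥0) : ℝ≥0∞) < r
      rw [ENNReal.coe_lt_coe, ← NNReal.coe_lt_coe, coe_nnnorm]
      simpa [Prod.norm_def] using hh
    have h3 := h1.hasSum h2
    have h4 : (z, y) + emb x + ((0 : E), h) = (x, y + h) := by simp [hemb]
    rw [h4] at h3
    refine h3.congr_fun fun n => ?_
    have := (p.changeOrigin (emb x) n).map_smul_univ (fun _ => h) (fun _ => ((0 : E), (1 : ℝ)))
    simpa using this.symm

/-- The integral over a compact set of parameters of a jointly analytic function is analytic. -/
theorem analyticAt_setIntegral_of_isCompact {X : Type*} [TopologicalSpace X]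
    [SecondCountableTopology X] [MeasurableSpace X] [BorelSpace X]
    {μ : Measure X} [IsFiniteMeasureOnCompacts μ] {K : Set X} (hK : IsCompact K)
    (hKm : MeasurableSet K) {e : X → E} (he : Continuous e) {F : E × ℝ → ℝ} {y : ℝ}
    (hF : ∀ x ∈ K, AnalyticAt ℝ F (e x, y)) :
    AnalyticAt ℝ (fun w => ∫ x in K, F (e x, w) ∂μ) y := by
  -- The quantifier over all measurable A lets overlapping pieces be cut into disjoint ones, so the
  -- property passes to unions.
  have key : ∃ t : Set X, MeasurableSet t ∧ K ⊆ t ∧ ∀ A ⊆ t ∩ K, MeasurableSet A →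
      (∀ᶠ w in 𝓝 y, IntegrableOn (fun x => F (e x, w)) A μ) ∧
      AnalyticAt ℝ (fun w => ∫ x in A, F (e x, w) ∂μ) y := by
    refine hK.induction_on (p := fun s => ∃ t : Set X, MeasurableSet t ∧ s ⊆ t ∧ ∀ A ⊆ t ∩ K,
      MeasurableSet A → (∀ᶠ w in 𝓝 y, IntegrableOn (fun x => F (e x, w)) A μ) ∧
      AnalyticAt ℝ (fun w => ∫ x in A, F (e x, w) ∂μ) y) ?_ ?_ ?_ ?_
    · refine ⟨∅, .empty, le_rfl, fun A hA _ => ?_⟩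
      have : A = ∅ := by simpa using hA
      subst this
      simpa using analyticAt_const
    · rintro s t hst ⟨u, hu, htu, h⟩
      exact ⟨u, hu, hst.trans htu, h⟩
    · rintro s t ⟨u, hu, hsu, h⟩ ⟨v, hv, htv, h'⟩
      refine ⟨u ∪ v, hu.union hv, union_subset_union hsu htv, fun A hA hAm => ?_⟩
      have h1 := h (A ∩ u) (fun x hx => ⟨hx.2, (hA hx.1).2⟩) (hAm.inter hu)
      have h2 := h' (A \ u) (fun x hx => ⟨(hA hx.1).1.resolve_left hx.2, (hA hx.1).2⟩)
        (hAm.diff hu)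
      have hAu : A ∩ u ∪ A \ u = A := inter_union_sdiff A u
      constructor
      · filter_upwards [h1.1, h2.1] with w hw1 hw2
        rw [← hAu]; exact hw1.union hw2
      · refine (h1.2.add h2.2).congr ?_
        filter_upwards [h1.1, h2.1] with w hw1 hw2
        conv_rhs => rw [← hAu]
        rw [setIntegral_union disjoint_sdiff_inter.symm (hAm.diff hu) hw1 hw2]
        rfl
    · intro x hx
      obtain ⟨r, hr, C, f, hfc, hfb, hfs⟩ := (hF x hx).exists_expansion_snd
      refine ⟨e ⁻¹' Metric.ball (e x) r, mem_nhdsWithin_of_mem_nhds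
        (he.continuousAt.preimage_mem_nhds (Metric.ball_mem_nhds _ hr)),
        e ⁻¹' Metric.ball (e x) r, (Metric.isOpen_ball.preimage he).measurableSet, le_rfl,
        fun A hA hAm => ?_⟩
      have hAfin : μ A < ⊤ :=
        (measure_mono (hA.trans inter_subset_right)).trans_lt hK.measure_lt_top
      have hmeas : ∀ n, AEStronglyMeasurable (fun x' => f n (e x')) (μ.restrict A) := fun n =>
        ContinuousOn.aestronglyMeasurable ((hfc n).comp he.continuousOn
          fun x' hx' => (hA hx').1) hAm
      have hbd : ∀ w : ℝ, ∀ n, ∀ᵐ x' ∂μ.restrict A,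
          ‖w ^ n * f n (e x')‖ ≤ C * (|w| / r) ^ n := fun w n => by
        filter_upwards [ae_restrict_mem hAm] with x' hx'
        have := hfb n _ (hA hx').1
        rw [norm_mul, norm_pow, Real.norm_eq_abs, Real.norm_eq_abs, div_pow]
        rw [← le_div_iff₀ (by positivity)] at this
        calc _ ≤ |w| ^ n * (C / r ^ n) := by gcongr
          _ = _ := by ring
      have hsb : ∀ w : ℝ, |w| < r → Summable fun n : ℕ => C * (|w| / r) ^ n := fun w hw =>
        (summable_geometric_of_lt_one (by positivity) ((div_lt_one hr).2 hw)).mul_left C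
      have hnhds : ∀ᶠ w in 𝓝 (0 : ℝ), |w| < r := by
        filter_upwards [Metric.ball_mem_nhds (0 : ℝ) hr] with w hw
        simpa using hw
      have : IsFiniteMeasure (μ.restrict A) := ⟨by simpa using hAfin⟩
      have hgood : ∀ w : ℝ, |w| < r → HasSum (fun n => w ^ n * ∫ x' in A, f n (e x') ∂μ)
          (∫ x' in A, F (e x', y + w) ∂μ) := fun w hw => by
        have := hasSum_integral_of_dominated_convergence (μ := μ.restrict A)
          (F := fun n x' => w ^ n * f n (e x')) (f := fun x' => F (e x', y + w))
          (fun n _ => C * (|w| / r) ^ n)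
          (fun n => (hmeas n).const_mul _) (hbd w) (Eventually.of_forall fun _ => hsb w hw)
          (integrable_const _) (by
            filter_upwards [ae_restrict_mem hAm] with x' hx'
            exact hfs _ (hA hx').1 w hw)
        simpa only [integral_const_mul] using this
      refine ⟨?_, analyticAt_of_eventually_hasSum (hnhds.mono hgood)⟩
      have hsub : ∀ᶠ w in 𝓝 y, |w - y| < r := by
        filter_upwards [Metric.ball_mem_nhds y hr] with w hw
        simpa [Real.dist_eq] using hw
      filter_upwards [hsub] with w hw
      have h0 : y + (w - y) = w := by ring
      refine Integrable.of_bound (C := ∑' n, C * (|w - y| / r) ^ n) ?_ ?_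
      · refine (aestronglyMeasurable_of_tendsto_ae (u := atTop)
          (f := fun (s : ℕ) x' => ∑ n ∈ Finset.range s, (w - y) ^ n * f n (e x')) (fun s => ?_) ?_)
        · exact Finset.aestronglyMeasurable_fun_sum _ fun n _ => (hmeas n).const_mul _
        · filter_upwards [ae_restrict_mem hAm] with x' hx'
          have := (hfs _ (hA hx').1 _ hw).tendsto_sum_nat
          rwa [h0] at this
      · filter_upwards [ae_restrict_mem hAm, ae_all_iff.2 (hbd (w - y))] with x' hx' hb
        have h2 := hfs _ (hA hx').1 _ hw
        rw [h0] at h2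
        exact h2.tsum_eq ▸ tsum_of_norm_bounded (hsb _ hw).hasSum hb
  obtain ⟨t, -, hKt, h⟩ := key
  exact (h K (subset_inter hKt le_rfl) hKm).2

end ParametricIntegral

/-! ### Multi-index power series -/

section MultiIndex

variable {N : ℕ}

theorem prod_comp_eq_prod_pow_card {n : ℕ} (x : Fin N → ℝ) (φ : Fin n → Fin N) :
    ∏ i, x (φ i) = ∏ j, x j ^ (Finset.univ.filter fun i => φ i = j).card := by
  rw [← Finset.prod_fiberwise Finset.univ φ]
  refine Finset.prod_congr rfl fun j _ => ?_
  rw [Finset.prod_congr rfl (g := fun _ => x j) (fun i hi => by rw [(Finset.mem_filter.1 hi).2]),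
    Finset.prod_const]

theorem euclideanSpace_norm_le_sum_abs (x : Conf N) : ‖x‖ ≤ ∑ i, |x i| := by
  have h : x = ∑ i, x i • EuclideanSpace.single i (1 : ℝ) := by
    ext j; simp [Finset.sum_apply, Pi.single_apply]
  conv_lhs => rw [h]
  refine (norm_sum_le _ _).trans (Finset.sum_le_sum fun i _ => ?_)
  simp [norm_smul]

/-- A function analytic at the origin is the sum of a power series in the coordinates. -/
theorem AnalyticAt.exists_hasSum_monom {f : Conf N → ℝ} (hf : AnalyticAt ℝ f 0) :
    ∃ R > 0, ∃ c : (Fin N → ℕ) → ℝ, ∀ x : Conf N, (∀ i, |x i| < R) →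
      HasSum (fun I => c I * monom x I) (f x) := by
  obtain ⟨p, r, hp⟩ := hf
  obtain ⟨ρ, hρ0, hρ⟩ := ENNReal.lt_iff_exists_nnreal_btwn.1 hp.r_pos
  have hρ0' : (0 : ℝ) < ρ := by simpa using hρ0
  -- In this polydisc Σ |x i| < ρ, so Σ ‖p n‖ (Σ |x i|)^n converges and dominates the coordinate
  -- expansion.
  set R : ℝ := ρ / (N + 1) with hR
  have hR0 : 0 < R := by positivity
  set e : Fin N → Conf N := fun j => EuclideanSpace.single j (1 : ℝ) with he
  -- One term for each word in the coordinate directions, from the multilinear expansion of p n (x,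
  -- …, x). Absolute summability permits regrouping words by the number of times each letter occurs.
  set T : Conf N → (Σ n : ℕ, Fin n → Fin N) → ℝ :=
    fun x s => (∏ i, x (s.2 i)) * p s.1 (fun i => e (s.2 i)) with hT
  have hsumx : ∀ x : Conf N, (∀ i, |x i| < R) → ∑ i, |x i| < ρ := fun x hx => by
    calc ∑ i, |x i| ≤ ∑ i : Fin N, R := Finset.sum_le_sum fun i _ => (hx i).le
      _ = N * R := by simp
      _ < ρ := by rw [hR, mul_div_assoc', div_lt_iff₀ (by positivity)]; nlinarith
  have hTs : ∀ x : Conf N, (∀ i, |x i| < R) → Summable (T x) := fun x hx => by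
    have hρr : (ρ : ENNReal) < p.radius := hρ.trans_le hp.r_le
    have h1 : Summable fun n : ℕ => ‖p n‖ * (∑ i, |x i|) ^ n := by
      have := p.summable_norm_mul_pow (r := ⟨∑ i, |x i|, Finset.sum_nonneg fun _ _ => abs_nonneg _⟩)
        (lt_trans (ENNReal.coe_lt_coe.2 (hsumx x hx)) hρr)
      exact this
    have hle : ∀ s, ‖T x s‖ ≤ ‖p s.1‖ * ∏ i, |x (s.2 i)| := fun s => by
      rw [hT, norm_mul, norm_prod, mul_comm]
      simp only [Real.norm_eq_abs]
      gcongr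
      have := (p s.1).le_opNorm (fun i => e (s.2 i))
      simpa [he] using this
    have hn : ∀ n : ℕ, HasSum (fun φ : Fin n → Fin N => ‖p n‖ * ∏ i, |x (φ i)|)
        (‖p n‖ * (∑ i, |x i|) ^ n) := fun n => by
      have : (∑ i, |x i|) ^ n = ∑ φ : Fin n → Fin N, ∏ i, |x (φ i)| := by
        rw [← Fin.prod_const, Finset.prod_univ_sum, Fintype.piFinset_univ]
      rw [this]
      exact (hasSum_fintype _).mul_left _
    refine Summable.of_norm_bounded (g := fun s => ‖p s.1‖ * ∏ i, |x (s.2 i)|) ?_ hle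
    rw [summable_sigma_of_nonneg fun s => by positivity]
    exact ⟨fun n => (hn n).summable, by simpa only [(hn _).tsum_eq] using h1⟩
  have hTsum : ∀ x : Conf N, (∀ i, |x i| < R) → HasSum (T x) (f x) := fun x hx => by
    have hmem : x ∈ Metric.eball (0 : Conf N) r := by
      rw [mem_eball_zero_iff]
      refine lt_trans ?_ hρ
      rw [← ofReal_norm, ENNReal.ofReal_lt_coe_iff (norm_nonneg _)]
      exact (euclideanSpace_norm_le_sum_abs x).trans_lt (hsumx x hx)
    have h1 := hp.hasSum hmem
    rw [zero_add] at h1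
    refine HasSum.sigma_of_hasSum h1 (fun n => ?_) (hTs x hx)
    have hx' : (fun _ : Fin n => x) = fun _ => ∑ j, x j • e j := by
      funext _; ext j; simp [he, Finset.sum_apply, Pi.single_apply]
    rw [hx', ContinuousMultilinearMap.map_sum]
    simp only [ContinuousMultilinearMap.map_smul_univ, smul_eq_mul]
    exact hasSum_fintype _
  set cnt : (Σ n : ℕ, Fin n → Fin N) → (Fin N → ℕ) :=
    fun s j => (Finset.univ.filter fun i => s.2 i = j).card with hcnt
  have hTm : ∀ x s, T x s = monom x (cnt s) * p s.1 (fun i => e (s.2 i)) := fun x s => by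
    simp only [hT, monom, hcnt, prod_comp_eq_prod_pow_card (x := fun j => x j)]
  -- On a fibre the monomial is constant; it can be divided out at a point all of whose coordinates
  -- are nonzero.
  have hfib : ∀ I, Summable fun s : {s // cnt s = I} => p s.1.1 (fun i => e (s.1.2 i)) := by
    intro I
    set x₀ : Conf N := WithLp.toLp 2 fun _ => R / 2 with hx₀
    have h0 : ∀ i, |x₀ i| < R := fun i => by
      simp only [hx₀]; rw [abs_of_pos (by positivity)]; linarith
    have h1 := ((hTs x₀ h0).comp_injective (Subtype.val_injective (p := fun s => cnt s = I)))
    have hne : monom x₀ I ≠ 0 := by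
      simp only [monom, hx₀]
      exact Finset.prod_ne_zero_iff.2 fun i _ => pow_ne_zero _ (by positivity)
    have h2 := h1.mul_left (monom x₀ I)⁻¹
    refine h2.congr fun s => ?_
    simp only [Function.comp_apply, hTm, s.2]
    field_simp
  refine ⟨R, hR0, fun I => ∑' s : {s // cnt s = I}, p s.1.1 (fun i => e (s.1.2 i)), fun x hx => ?_⟩
  have h1 := (Equiv.sigmaFiberEquiv cnt).hasSum_iff.2 (hTsum x hx)
  refine h1.sigma fun I => ?_
  have h2 := (hfib I).hasSum.mul_right (monom x I)
  refine h2.congr_fun fun s => ?_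
  simp only [Function.comp_apply, Equiv.sigmaFiberEquiv, Equiv.coe_fn_mk, hTm, s.2]
  ring

/-- One term of the binomial expansion of (a + h)^n. It lets a power series at radius a + h dominate
its termwise derivative at radius a. -/
theorem natCast_mul_pow_pred_mul_le {a h : ℝ} (ha : 0 ≤ a) (hh : 0 ≤ h) (n : ℕ) :
    n * a ^ (n - 1) * h ≤ (a + h) ^ n := by
  induction n with
  | zero => simp
  | succ n ih =>
    have h1 : a ^ n ≤ (a + h) ^ n := by gcongr; linarith
    have h2 : (n : ℝ) * a ^ n * h ≤ a * (a + h) ^ n := by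
      rcases n with _ | n
      · simpa using ha
      · calc ((n + 1 : ℕ) : ℝ) * a ^ (n + 1) * h = a * (((n + 1 : ℕ) : ℝ) * a ^ (n + 1 - 1) * h) := by
              simp only [Nat.add_sub_cancel]; ring
          _ ≤ _ := by gcongr
    simp only [Nat.add_sub_cancel]
    push_cast
    calc ((n : ℝ) + 1) * a ^ n * h = n * a ^ n * h + a ^ n * h := by ring
      _ ≤ a * (a + h) ^ n + (a + h) ^ n * h := by gcongr
      _ = _ := by ring

/-- The open polydisc of radius `R` around the origin. -/
def polydisc (N : ℕ) (R : ℝ) : Set (Conf N) := {x | ∀ i, |x i| < R}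

theorem isOpen_polydisc (R : ℝ) : IsOpen (polydisc N R) := by
  simp only [polydisc, ofPred_forall]
  exact isOpen_iInter_of_finite fun i => isOpen_lt (by fun_prop) continuous_const

theorem zero_mem_polydisc {R : ℝ} (hR : 0 < R) : (0 : Conf N) ∈ polydisc N R := fun i => by simpa

theorem exists_polydisc_subset {s : Set (Conf N)} (hs : s ∈ 𝓝 0) :
    ∃ R > 0, polydisc N R ⊆ s := by
  obtain ⟨ε, hε, h⟩ := Metric.mem_nhds_iff.1 hs
  refine ⟨ε / (N + 1), by positivity, fun x hx => h ?_⟩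
  rw [mem_ball_zero_iff]
  calc ‖x‖ ≤ ∑ i, |x i| := euclideanSpace_norm_le_sum_abs x
    _ ≤ ∑ i : Fin N, ε / (N + 1) := Finset.sum_le_sum fun i _ => (hx i).le
    _ = N * (ε / (N + 1)) := by simp
    _ < ε := by rw [mul_div_assoc', div_lt_iff₀ (by positivity)]; nlinarith

theorem analyticOnNhd_partialDeriv {f : Conf N → ℝ} {s : Set (Conf N)} (hf : AnalyticOnNhd ℝ f s)
    (j : Fin N) : AnalyticOnNhd ℝ (partialDeriv j f) s := fun x hx =>
  ((ContinuousLinearMap.apply ℝ ℝ (EuclideanSpace.single j (1 : ℝ))).analyticAt _).comp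
    (hf.fderiv x hx)

/-- Termwise differentiation of a multi-index power series, written with `∂^I f (0)` in place of
the coefficients. -/
theorem hasSum_monom_partialDeriv {f : Conf N → ℝ} {R : ℝ} (hf : AnalyticOnNhd ℝ f (polydisc N R))
    {d : (Fin N → ℕ) → ℝ} (hd : ∀ x ∈ polydisc N R,
      HasSum (fun I => d I / (∏ j, ((I j).factorial : ℝ)) * monom x I) (f x)) (j : Fin N) :
    ∀ x ∈ polydisc N R, HasSum (fun I => d (I + Pi.single j 1) / (∏ j, ((I j).factorial : ℝ)) *
      monom x I) (partialDeriv j f x) := by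
  intro x hx
  set c : (Fin N → ℕ) → ℝ := fun I => d I / (∏ j, ((I j).factorial : ℝ)) with hc
  set m : (Fin N → ℕ) → ℝ := fun I => ∏ i ∈ Finset.univ.erase j, x i ^ I i with hm
  set X : ℝ → Conf N := fun t => x + (t - x j) • EuclideanSpace.single j (1 : ℝ) with hX
  have hXj : ∀ t, X t j = t := fun t => by simp [hX]
  have hXi : ∀ t, ∀ i ≠ j, X t i = x i := fun t i hi => by simp [hX, hi]
  have hXmem : ∀ t, |t| < R → X t ∈ polydisc N R := fun t ht i => by
    by_cases hi : i = j
    · subst hi; rwa [hXj]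
    · rw [hXi t i hi]; exact hx i
  have hmon : ∀ t I, monom (X t) I = t ^ I j * m I := fun t I => by
    rw [monom, ← Finset.mul_prod_erase _ _ (Finset.mem_univ j), hXj]
    congr 1
    exact Finset.prod_congr rfl fun i hi => by rw [hXi t i (Finset.ne_of_mem_erase hi)]
  have hXx : X (x j) = x := by simp [hX]
  obtain ⟨R₁, hR₁, hR₁R⟩ := exists_between (hx j)
  obtain ⟨R₂, hR₂, hR₂R⟩ := exists_between hR₁R
  have hR₁0 : 0 < R₁ := (abs_nonneg _).trans_lt hR₁
  have hR₂0 : 0 < R₂ := hR₁0.trans hR₂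
  have hsum : ∀ t, |t| < R → HasSum (fun I => c I * (t ^ I j * m I)) (f (X t)) := fun t ht => by
    simpa only [hmon] using hd _ (hXmem t ht)
  have hu : Summable fun I => (R₂ - R₁)⁻¹ * ‖c I * (R₂ ^ I j * m I)‖ :=
    (hsum R₂ (by rwa [abs_of_pos hR₂0])).summable.norm.mul_left _
  have hder : ∀ I, ∀ t ∈ Ioo (-R₁) R₁, HasDerivAt (fun t => c I * (t ^ I j * m I))
      (c I * ((I j : ℝ) * t ^ (I j - 1) * m I)) t := fun I t _ =>
    ((hasDerivAt_pow (I j) t).mul_const (m I)).const_mul (c I)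
  have hbound : ∀ I, ∀ t ∈ Ioo (-R₁) R₁, ‖c I * ((I j : ℝ) * t ^ (I j - 1) * m I)‖ ≤
      (R₂ - R₁)⁻¹ * ‖c I * (R₂ ^ I j * m I)‖ := fun I t ht => by
    have ht' : |t| ≤ R₁ := (abs_lt.2 ht).le
    rw [inv_mul_eq_div, le_div_iff₀ (by linarith)]
    simp only [norm_mul, norm_pow, Real.norm_eq_abs, Nat.abs_cast, abs_of_pos hR₂0]
    have h1 := natCast_mul_pow_pred_mul_le hR₁0.le (by linarith : 0 ≤ R₂ - R₁) (I j)
    rw [add_sub_cancel] at h1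
    have h2 : (I j : ℝ) * |t| ^ (I j - 1) * (R₂ - R₁) ≤ R₂ ^ I j := by
      refine le_trans ?_ h1
      have : 0 ≤ R₂ - R₁ := by linarith
      gcongr
    calc |c I| * (↑(I j) * |t| ^ (I j - 1) * |m I|) * (R₂ - R₁)
        = |c I| * |m I| * (↑(I j) * |t| ^ (I j - 1) * (R₂ - R₁)) := by ring
      _ ≤ |c I| * |m I| * R₂ ^ I j := by gcongr
      _ = _ := by ring
  have hxI : x j ∈ Ioo (-R₁) R₁ := abs_lt.1 hR₁
  have h1 := hasDerivAt_tsum_of_isPreconnected hu isOpen_Ioo isPreconnected_Ioo hder hbound hxI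
    (hsum (x j) (hx j)).summable hxI
  have h2 : HasDerivAt (fun t => f (X t)) (partialDeriv j f x) (x j) := by
    have hX' : HasDerivAt X (EuclideanSpace.single j (1 : ℝ)) (x j) := by
      have := (((hasDerivAt_id (x j)).sub_const (x j)).smul_const
        (EuclideanSpace.single j (1 : ℝ))).const_add x
      rwa [one_smul] at this
    have hfx : HasFDerivAt f (fderiv ℝ f x) (X (x j)) := by
      rw [hXx]; exact (hf x hx).differentiableAt.hasFDerivAt
    exact hfx.comp_hasDerivAt (x j) hX'
  have h3 : (fun t => ∑' I, c I * (t ^ I j * m I)) =ᶠ[𝓝 (x j)] fun t => f (X t) := by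
    filter_upwards [isOpen_Ioo.mem_nhds hxI] with t ht
    exact (hsum t ((abs_lt.2 ht).trans hR₁R)).tsum_eq
  have h4 : partialDeriv j f x = ∑' I, c I * ((I j : ℝ) * x j ^ (I j - 1) * m I) :=
    (h2.congr_of_eventuallyEq h3).unique h1
  have h5 : HasSum (fun I => c I * ((I j : ℝ) * x j ^ (I j - 1) * m I)) (partialDeriv j f x) := by
    rw [h4]
    exact (Summable.of_norm_bounded hu fun I => hbound I _ hxI).hasSum
  -- Differentiation kills the terms with I j = 0; the others are exactly the shifted indices.
  have hinj : Function.Injective fun I : Fin N → ℕ => I + Pi.single j 1 :=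
    add_left_injective _
  rw [← hinj.hasSum_iff] at h5
  · refine h5.congr_fun fun I => ?_
    have hfac : (∏ i, (((I + Pi.single j 1 : Fin N → ℕ) i).factorial : ℝ)) =
        (I j + 1) * ∏ i, ((I i).factorial : ℝ) := by
      rw [← Finset.mul_prod_erase _ _ (Finset.mem_univ j),
        ← Finset.mul_prod_erase _ (fun i => ((I i).factorial : ℝ)) (Finset.mem_univ j), ← mul_assoc]
      congr 1
      · simp [Nat.factorial_succ]
      · refine Finset.prod_congr rfl fun i hi => ?_
        simp [Finset.ne_of_mem_erase hi]
    have hmI : m (I + Pi.single j 1) = m I := by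
      refine Finset.prod_congr rfl fun i hi => ?_
      simp [Finset.ne_of_mem_erase hi]
    have hxm : monom x I = x j ^ I j * m I := by simpa only [hXx] using hmon (x j) I
    have hne : (∏ i, ((I i).factorial : ℝ)) ≠ 0 :=
      Finset.prod_ne_zero_iff.2 fun i _ => by positivity
    simp only [Function.comp_apply, hc, hfac, hmI, hxm]
    simp only [Pi.add_apply, Pi.single_eq_same, Nat.add_sub_cancel, Nat.cast_add, Nat.cast_one]
    field_simp
  · intro I hI
    have : I j = 0 := by
      by_contra h0
      refine hI ⟨I - Pi.single j 1, ?_⟩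
      funext i
      by_cases hi : i = j
      · subst hi; simp; omega
      · simp [hi]
    simp [this]

/-- With coefficients written as d I / I!, each partial derivative only shifts d. At the origin only
d K survives, which identifies the coefficients of any convergent expansion with the Taylor
coefficients. -/
theorem hasSum_monom_mixedPartial {f : Conf N → ℝ} {R : ℝ}
    (hf : AnalyticOnNhd ℝ f (polydisc N R)) {d : (Fin N → ℕ) → ℝ} (hd : ∀ x ∈ polydisc N R,
      HasSum (fun I => d I / (∏ j, ((I j).factorial : ℝ)) * monom x I) (f x)) (K : Fin N → ℕ) :
    ∀ x ∈ polydisc N R, HasSum (fun I => d (I + K) / (∏ j, ((I j).factorial : ℝ)) * monom x I)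
      (mixedPartial K f x) := by
  have hiter : ∀ (j : Fin N) (n : ℕ) (g : Conf N → ℝ) (b : (Fin N → ℕ) → ℝ),
      AnalyticOnNhd ℝ g (polydisc N R) → (∀ x ∈ polydisc N R,
        HasSum (fun I => b I / (∏ j, ((I j).factorial : ℝ)) * monom x I) (g x)) →
      AnalyticOnNhd ℝ ((partialDeriv j)^[n] g) (polydisc N R) ∧ ∀ x ∈ polydisc N R,
        HasSum (fun I => b (I + Pi.single j n) / (∏ j, ((I j).factorial : ℝ)) * monom x I)
          ((partialDeriv j)^[n] g x) := by
    intro j n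
    induction n with
    | zero => intro g b hg hb; simpa using ⟨hg, hb⟩
    | succ n ih =>
      intro g b hg hb
      have := ih _ _ (analyticOnNhd_partialDeriv hg j) (hasSum_monom_partialDeriv hg hb j)
      refine ⟨this.1, fun x hx => ?_⟩
      have h2 := this.2 x hx
      simp only [add_assoc, ← Pi.single_add] at h2
      exact h2
  have hlist : ∀ l : List (Fin N),
      AnalyticOnNhd ℝ (l.foldr (fun j g => (partialDeriv j)^[K j] g) f) (polydisc N R) ∧
      ∀ x ∈ polydisc N R, HasSum (fun I => d (I + (l.map fun j => Pi.single j (K j)).sum) /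
        (∏ j, ((I j).factorial : ℝ)) * monom x I)
          (l.foldr (fun j g => (partialDeriv j)^[K j] g) f x) := by
    intro l
    induction l with
    | nil => simpa using ⟨hf, hd⟩
    | cons j l ih =>
      have := hiter j (K j) _ (fun I => d (I + (l.map fun j => Pi.single j (K j)).sum)) ih.1 ih.2
      simpa only [List.foldr_cons, List.map_cons, List.sum_cons, add_assoc] using this
  have hK : ((List.finRange N).map fun j => (Pi.single j (K j) : Fin N → ℕ)).sum = K := by
    have h1 : ((List.finRange N).map fun j => (Pi.single j (K j) : Fin N → ℕ)).sum =
      ∑ j, Pi.single j (K j) := (Fin.sum_univ_def _).symm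
    rw [h1]
    exact Finset.univ_sum_single K
  have h := (hlist (List.finRange N)).2
  rw [hK] at h
  exact h

theorem monom_zero_left (I : Fin N → ℕ) : monom (0 : Conf N) I = if I = 0 then 1 else 0 := by
  split_ifs with h
  · subst h; simp [monom]
  · obtain ⟨j, hj⟩ := Function.ne_iff.1 h
    exact Finset.prod_eq_zero (Finset.mem_univ j) (by simpa using hj)

/-- The coordinate power series of an analytic function is its Taylor series. -/
theorem AnalyticAt.exists_hasSum_taylorCoeff {f : Conf N → ℝ} (hf : AnalyticAt ℝ f 0) :
    ∃ R > 0, ∀ x ∈ polydisc N R, HasSum (fun I => taylorCoeff f I * monom x I) (f x) := by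
  obtain ⟨R₁, hR₁, c, hc⟩ := hf.exists_hasSum_monom
  obtain ⟨R₂, hR₂, h₂⟩ := exists_polydisc_subset hf.eventually_analyticAt
  have hsub : ∀ x ∈ polydisc N (min R₁ R₂), x ∈ polydisc N R₁ ∧ x ∈ polydisc N R₂ := fun x hx =>
    ⟨fun i => (hx i).trans_le (min_le_left _ _), fun i => (hx i).trans_le (min_le_right _ _)⟩
  have hfac : ∀ I : Fin N → ℕ, (∏ j, ((I j).factorial : ℝ)) ≠ 0 := fun I =>
    Finset.prod_ne_zero_iff.2 fun i _ => by positivity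
  have key : ∀ I, taylorCoeff f I = c I := fun I => by
    have h := hasSum_monom_mixedPartial (f := f) (R := min R₁ R₂)
      (d := fun I => c I * ∏ j, ((I j).factorial : ℝ)) (fun x hx => h₂ (hsub x hx).2)
      (fun x hx => by simpa only [mul_div_cancel_right₀ _ (hfac _)] using hc x (hsub x hx).1) I 0
      (zero_mem_polydisc (lt_min hR₁ hR₂))
    have h' := h.unique (hasSum_single 0 fun I hI => by simp [monom_zero_left, hI])
    rw [taylorCoeff, h', div_eq_iff (hfac I)]
    simp [monom_zero_left]
  refine ⟨min R₁ R₂, lt_min hR₁ hR₂, fun x hx => ?_⟩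
  simpa only [key] using hc x (hsub x hx).1

end MultiIndex

/-! ### The analytic Morse lemma -/

section Morse

open scoped InnerProductSpace NNReal ENNReal ContDiff

section General

variable {E F : Type*} [NormedAddCommGroup E] [NormedSpace ℝ E] [NormedAddCommGroup F]
  [NormedSpace ℝ F]

/-- Analytic Hadamard lemma. -/
theorem AnalyticAt.exists_hadamard [CompleteSpace F] {f : E → F} (hf : AnalyticAt ℝ f 0) :
    ∃ A : E → E →L[ℝ] F, AnalyticAt ℝ A 0 ∧ ∀ᶠ y in 𝓝 0, f y = f 0 + A y y := by
  obtain ⟨p, r, hp⟩ := hf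
  obtain ⟨ρ, hρ0, hρ⟩ := ENNReal.lt_iff_exists_nnreal_btwn.1 hp.r_pos
  have hρ0' : (0 : ℝ) < ρ := by simpa using hρ0
  obtain ⟨C, hC, hpC⟩ := p.norm_mul_pow_le_of_lt_radius (hρ.trans_le hp.r_le)
  -- The shifted series drops the constant term and leaves one argument open; feeding y back into
  -- that slot recovers f y - f 0.
  have hrad : (ρ : ℝ≥0∞) ≤ p.shift.radius := by
    refine p.shift.le_radius_of_bound (C / ρ) fun n => ?_
    have h1 : ‖p.shift n‖ = ‖p (n + 1)‖ := (p (n + 1)).curryRight_norm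
    rw [h1, le_div_iff₀ hρ0', mul_assoc, ← pow_succ]
    exact hpC (n + 1)
  have hs := p.shift.hasFPowerSeriesOnBall (lt_of_lt_of_le hρ0 hrad)
  refine ⟨p.shift.sum, hs.analyticAt, ?_⟩
  filter_upwards [Metric.eball_mem_nhds (0 : E) hρ0] with y hy
  have h1 := hp.hasSum (Metric.eball_subset_eball hρ.le hy)
  have h2 := p.shift.hasSum (Metric.eball_subset_eball hrad hy)
  have h3 := (ContinuousLinearMap.apply ℝ F y).hasSum h2
  have h4 : HasSum (fun n => p (n + 1) fun _ => y) (p.shift.sum y y) := by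
    refine h3.congr_fun fun n => ?_
    simp only [ContinuousLinearMap.apply_apply, FormalMultilinearSeries.shift,
      ContinuousMultilinearMap.curryRight_apply]
    congr 1
    funext i
    refine Fin.lastCases ?_ (fun i => ?_) i <;> simp
  have h5 : HasSum (fun n => p n fun _ => y) ((p 0 fun _ => y) + p.shift.sum y y) := by
    have := (hasSum_nat_add_iff (f := fun n => p n fun _ => y) 1).1 h4
    simpa [add_comm] using this
  rw [zero_add] at h1
  rw [h1.unique h5, hp.coeff_zero]

theorem hasFDerivAt_clm_apply_self {A : E → E →L[ℝ] F} (hA : DifferentiableAt ℝ A 0) :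
    HasFDerivAt (fun y => A y y) (A 0) 0 := by
  have := hA.hasFDerivAt.clm_apply (hasFDerivAt_id (𝕜 := ℝ) (0 : E))
  refine this.congr_fderiv ?_
  ext v; simp

/-- In a Banach algebra the square root is analytic near `1`. -/
theorem exists_analyticAt_sqrt {A : Type*} [NormedRing A] [NormedAlgebra ℝ A] [CompleteSpace A] :
    ∃ s : A → A, AnalyticAt ℝ s 1 ∧ s 1 = 1 ∧ (∀ᶠ x in 𝓝 (1 : A), s x * s x = x) ∧
      ∀ᶠ y in 𝓝 (1 : A), s (y * y) = y := by
  set f : A → A := fun x => x * x with hf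
  have hfa : AnalyticAt ℝ f 1 := analyticAt_id.mul analyticAt_id
  have hc : ContDiffAt ℝ ω f 1 := hfa.contDiffAt
  -- The derivative of squaring at 1 is v ↦ 2v, which is invertible, so squaring has an analytic
  -- local inverse.
  set e : A ≃L[ℝ] A := ContinuousLinearEquiv.smulLeft (Units.mk0 (2 : ℝ) two_ne_zero) with he
  have hd : HasFDerivAt f (e : A →L[ℝ] A) 1 := by
    have := (hasFDerivAt_id (𝕜 := ℝ) (1 : A)).mul' (hasFDerivAt_id (𝕜 := ℝ) (1 : A))
    refine this.congr_fderiv ?_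
    ext v
    simp [he, two_smul, Units.smul_def]
  have hn : (ω : WithTop ℕ∞) ≠ 0 := by simp
  have h1 : f 1 = 1 := by simp [hf]
  have hs := hc.hasStrictFDerivAt' hd hn
  refine ⟨hc.localInverse hd hn, ?_, ?_, ?_, ?_⟩
  · have := (hc.to_localInverse hd hn).analyticAt
    rwa [h1] at this
  · have := hc.localInverse_apply_image hd hn
    rwa [h1] at this
  · have := hs.eventually_right_inverse
    rwa [h1] at this
  · exact hs.eventually_left_inverse

end General

variable {E : Type*} [NormedAddCommGroup E] [InnerProductSpace ℝ E] [FiniteDimensional ℝ E]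

theorem inner_adjoint_add_self (T : E →L[ℝ] E) (u : E) :
    ⟪((1 / 2 : ℝ) • (T + ContinuousLinearMap.adjoint T)) u, u⟫_ℝ = ⟪T u, u⟫_ℝ := by
  simp only [smul_apply, add_apply, inner_smul_left,
    inner_add_left, ContinuousLinearMap.adjoint_inner_left]
  rw [real_inner_comm u (T u)]
  simp
  ring

/-- Near a critical point at height zero, an analytic function is a quadratic form with analytic
coefficients. -/
theorem AnalyticAt.exists_quadratic {V : E → ℝ} {q : E} (hV : AnalyticAt ℝ V q) (h0 : V q = 0)
    (h1 : fderiv ℝ V q = 0) :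
    ∃ S : E → E →L[ℝ] E, AnalyticAt ℝ S 0 ∧ (∀ y, ContinuousLinearMap.adjoint (S y) = S y) ∧
      ∀ᶠ y in 𝓝 0, V (q + y) = ⟪S y y, y⟫_ℝ := by
  set f : E → ℝ := fun y => V (q + y) with hf
  have hfa : AnalyticAt ℝ f 0 := by
    refine AnalyticAt.fun_comp (g := V) ?_ (by fun_prop)
    simpa using hV
  obtain ⟨A, hA, hfA⟩ := hfa.exists_hadamard
  have hf0 : f 0 = 0 := by simp [hf, h0]
  have hA0 : A 0 = 0 := by
    have h2 : HasFDerivAt f (A 0) 0 := by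
      refine (hasFDerivAt_clm_apply_self hA.differentiableAt).congr_of_eventuallyEq ?_
      filter_upwards [hfA] with y hy
      rw [hy, hf0, zero_add]
    have h3 : HasFDerivAt f (fderiv ℝ V q) 0 := by
      have h4 : HasFDerivAt V (fderiv ℝ V q) (q + 0) := by
        rw [add_zero]; exact hV.differentiableAt.hasFDerivAt
      exact (h4.comp (0 : E) ((hasFDerivAt_id (𝕜 := ℝ) (0 : E)).const_add q)).congr_fderiv
        (by ext; simp)
    rw [h2.unique h3, h1]
  -- Since A vanishes at 0 (the point is critical), a second division by y makes V a quadratic form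
  -- B(y) y y.
  obtain ⟨B, hB, hAB⟩ := hA.exists_hadamard
  set b₀ := stdOrthonormalBasis ℝ E with hb₀
  -- The Riesz identification, written in an orthonormal basis as a real continuous linear map;
  -- composing with it turns bilinear forms into operators.
  set D : (E →L[ℝ] ℝ) →L[ℝ] E :=
    ∑ i, (ContinuousLinearMap.apply ℝ ℝ (b₀ i)).smulRight (b₀ i) with hD
  have hDi : ∀ (φ : E →L[ℝ] ℝ) (v : E), ⟪D φ, v⟫_ℝ = φ v := fun φ v => by
    conv_rhs => rw [← b₀.sum_repr v]
    simp [hD, sum_inner, inner_smul_left,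
      OrthonormalBasis.repr_apply_apply, mul_comm]
  set Λ : (E →L[ℝ] E →L[ℝ] ℝ) →L[ℝ] (E →L[ℝ] E) :=
    ContinuousLinearMap.compL ℝ E (E →L[ℝ] ℝ) E D with hΛ
  have hΛi : ∀ (b : E →L[ℝ] E →L[ℝ] ℝ) (u v : E), ⟪Λ b u, v⟫_ℝ = b u v := fun b u v => by
    simp [hΛ, hDi]
  set adj : (E →L[ℝ] E) →L[ℝ] (E →L[ℝ] E) :=
    (ContinuousLinearMap.adjoint (𝕜 := ℝ) (E := E) (F := E)).toContinuousLinearEquiv.toContinuousLinearMap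
    with hadj
  refine ⟨fun y => (1 / 2 : ℝ) • (Λ (B y) + ContinuousLinearMap.adjoint (Λ (B y))), ?_, fun y => ?_, ?_⟩
  · have h2 : AnalyticAt ℝ (fun y => Λ (B y)) 0 := by
      refine AnalyticAt.fun_comp (g := fun b => Λ b) ?_ hB
      exact Λ.analyticAt (B 0)
    have h3 : AnalyticAt ℝ (fun y => ContinuousLinearMap.adjoint (Λ (B y))) 0 :=
      AnalyticAt.fun_comp (adj.analyticAt _) h2
    exact analyticAt_const.fun_smul (h2.fun_add h3)
  · simp [add_comm]
  · filter_upwards [hfA, hAB] with y hy hy'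
    change f y = _
    rw [inner_adjoint_add_self, hΛi, hy, hy', hA0, hf0]
    simp

/-- An analytic family of symmetric operators is analytically congruent to its central member. -/
theorem exists_congruence {S : E → E →L[ℝ] E} (hS : AnalyticAt ℝ S 0)
    (hsym : ∀ y, ContinuousLinearMap.adjoint (S y) = S y) (hu : IsUnit (S 0)) :
    ∃ C : E → E →L[ℝ] E, AnalyticAt ℝ C 0 ∧ C 0 = 1 ∧
      ∀ᶠ y in 𝓝 0, ∀ u, ⟪S 0 (C y u), C y u⟫_ℝ = ⟪S y u, u⟫_ℝ := by
  obtain ⟨U, hU⟩ := hu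
  obtain ⟨s, hs, hs1, hsq, hinv⟩ := exists_analyticAt_sqrt (A := E →L[ℝ] E)
  set W : E →L[ℝ] E := ((U⁻¹ : (E →L[ℝ] E)ˣ) : E →L[ℝ] E) with hW
  have hWS : W * S 0 = 1 := by rw [← hU]; exact U.inv_mul
  have hSW : S 0 * W = 1 := by rw [← hU]; exact U.mul_inv
  have hstar : ∀ y, star (S y) = S y := hsym
  have hWstar : star W = W := by
    have h1 : star W * S 0 = 1 := by rw [← hstar 0, ← star_mul, hSW, star_one]
    calc star W = star W * (S 0 * W) := by rw [hSW, mul_one]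
      _ = W := by rw [← mul_assoc, h1, one_mul]
  -- The congruence is C = √X with X = S(0)⁻¹ S(y). The map σ(T) = S(0)⁻¹ T* S(0) reverses products
  -- and fixes X, so σ(√X) is another square root of X near 1 and equals √X by local uniqueness.
  -- Hence (√X)* S(0) √X = S(0) X = S(y).
  set X : E → E →L[ℝ] E := fun y => W * S y with hX
  have hX0 : X 0 = 1 := hWS
  have hXa : AnalyticAt ℝ X 0 := analyticAt_const.mul hS
  have hCa : AnalyticAt ℝ (fun y => s (X y)) 0 := AnalyticAt.fun_comp (by rw [hX0]; exact hs) hXa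
  set adj : (E →L[ℝ] E) →L[ℝ] (E →L[ℝ] E) :=
    (ContinuousLinearMap.adjoint (𝕜 := ℝ) (E := E) (F := E)).toContinuousLinearEquiv.toContinuousLinearMap
  have hσc : ContinuousAt (fun y => W * star (s (X y)) * S 0) 0 := by
    have : ContinuousAt (fun y => adj (s (X y))) 0 :=
      adj.continuous.continuousAt.comp hCa.continuousAt
    exact (continuousAt_const.mul this).mul continuousAt_const
  refine ⟨fun y => s (X y), hCa, by simp [hX0, hs1], ?_⟩
  have hXt : Tendsto X (𝓝 0) (𝓝 1) := hX0 ▸ hXa.continuousAt.tendsto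
  have hσt : Tendsto (fun y => W * star (s (X y)) * S 0) (𝓝 0) (𝓝 1) := by
    have h2 := hσc.tendsto
    simpa [hX0, hs1, hWS] using h2
  filter_upwards [hXt.eventually hsq, hσt.eventually hinv] with y h1 h2 u
  have hXs : W * star (X y) * S 0 = X y := by
    simp only [hX, star_mul, hstar, hWstar]
    rw [mul_assoc, mul_assoc, hWS, mul_one]
  have h3 : W * star (s (X y)) * S 0 * (W * star (s (X y)) * S 0) = X y := by
    calc _ = W * star (s (X y)) * (S 0 * W) * star (s (X y)) * S 0 := by simp only [mul_assoc]
      _ = W * star (s (X y) * s (X y)) * S 0 := by rw [hSW, mul_one, star_mul]; simp only [mul_assoc]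
      _ = X y := by rw [h1, hXs]
  rw [h3] at h2
  have h4 : star (s (X y)) * S 0 * s (X y) = S y := by
    have h5 : S 0 * s (X y) = star (s (X y)) * S 0 := by
      conv_lhs => rw [h2]
      rw [← mul_assoc, ← mul_assoc, hSW, one_mul]
    rw [← h5, mul_assoc, h1]
    simp only [hX]
    rw [← mul_assoc, hSW, one_mul]
  have h6 := congrArg (fun T : E →L[ℝ] E => ⟪T u, u⟫_ℝ) h4
  simp only [mul_apply_eq_comp, ContinuousLinearMap.star_eq_adjoint,
    ContinuousLinearMap.adjoint_inner_left] at h6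
  exact h6

end Morse

/-! ### Linear normal form of the Hessian -/

section MorseChart

open scoped InnerProductSpace ContDiff

variable {N : ℕ}

/-- The quadratic normal form with `k` negative squares. -/
def morseForm (k : ℕ) (x : Conf N) : ℝ :=
  -(∑ i : Fin N with i.val < k, x i ^ 2) + ∑ i : Fin N with k ≤ i.val, x i ^ 2

theorem morseForm_eq_sum (k : ℕ) (x : Conf N) :
    morseForm k x = ∑ i : Fin N, (if i.val < k then -1 else 1) * x i ^ 2 := by
  rw [morseForm, Finset.sum_filter, Finset.sum_filter, ← Finset.sum_neg_distrib,
    ← Finset.sum_add_distrib]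
  refine Finset.sum_congr rfl fun i _ => ?_
  by_cases h : i.val < k
  · simp [h, not_le.2 h]
  · simp [h, not_lt.1 h]

/-- By symmetry the derivative of ⟪S y y, y⟫ along e_j is ⟪S'(y)(e_j) y, y⟫ + 2⟪S y y, e_j⟫. The
first term vanishes to second order at 0, so only the second contributes to the next derivative. -/
theorem hessian_eq_of_quadratic {V : Conf N → ℝ} {q : Conf N} {S : Conf N → Conf N →L[ℝ] Conf N}
    (hS : AnalyticAt ℝ S 0) (hsym : ∀ y, ContinuousLinearMap.adjoint (S y) = S y)
    (hV : ∀ᶠ y in 𝓝 0, V (q + y) = ⟪S y y, y⟫_ℝ) (i j : Fin N) :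
    hessian V q i j =
      2 * ⟪S 0 (EuclideanSpace.single i 1), EuclideanSpace.single j (1 : ℝ)⟫_ℝ := by
  set ei : Conf N := EuclideanSpace.single i (1 : ℝ)
  set ej : Conf N := EuclideanSpace.single j (1 : ℝ)
  set G : Conf N → ℝ := fun y => ⟪(fderiv ℝ S y ej) y, y⟫_ℝ + 2 * ⟪S y y, ej⟫_ℝ with hG
  have h1 : ∀ᶠ y in 𝓝 (0 : Conf N), partialDeriv j V (q + y) = G y := by
    filter_upwards [hV.eventually_nhds, hS.eventually_analyticAt] with y hy hSy
    have hd : HasFDerivAt S (fderiv ℝ S y) y := hSy.differentiableAt.hasFDerivAt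
    have hg := (hd.clm_apply (hasFDerivAt_id (𝕜 := ℝ) y)).inner ℝ (hasFDerivAt_id (𝕜 := ℝ) y)
    have hV' : HasFDerivAt (fun y => V (q + y)) _ y := hg.congr_of_eventuallyEq hy
    have h2 : fderiv ℝ V (q + y) = fderiv ℝ (fun y => V (q + y)) y :=
      (fderiv_comp_add_left (f := V) q).symm
    have key : ∀ e : Conf N, fderiv ℝ (fun y => V (q + y)) y e =
        ⟪(fderiv ℝ S y e) y, y⟫_ℝ + 2 * ⟪S y y, e⟫_ℝ := fun e => by
      have hs : ⟪S y e, y⟫_ℝ = ⟪S y y, e⟫_ℝ := by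
        rw [← ContinuousLinearMap.adjoint_inner_right, hsym, real_inner_comm]
      rw [hV'.fderiv]
      simp only [id_eq, ContinuousLinearMap.comp_apply, ContinuousLinearMap.prod_apply,
        fderivInnerCLM_apply, add_apply, ContinuousLinearMap.flip_apply,
        ContinuousLinearMap.id_apply, inner_add_left, hs]
      ring
    rw [partialDeriv, h2, key]
  have hP : DifferentiableAt ℝ (fun y => fderiv ℝ S y ej) 0 :=
    hS.fderiv.differentiableAt.clm_apply (differentiableAt_const _)
  have hG' : HasFDerivAt G
      ((2 : ℝ) • (innerSL ℝ ej).comp (S 0)) 0 := by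
    have h3 := (hasFDerivAt_clm_apply_self hP).inner ℝ (hasFDerivAt_id (𝕜 := ℝ) (0 : Conf N))
    have h4 := ((hasFDerivAt_clm_apply_self hS.differentiableAt).inner ℝ
      (hasFDerivAt_const ej (0 : Conf N))).const_mul 2
    refine (h3.add h4).congr_fderiv ?_
    ext v
    simp [real_inner_comm]
  have h5 : HasFDerivAt (fun y => partialDeriv j V (q + y)) _ 0 := hG'.congr_of_eventuallyEq h1
  have h6 : fderiv ℝ (partialDeriv j V) q = fderiv ℝ (fun y => partialDeriv j V (q + y)) 0 := by
    rw [fderiv_comp_add_left (f := partialDeriv j V) q, add_zero]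
  change fderiv ℝ (partialDeriv j V) q ei = _
  rw [h6, h5.fderiv]
  simp [real_inner_comm]

theorem det_half_hessian {V : Conf N → ℝ} {q : Conf N} {S₀ : Conf N →L[ℝ] Conf N}
    (hsym : ContinuousLinearMap.adjoint S₀ = S₀)
    (h : ∀ i j, hessian V q i j =
      2 * ⟪S₀ (EuclideanSpace.single i 1), EuclideanSpace.single j (1 : ℝ)⟫_ℝ) :
    ((1 / 2 : ℝ) • hessian V q).det = LinearMap.det (S₀ : Conf N →ₗ[ℝ] Conf N) := by
  rw [← LinearMap.det_toMatrix (EuclideanSpace.basisFun (Fin N) ℝ).toBasis]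
  congr 1
  ext i j
  rw [Matrix.smul_apply, h, LinearMap.toMatrix_apply]
  have : ⟪S₀ (EuclideanSpace.single i 1), EuclideanSpace.single j (1 : ℝ)⟫_ℝ =
      ⟪EuclideanSpace.single i (1 : ℝ), S₀ (EuclideanSpace.single j (1 : ℝ))⟫_ℝ := by
    rw [← ContinuousLinearMap.adjoint_inner_right, hsym]
  rw [this]
  simp [EuclideanSpace.inner_single_left]

theorem hessian_isHermitian {V : Conf N → ℝ} {q : Conf N} {S₀ : Conf N →L[ℝ] Conf N}
    (hsym : ContinuousLinearMap.adjoint S₀ = S₀)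
    (h : ∀ i j, hessian V q i j =
      2 * ⟪S₀ (EuclideanSpace.single i 1), EuclideanSpace.single j (1 : ℝ)⟫_ℝ) :
    (hessian V q).IsHermitian := by
  ext i j
  rw [Matrix.conjTranspose_apply, h, h, star_trivial, ← ContinuousLinearMap.adjoint_inner_right,
    hsym, real_inner_comm]

/-- A nondegenerate symmetric operator is brought to normal form by a linear change of variables;
the number of negative squares is the number of negative eigenvalues. -/
theorem exists_linear_normal_form {V : Conf N → ℝ} {q : Conf N} {S₀ : Conf N →L[ℝ] Conf N}
    (hsym : ContinuousLinearMap.adjoint S₀ = S₀)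
    (h : ∀ i j, hessian V q i j =
      2 * ⟪S₀ (EuclideanSpace.single i 1), EuclideanSpace.single j (1 : ℝ)⟫_ℝ)
    (hdet : (hessian V q).det ≠ 0) :
    ∃ P : Conf N ≃L[ℝ] Conf N, ∀ u, ⟪S₀ u, u⟫_ℝ = morseForm (morseIndex V q) (P u) := by
  have hH := hessian_isHermitian hsym h
  set b := hH.eigenvectorBasis with hb
  set lam := hH.eigenvalues with hlam
  have hlam0 : ∀ i, lam i ≠ 0 := fun i h0 => hdet (by
    rw [hH.det_eq_prod_eigenvalues]
    exact Finset.prod_eq_zero (Finset.mem_univ i) (by simpa using h0))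
  have hSH : ∀ u : Conf N, ∀ i, S₀ u i = (1 / 2) * ((hessian V q).mulVec u) i := fun u i => by
    have hu : u = ∑ j, u j • EuclideanSpace.single j (1 : ℝ) := by
      ext j; simp [Finset.sum_apply, Pi.single_apply]
    conv_lhs => rw [hu]
    simp only [map_sum, map_smul, Matrix.mulVec, dotProduct]
    rw [Finset.mul_sum]
    simp only [WithLp.ofLp_sum, Finset.sum_apply, PiLp.smul_apply, smul_eq_mul]
    refine Finset.sum_congr rfl fun j _ => ?_
    have h1 : hessian V q i j = hessian V q j i := by
      have := congrFun (congrFun hH i) j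
      simpa [Matrix.conjTranspose_apply] using this.symm
    rw [h1, h]
    simp [EuclideanSpace.inner_single_right]
    ring
  have hSb : ∀ j, S₀ (b j) = (lam j / 2) • b j := fun j => by
    ext i
    rw [hSH, hH.mulVec_eigenvectorBasis]
    simp [hb, hlam]
    ring
  have hquad : ∀ u, ⟪S₀ u, u⟫_ℝ = ∑ j, (lam j / 2) * (b.repr u j) ^ 2 := fun u => by
    have h1 : S₀ u = ∑ j, (b.repr u j * (lam j / 2)) • b j := by
      conv_lhs => rw [← b.sum_repr u]
      simp [map_sum, hSb, smul_smul]
    rw [h1, sum_inner]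
    refine Finset.sum_congr rfl fun j _ => ?_
    rw [inner_smul_left, ← b.repr_apply_apply]
    simp
    ring
  have hcard : Fintype.card {i : Fin N // i.val < morseIndex V q} =
      Fintype.card {i : Fin N // lam i < 0} := by
    have h1 : morseIndex V q = Fintype.card {i : Fin N // lam i < 0} := by
      rw [morseIndex, hH.roots_charpoly_eq_eigenvalues, Multiset.countP_map, Fintype.card_subtype]
      rfl
    have h2 : morseIndex V q ≤ N := by
      rw [h1]; exact (Fintype.card_subtype_le _).trans_eq (Fintype.card_fin N)
    rw [← h1, Fintype.card_subtype]
    rw [Fin.card_filter_val_lt, min_eq_right h2]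
  -- The form has eigenvalues `lam j / 2`. The permutation puts the negative ones into the first
  -- places, and P rescales the eigencoordinates by the square roots of |lam j| / 2.
  set σ : Equiv.Perm (Fin N) := (Fintype.equivOfCardEq hcard).extendSubtype with hσ
  have hσ1 : ∀ i : Fin N, i.val < morseIndex V q → lam (σ i) < 0 := fun i hi =>
    (Fintype.equivOfCardEq hcard).extendSubtype_mem i hi
  have hσ2 : ∀ i : Fin N, ¬ i.val < morseIndex V q → ¬ lam (σ i) < 0 := fun i hi =>
    (Fintype.equivOfCardEq hcard).extendSubtype_not_mem i hi
  set P : Conf N →ₗ[ℝ] Conf N :=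
    { toFun := fun u => WithLp.toLp 2 fun i => Real.sqrt (|lam (σ i)| / 2) * b.repr u (σ i)
      map_add' := fun u v => by ext i; simp [mul_add]
      map_smul' := fun c u => by ext i; simp; ring } with hP
  have hPinj : Function.Injective P := by
    rw [← LinearMap.ker_eq_bot, LinearMap.ker_eq_bot']
    intro u hu
    have h1 : ∀ i, b.repr u i = 0 := fun i => by
      have h2 := congrArg (fun x : Conf N => x (σ.symm i)) hu
      simp only [hP, LinearMap.coe_mk, AddHom.coe_mk, Equiv.apply_symm_apply, PiLp.zero_apply] at h2
      refine (mul_eq_zero.1 h2).resolve_left ?_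
      refine Real.sqrt_ne_zero'.2 ?_
      have := hlam0 i
      positivity
    apply b.repr.injective
    ext i
    simpa using h1 i
  refine ⟨(LinearEquiv.ofInjectiveEndo P hPinj).toContinuousLinearEquiv, fun u => ?_⟩
  rw [hquad, morseForm_eq_sum, ← Equiv.sum_comp σ]
  refine Finset.sum_congr rfl fun i _ => ?_
  have h1 : ((LinearEquiv.ofInjectiveEndo P hPinj).toContinuousLinearEquiv u) i =
    Real.sqrt (|lam (σ i)| / 2) * b.repr u (σ i) := rfl
  rw [h1, mul_pow, Real.sq_sqrt (by positivity)]
  split_ifs with hi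
  · rw [abs_of_neg (hσ1 i hi)]; ring
  · rw [abs_of_nonneg (not_lt.1 (hσ2 i hi))]; ring

end MorseChart

/-! ### Existence of Morse charts and the Jacobian at the critical point -/

section MorseChart

open scoped InnerProductSpace ContDiff

variable {N : ℕ}

theorem morseIndex_le (V : Conf N → ℝ) (q : Conf N) : morseIndex V q ≤ N := by
  refine (Multiset.countP_le_card _ _).trans ((Polynomial.card_roots' _).trans ?_)
  rw [Matrix.charpoly_natDegree_eq_dim, Fintype.card_fin]

/-- Analytic Morse lemma. -/
theorem exists_isMorseChart {G : Set (Conf N)} (hG : IsOpen G) {V : Conf N → ℝ} {qc : Conf N}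
    (hqc : qc ∈ G) (hV : AnalyticAt ℝ V qc) (h0 : V qc = 0) (h1 : fderiv ℝ V qc = 0)
    (hdet : (hessian V qc).det ≠ 0) :
    ∃ q : OpenPartialHomeomorph (Conf N) (Conf N), IsMorseChart V G qc (morseIndex V qc) q := by
  obtain ⟨S, hS, hsym, hVS⟩ := hV.exists_quadratic h0 h1
  have hH := hessian_eq_of_quadratic hS hsym hVS
  obtain ⟨P, hP⟩ := exists_linear_normal_form (hsym 0) hH hdet
  have hdetS : LinearMap.det (S 0 : Conf N →ₗ[ℝ] Conf N) ≠ 0 := by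
    rw [← det_half_hessian (hsym 0) hH, Matrix.det_smul]
    exact mul_ne_zero (by positivity) hdet
  have hunit : IsUnit (S 0) := by
    set e := (LinearEquiv.ofIsUnitDet (v := (EuclideanSpace.basisFun (Fin N) ℝ).toBasis)
      (v' := (EuclideanSpace.basisFun (Fin N) ℝ).toBasis) (f := (S 0 : Conf N →ₗ[ℝ] Conf N))
      (by rw [LinearMap.det_toMatrix]; exact hdetS.isUnit)).toContinuousLinearEquiv
    exact ⟨ContinuousLinearEquiv.toUnit e, by ext1 x; rfl⟩
  obtain ⟨C, hC, hC0, hCS⟩ := exists_congruence hS hsym hunit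
  -- This is the inverse chart: with y = p - qc, V = ⟪S(y) y, y⟫ = ⟪S(0) C(y)y, C(y)y⟫, which P
  -- brings to normal form. Its derivative at qc is P, because C(0) = 1.
  set ψ : Conf N → Conf N := fun p => P (C (p - qc) (p - qc)) with hψ
  have hsub : AnalyticAt ℝ (fun p : Conf N => p - qc) qc := by fun_prop
  have hψa : AnalyticAt ℝ ψ qc := by
    have h2 : AnalyticAt ℝ (fun p => C (p - qc)) qc := by
      refine AnalyticAt.fun_comp (g := C) ?_ hsub
      simpa using hC
    have h3 : AnalyticAt ℝ (fun p => C (p - qc) (p - qc)) qc :=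
      (ContDiffAt.clm_apply (n := ω) h2.contDiffAt hsub.contDiffAt).analyticAt
    exact AnalyticAt.fun_comp (g := fun x => P x)
      ((P : Conf N →L[ℝ] Conf N).analyticAt _) h3
  have hψ0 : ψ qc = 0 := by simp [hψ]
  have hψd : HasFDerivAt ψ (P : Conf N →L[ℝ] Conf N) qc := by
    have h2 : HasFDerivAt (fun y => C y y) (C 0) (qc - qc) := by
      rw [sub_self]; exact hasFDerivAt_clm_apply_self hC.differentiableAt
    have h3 := HasFDerivAt.comp (f := fun p : Conf N => p - qc) qc h2
      ((hasFDerivAt_id (𝕜 := ℝ) qc).sub_const qc)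
    have h4 := (P : Conf N →L[ℝ] Conf N).hasFDerivAt.comp qc h3
    refine h4.congr_fderiv ?_
    ext1 v; simp [hC0]
  have hn : (ω : WithTop ℕ∞) ≠ 0 := by simp
  have hcd : ContDiffAt ℝ ω ψ qc := hψa.contDiffAt
  set Φ := hcd.toOpenPartialHomeomorph ψ hψd hn with hΦ
  have hΦψ : ∀ p, Φ p = ψ p := fun p => rfl
  have hmem : qc ∈ Φ.source := hcd.mem_toOpenPartialHomeomorph_source hψd hn
  have hform : ∀ᶠ p in 𝓝 qc, V p = morseForm (morseIndex V qc) (ψ p) := by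
    have ht : Tendsto (fun p : Conf N => p - qc) (𝓝 qc) (𝓝 0) := by
      simpa using hsub.continuousAt.tendsto
    filter_upwards [ht.eventually hVS, ht.eventually hCS] with p hp1 hp2
    rw [hψ, ← hP, hp2, ← hp1, add_sub_cancel]
  obtain ⟨O, hO, hOo, hOmem⟩ := eventually_nhds_iff.1
    ((hform.and hψa.eventually_analyticAt).and (hG.eventually_mem hqc))
  have hsymm : AnalyticAt ℝ Φ.symm 0 := by
    have := Φ.analyticAt_symm' hmem hψa hψd.fderiv
    rwa [hΦψ, hψ0] at this
  obtain ⟨O', hO', hO'o, hO'mem⟩ := eventually_nhds_iff.1 hsymm.eventually_analyticAt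
  -- On O, which lies in G, the normal form holds and ψ is analytic; on O' the inverse is analytic.
  -- Both restrictions are needed on the whole chart domain.
  set Θ := (Φ.symm.restrOpen O' hO'o).symm.restrOpen O hOo with hΘ
  have hΘs : Θ.source = (Φ.source ∩ Φ ⁻¹' O') ∩ O := by
    simp [hΘ, inter_comm]
  have hsrc : ∀ p ∈ Θ.source, p ∈ O ∧ ψ p ∈ O' := fun p hp => by
    rw [hΘs] at hp; exact ⟨hp.2, hp.1.2⟩
  refine ⟨Θ.symm, ?_, ?_, ?_, ?_, ?_, ?_⟩
  · have : qc ∈ Θ.source := by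
      rw [hΘs]; exact ⟨⟨hmem, by simpa [hΦψ, hψ0] using hO'mem⟩, hOmem⟩
    have h2 := Θ.map_source this
    have h3 : Θ qc = 0 := hψ0
    rwa [h3] at h2
  · have : qc ∈ Θ.source := by
      rw [hΘs]; exact ⟨⟨hmem, by simpa [hΦψ, hψ0] using hO'mem⟩, hOmem⟩
    have h2 := Θ.left_inv this
    have h3 : Θ qc = 0 := hψ0
    rwa [h3] at h2
  · intro p hp
    exact (hO p (hsrc p hp).1).2
  · intro x hx
    have h2 : Θ.symm x ∈ Θ.source := Θ.map_target hx
    have h3 : ψ (Θ.symm x) = x := Θ.right_inv hx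
    have := hO' _ (hsrc _ h2).2
    rw [h3] at this
    exact this
  · intro p hp
    exact (hO p (hsrc p hp).1).1.2
  · intro x hx
    have h2 : Θ.symm x ∈ Θ.source := Θ.map_target hx
    have h3 : ψ (Θ.symm x) = x := Θ.right_inv hx
    have := (hO _ (hsrc _ h2).1).1.1
    rw [h3] at this
    exact this

/-- The Jacobian determinant of a Morse chart at the critical point. -/
theorem abs_det_fderiv_isMorseChart {G : Set (Conf N)} {V : Conf N → ℝ} {qc : Conf N} {k : ℕ}
    (hV : AnalyticAt ℝ V qc) (h0 : V qc = 0) (h1 : fderiv ℝ V qc = 0)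
    {q : OpenPartialHomeomorph (Conf N) (Conf N)} (hq : IsMorseChart V G qc k q) :
    jacobianDet q 0 ^ 2 * |((1 / 2 : ℝ) • hessian V qc).det| = 1 := by
  obtain ⟨S, hS, hsym, hVS⟩ := hV.exists_quadratic h0 h1
  have hH := hessian_eq_of_quadratic hS hsym hVS
  set L := fderiv ℝ q 0 with hL
  have hqd : HasFDerivAt q L 0 := (hq.analytic 0 hq.zero_mem).differentiableAt.hasFDerivAt
  -- Along the ray t u the function V is exactly t² times the normal form at u; dividing the
  -- quadratic expression of V by t² and letting t → 0 leaves the form of S(0) at L u.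
  have hquad : ∀ u, ⟪S 0 (L u), L u⟫_ℝ = morseForm k u := fun u => by
    set φ : ℝ → Conf N := fun t => q (t • u) - qc with hφ
    have hφd : HasDerivAt φ (L u) 0 := by
      have h2 : HasDerivAt (fun t : ℝ => t • u) u 0 := by
        simpa using (hasDerivAt_id (0 : ℝ)).smul_const u
      have h3 : HasFDerivAt q L ((0 : ℝ) • u) := by rwa [zero_smul]
      exact (h3.comp_hasDerivAt 0 h2).sub_const qc
    have hφ0 : φ 0 = 0 := by simp [hφ, hq.map_zero]
    have hφt : Tendsto φ (𝓝 0) (𝓝 0) := by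
      have := hφd.continuousAt.tendsto
      rwa [hφ0] at this
    have hslope : Tendsto (fun t => t⁻¹ • φ t) (𝓝[≠] 0) (𝓝 (L u)) := by
      have := hasDerivAt_iff_tendsto_slope_zero.1 hφd
      simpa [hφ0] using this
    have hSt : Tendsto (fun t => S (φ t)) (𝓝[≠] 0) (𝓝 (S 0)) :=
      (hS.continuousAt.tendsto.comp hφt).mono_left nhdsWithin_le_nhds
    have hlim : Tendsto (fun t => ⟪S (φ t) (t⁻¹ • φ t), t⁻¹ • φ t⟫_ℝ) (𝓝[≠] 0)
        (𝓝 ⟪S 0 (L u), L u⟫_ℝ) := 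
      ((isBoundedBilinearMap_apply.continuous.tendsto _).comp (hSt.prodMk_nhds hslope)).inner hslope
    have hsrc : ∀ᶠ t : ℝ in 𝓝 0, t • u ∈ q.source := by
      have : ContinuousAt (fun t : ℝ => t • u) 0 := by fun_prop
      refine this.eventually_mem (q.open_source.mem_nhds ?_)
      simpa using hq.zero_mem
    have hconst : ∀ᶠ t in 𝓝[≠] (0 : ℝ),
        ⟪S (φ t) (t⁻¹ • φ t), t⁻¹ • φ t⟫_ℝ = morseForm k u := by
      filter_upwards [nhdsWithin_le_nhds (hφt.eventually hVS), nhdsWithin_le_nhds hsrc,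
        self_mem_nhdsWithin] with t h2 h3 h4
      have h4' : t ≠ 0 := h4
      have h5 := hq.normal_form _ h3
      rw [hφ, add_sub_cancel, h5] at h2
      simp only [map_smul, inner_smul_left, inner_smul_right]
      change _ = ⟪S (φ t) (φ t), φ t⟫_ℝ at h2
      rw [← h2]
      change _ * (_ * morseForm k (t • u)) = _
      rw [morseForm_eq_sum, morseForm_eq_sum, Finset.mul_sum, Finset.mul_sum]
      refine Finset.sum_congr rfl fun i _ => ?_
      simp only [PiLp.smul_apply, smul_eq_mul, conj_trivial]
      field_simp
    exact tendsto_nhds_unique hlim (tendsto_const_nhds.congr' (hconst.mono fun _ h => h.symm))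
  set D : Conf N →L[ℝ] Conf N := LinearMap.toContinuousLinearMap
    (Matrix.toLin (EuclideanSpace.basisFun (Fin N) ℝ).toBasis (EuclideanSpace.basisFun (Fin N) ℝ).toBasis
      (Matrix.diagonal fun i : Fin N => if i.val < k then (-1 : ℝ) else 1)) with hD
  have hDi : ∀ u i, D u i = (if i.val < k then (-1 : ℝ) else 1) * u i := fun u i => by
    rw [hD, ← Matrix.toEuclideanLin_eq_toLin_orthonormal]
    simp [Matrix.toLpLin_apply, Matrix.mulVec_diagonal]
  have hDet : |LinearMap.det (D : Conf N →ₗ[ℝ] Conf N)| = 1 := by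
    rw [hD, LinearMap.coe_toContinuousLinearMap, LinearMap.det_toLin, Matrix.det_diagonal,
      Finset.abs_prod]
    refine Finset.prod_eq_one fun i _ => ?_
    split_ifs <;> simp
  -- A symmetric operator whose quadratic form vanishes is zero, so `hquad` becomes an operator
  -- identity, whose determinants can be compared.
  have hLSL : (ContinuousLinearMap.adjoint L * S 0 * L - D : Conf N →L[ℝ] Conf N) = 0 := by
    have hsymm : ((ContinuousLinearMap.adjoint L * S 0 * L - D : Conf N →L[ℝ] Conf N) :
        Conf N →ₗ[ℝ] Conf N).IsSymmetric := by
      intro u v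
      simp only [ContinuousLinearMap.coe_coe, sub_apply, mul_apply_eq_comp, inner_sub_left,
        inner_sub_right, ContinuousLinearMap.adjoint_inner_left,
        ContinuousLinearMap.adjoint_inner_right]
      congr 1
      · rw [← ContinuousLinearMap.adjoint_inner_right, hsym]
      · simp only [PiLp.inner_apply, hDi]
        exact Finset.sum_congr rfl fun i _ => by simp
    have h2 := hsymm.inner_map_self_eq_zero.1 fun u => by
      simp only [ContinuousLinearMap.coe_coe, sub_apply, mul_apply_eq_comp, inner_sub_left,
        ContinuousLinearMap.adjoint_inner_left, hquad, morseForm_eq_sum, PiLp.inner_apply, hDi]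
      rw [← Finset.sum_sub_distrib]
      refine Finset.sum_eq_zero fun i _ => ?_
      simp
      split_ifs <;> ring
    exact ContinuousLinearMap.coe_injective h2
  have hadj : LinearMap.det (ContinuousLinearMap.adjoint L : Conf N →ₗ[ℝ] Conf N) =
      LinearMap.det (L : Conf N →ₗ[ℝ] Conf N) := by
    rw [← LinearMap.det_toMatrix (EuclideanSpace.basisFun (Fin N) ℝ).toBasis,
      ← LinearMap.det_toMatrix (EuclideanSpace.basisFun (Fin N) ℝ).toBasis
        (L : Conf N →ₗ[ℝ] Conf N)]
    have h2 := LinearMap.toMatrix_adjoint (EuclideanSpace.basisFun (Fin N) ℝ)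
      (EuclideanSpace.basisFun (Fin N) ℝ) (L : Conf N →ₗ[ℝ] Conf N)
    have h3 : (ContinuousLinearMap.adjoint L : Conf N →ₗ[ℝ] Conf N) =
      LinearMap.adjoint (L : Conf N →ₗ[ℝ] Conf N) := rfl
    rw [h3, h2, Matrix.det_conjTranspose, star_trivial]
  have h3 : LinearMap.det ((ContinuousLinearMap.adjoint L * S 0 * L : Conf N →L[ℝ] Conf N) :
      Conf N →ₗ[ℝ] Conf N) = LinearMap.det (L : Conf N →ₗ[ℝ] Conf N) *
        LinearMap.det (S 0 : Conf N →ₗ[ℝ] Conf N) * LinearMap.det (L : Conf N →ₗ[ℝ] Conf N) := by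
    conv_rhs => enter [1, 1]; rw [← hadj]
    rw [← LinearMap.det_comp, ← LinearMap.det_comp]
    rfl
  rw [sub_eq_zero.1 hLSL] at h3
  rw [det_half_hessian (hsym 0) hH, jacobianDet]
  change |LinearMap.det (L : Conf N →ₗ[ℝ] Conf N)| ^ 2 * _ = 1
  rw [← hDet, h3, abs_mul, abs_mul]
  ring

end MorseChart

/-! ### Polar coordinates and moments of the sphere -/

section Polar

variable {ι : Type*} [Fintype ι]

/-- The unit sphere of `ℝ^ι`. -/
abbrev USphere (ι : Type*) [Fintype ι] : Type _ := Metric.sphere (0 : EuclideanSpace ℝ ι) 1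

/-- The surface measure of the unit sphere of `ℝ^ι`. -/
noncomputable abbrev surfaceMeasure (ι : Type*) [Fintype ι] : Measure (USphere ι) :=
  (volume : Measure (EuclideanSpace ℝ ι)).toSphere

theorem smul_homeomorphUnitSphereProd (x : ({0}ᶜ : Set (EuclideanSpace ℝ ι))) :
    ((homeomorphUnitSphereProd (EuclideanSpace ℝ ι) x).2 : ℝ) •
      ((homeomorphUnitSphereProd (EuclideanSpace ℝ ι) x).1 : EuclideanSpace ℝ ι) = x := by
  have h := congrArg Subtype.val ((homeomorphUnitSphereProd (EuclideanSpace ℝ ι)).symm_apply_apply x)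
  simpa only [homeomorphUnitSphereProd_symm_apply_coe] using h

/-- The radial variable is s = r², for which r^(n-1) dr = ½ s^(n/2-1) ds; squared radii make the
Morse form linear. -/
theorem lintegral_polar [Nonempty ι] {f : EuclideanSpace ℝ ι → ENNReal} (hf : Measurable f) :
    ∫⁻ x, f x = ∫⁻ ω : USphere ι, ∫⁻ s in Ioi (0 : ℝ),
      ENNReal.ofReal (1 / 2 * s ^ ((Fintype.card ι : ℝ) / 2 - 1)) * f (√s • (ω : EuclideanSpace ℝ ι))
        ∂volume ∂(surfaceMeasure ι) := by
  have hcard : 0 < Fintype.card ι := Fintype.card_pos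
  have h1 : ∫⁻ x, f x = ∫⁻ x : ({0}ᶜ : Set (EuclideanSpace ℝ ι)), f x
      ∂(volume : Measure (EuclideanSpace ℝ ι)).comap (↑) := by
    rw [lintegral_subtype_comap (measurableSet_singleton _).compl, restrict_compl_singleton]
  have hg : Measurable fun p : USphere ι × Ioi (0 : ℝ) =>
      f ((p.2 : ℝ) • (p.1 : EuclideanSpace ℝ ι)) := hf.comp (by fun_prop)
  have h2 := (volume : Measure (EuclideanSpace ℝ ι)).measurePreserving_homeomorphUnitSphereProd
    |>.lintegral_comp hg
  simp only [smul_homeomorphUnitSphereProd] at h2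
  rw [h1, h2, lintegral_prod _ hg.aemeasurable]
  refine lintegral_congr fun ω => ?_
  have hgω : Measurable fun r : Ioi (0 : ℝ) => f ((r : ℝ) • (ω : EuclideanSpace ℝ ι)) :=
    hf.comp (by fun_prop)
  rw [Measure.volumeIoiPow, lintegral_withDensity_eq_lintegral_mul _ (by fun_prop) hgω,
    finrank_euclideanSpace]
  simp only [Pi.mul_apply]
  rw [lintegral_subtype_comap measurableSet_Ioi (fun r : ℝ => ENNReal.ofReal (r ^ (Fintype.card ι - 1)) *
    f (r • (ω : EuclideanSpace ℝ ι)))]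
  have himg : (fun r : ℝ => r ^ 2) '' Ioi 0 = Ioi 0 := by
    ext s
    constructor
    · rintro ⟨r, hr, rfl⟩
      exact pow_pos (mem_Ioi.1 hr) 2
    · intro hs
      exact ⟨√s, Real.sqrt_pos.2 hs, Real.sq_sqrt (le_of_lt hs)⟩
  have h3 := lintegral_image_eq_lintegral_abs_deriv_mul (f := fun r : ℝ => r ^ 2)
    (f' := fun r => 2 * r) (s := Ioi 0) measurableSet_Ioi
    (fun r _ => by simpa using (hasDerivAt_pow 2 r).hasDerivWithinAt)
    (fun a ha b hb hab => (pow_left_inj₀ (le_of_lt ha) (le_of_lt hb) two_ne_zero).1 hab)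
    (fun s => ENNReal.ofReal (1 / 2 * s ^ ((Fintype.card ι : ℝ) / 2 - 1)) *
      f (√s • (ω : EuclideanSpace ℝ ι)))
  rw [himg] at h3
  rw [h3]
  refine setLIntegral_congr_fun measurableSet_Ioi fun r hr => ?_
  have hr0 : 0 < r := hr
  rw [Real.sqrt_sq hr0.le, ← mul_assoc, ← ENNReal.ofReal_mul (abs_nonneg _),
    abs_of_pos (by positivity)]
  congr 2
  have h4 : (r ^ 2) ^ ((Fintype.card ι : ℝ) / 2 - 1) = r ^ ((Fintype.card ι : ℝ) - 2) := by
    rw [← Real.rpow_natCast r 2, ← Real.rpow_mul hr0.le]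
    congr 1; push_cast; ring
  rw [h4, ← Real.rpow_natCast, Nat.cast_sub hcard]
  have h5 : ((Fintype.card ι : ℝ) - (1 : ℕ)) = 1 + ((Fintype.card ι : ℝ) - 2) := by push_cast; ring
  rw [h5, Real.rpow_add hr0, Real.rpow_one]
  ring

theorem integral_pow_mul_exp_neg_sq (n : ℕ) :
    ∫ x : ℝ, x ^ (2 * n) * Real.exp (-x ^ 2) = Real.Gamma (n + 1 / 2) := by
  have h1 : (fun x : ℝ => x ^ (2 * n) * Real.exp (-x ^ 2)) =
      fun x => (fun y : ℝ => y ^ (2 * n) * Real.exp (-y ^ 2)) |x| := by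
    funext x; simp only [sq_abs, pow_mul]
  rw [h1, integral_comp_abs (f := fun y : ℝ => y ^ (2 * n) * Real.exp (-y ^ 2))]
  have h2 := integral_rpow_mul_exp_neg_rpow (p := 2) (q := (2 * n : ℕ)) two_pos
    (by have : (0 : ℝ) ≤ (2 * n : ℕ) := Nat.cast_nonneg _
        linarith)
  simp only [Real.rpow_natCast] at h2
  have h3 : ∀ x : ℝ, x ^ (2 : ℝ) = x ^ 2 := fun x => by exact_mod_cast Real.rpow_natCast x 2
  simp only [h3] at h2
  rw [h2]
  have : (((2 * n : ℕ) : ℝ) + 1) / 2 = n + 1 / 2 := by push_cast; ring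
  rw [this]
  ring

theorem integral_odd_pow_mul_exp_neg_sq {n : ℕ} (hn : Odd n) :
    ∫ x : ℝ, x ^ n * Real.exp (-x ^ 2) = 0 := by
  have h := integral_neg_eq_self (fun x : ℝ => x ^ n * Real.exp (-x ^ 2)) volume
  simp only [hn.neg_pow, neg_sq, neg_mul, integral_neg] at h
  linarith

theorem integral_prod_pow_mul_exp_neg_norm_sq (n : ι → ℕ) :
    ∫ x : EuclideanSpace ℝ ι, (∏ i, x i ^ n i) * Real.exp (-‖x‖ ^ 2) =
      ∏ i, ∫ x : ℝ, x ^ n i * Real.exp (-x ^ 2) := by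
  rw [← integral_fintype_prod_volume_eq_prod (fun i (x : ℝ) => x ^ n i * Real.exp (-x ^ 2)),
    ← (EuclideanSpace.volume_preserving_symm_measurableEquiv_toLp ι).integral_comp'
      (fun y : ι → ℝ => ∏ i, (y i ^ n i * Real.exp (-y i ^ 2)))]
  refine integral_congr_ae (Eventually.of_forall fun x => ?_)
  simp only [MeasurableEquiv.toLp_symm_apply, Finset.prod_mul_distrib, ← Real.exp_sum,
    EuclideanSpace.norm_sq_eq, Real.norm_eq_abs, sq_abs, Finset.sum_neg_distrib]

/-- A monomial times exp(-‖x‖²) is integrated in two ways: in Cartesian coordinates it factorizes,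
in polar coordinates the radial part is a Gamma integral. -/
theorem sphere_moment_mul_Gamma [Nonempty ι] (n : ι → ℕ) :
    (∫ ω : USphere ι, ∏ i, (ω : EuclideanSpace ℝ ι) i ^ n i ∂(surfaceMeasure ι)) *
      (1 / 2 * Real.Gamma (((Fintype.card ι : ℝ) + ∑ i, n i) / 2)) =
      ∏ i, ∫ x : ℝ, x ^ n i * Real.exp (-x ^ 2) := by
  have hcard : 0 < Fintype.card ι := Fintype.card_pos
  rw [← integral_prod_pow_mul_exp_neg_norm_sq]
  set f : EuclideanSpace ℝ ι → ℝ := fun x => (∏ i, x i ^ n i) * Real.exp (-‖x‖ ^ 2) with hf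
  have h1 : ∫ x, f x = ∫ x : ({0}ᶜ : Set (EuclideanSpace ℝ ι)), f x
      ∂(volume : Measure (EuclideanSpace ℝ ι)).comap (↑) := by
    rw [integral_subtype_comap (measurableSet_singleton _).compl, restrict_compl_singleton]
  have h2 := (volume : Measure (EuclideanSpace ℝ ι)).measurePreserving_homeomorphUnitSphereProd
    |>.integral_comp (Homeomorph.measurableEmbedding _)
      (fun p : USphere ι × Ioi (0 : ℝ) => f ((p.2 : ℝ) • (p.1 : EuclideanSpace ℝ ι)))
  simp only [smul_homeomorphUnitSphereProd] at h2
  rw [h1, h2]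
  have h3 : ∀ p : USphere ι × Ioi (0 : ℝ), f ((p.2 : ℝ) • (p.1 : EuclideanSpace ℝ ι)) =
      (∏ i, (p.1 : EuclideanSpace ℝ ι) i ^ n i) *
        ((p.2 : ℝ) ^ (∑ i, n i) * Real.exp (-(p.2 : ℝ) ^ 2)) := fun p => by
    have hnorm : ‖(p.1 : EuclideanSpace ℝ ι)‖ = 1 := by simp
    simp only [hf, PiLp.smul_apply, smul_eq_mul, mul_pow, Finset.prod_mul_distrib,
      Finset.prod_pow_eq_pow_sum, norm_smul, hnorm, mul_one, Real.norm_eq_abs, sq_abs]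
    ring
  simp only [h3]
  rw [integral_prod_mul (fun ω : USphere ι => ∏ i, (ω : EuclideanSpace ℝ ι) i ^ n i)
    (fun r : Ioi (0 : ℝ) => (r : ℝ) ^ (∑ i, n i) * Real.exp (-(r : ℝ) ^ 2))]
  congr 1
  simp only [Measure.volumeIoiPow, ENNReal.ofReal]
  rw [integral_withDensity_eq_integral_smul
    (measurable_subtype_coe.pow_const _).real_toNNReal,
    integral_subtype_comap measurableSet_Ioi fun r : ℝ =>
      Real.toNNReal (r ^ (Module.finrank ℝ (EuclideanSpace ℝ ι) - 1)) •
        (r ^ (∑ i, n i) * Real.exp (-r ^ 2)), finrank_euclideanSpace]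
  have h4 := integral_rpow_mul_exp_neg_rpow (p := 2)
    (q := (Fintype.card ι - 1 + ∑ i, n i : ℕ)) two_pos
    (lt_of_lt_of_le (by norm_num) (Nat.cast_nonneg _))
  have h5 : ((Fintype.card ι - 1 + ∑ i, n i : ℕ) : ℝ) + 1 = (Fintype.card ι : ℝ) + ∑ i, n i := by
    rw [Nat.cast_add, Nat.cast_sub hcard]; push_cast; ring
  rw [h5] at h4
  push_cast at h4 ⊢
  rw [← h4]
  refine setIntegral_congr_fun measurableSet_Ioi fun r hr => ?_
  have hr0 : 0 < r := hr
  have h6 : r ^ (2 : ℝ) = r ^ 2 := by exact_mod_cast Real.rpow_natCast r 2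
  simp only [NNReal.smul_def, smul_eq_mul, Real.coe_toNNReal _ (pow_nonneg hr0.le _)]
  have h7 : (((Fintype.card ι - 1 : ℕ) : ℝ) + ∑ i, (n i : ℝ)) =
      ((Fintype.card ι - 1 + ∑ i, n i : ℕ) : ℝ) := by push_cast; rfl
  rw [h6, ← mul_assoc, ← pow_add, h7, Real.rpow_natCast]

theorem sphere_moment_even [Nonempty ι] (n : ι → ℕ) :
    ∫ ω : USphere ι, ∏ i, (ω : EuclideanSpace ℝ ι) i ^ (2 * n i) ∂(surfaceMeasure ι) =
      2 * (∏ i, Real.Gamma (n i + 1 / 2)) / Real.Gamma ((Fintype.card ι : ℝ) / 2 + ∑ i, n i) := by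
  have h := sphere_moment_mul_Gamma fun i => 2 * n i
  simp only [integral_pow_mul_exp_neg_sq] at h
  have h1 : ((Fintype.card ι : ℝ) + (∑ i, (2 * n i) : ℕ)) / 2 =
      (Fintype.card ι : ℝ) / 2 + (∑ i, n i : ℕ) := by
    rw [← Finset.mul_sum]; push_cast; ring
  push_cast at h1 h
  rw [h1] at h
  have hc : (0 : ℝ) < Fintype.card ι := by exact_mod_cast Fintype.card_pos
  have h2 : Real.Gamma ((Fintype.card ι : ℝ) / 2 + ∑ i, (n i : ℝ)) ≠ 0 :=
    (Real.Gamma_pos_of_pos (by positivity)).ne'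
  push_cast
  rw [eq_div_iff h2, ← h]
  ring

theorem sphere_moment_odd [Nonempty ι] {n : ι → ℕ} {j : ι} (hj : Odd (n j)) :
    ∫ ω : USphere ι, ∏ i, (ω : EuclideanSpace ℝ ι) i ^ n i ∂(surfaceMeasure ι) = 0 := by
  have h := sphere_moment_mul_Gamma n
  rw [Finset.prod_eq_zero (Finset.mem_univ j) (integral_odd_pow_mul_exp_neg_sq hj)] at h
  have hc : (0 : ℝ) < Fintype.card ι := by exact_mod_cast Fintype.card_pos
  exact (mul_eq_zero.1 h).resolve_right
    (mul_pos (by norm_num) (Real.Gamma_pos_of_pos (by positivity))).ne'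

theorem abs_apply_le_one_of_sphere (ω : USphere ι) (i : ι) : |(ω : EuclideanSpace ℝ ι) i| ≤ 1 := by
  have h := EuclideanSpace.norm_sq_eq (ω : EuclideanSpace ℝ ι)
  have hnorm : ‖(ω : EuclideanSpace ℝ ι)‖ = 1 := by simp
  rw [hnorm] at h
  have h1 : |(ω : EuclideanSpace ℝ ι) i| ^ 2 ≤ 1 := by
    have := Finset.single_le_sum (f := fun i => ‖(ω : EuclideanSpace ℝ ι) i‖ ^ 2)
      (fun _ _ => by positivity) (Finset.mem_univ i)
    rw [← h, one_pow, Real.norm_eq_abs] at this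
    exact this
  nlinarith [abs_nonneg ((ω : EuclideanSpace ℝ ι) i)]

theorem prod_abs_pow_le_one_of_sphere (ω : USphere ι) (n : ι → ℕ) :
    ∏ i, |(ω : EuclideanSpace ℝ ι) i| ^ n i ≤ 1 :=
  Finset.prod_le_one (fun _ _ => by positivity)
    fun i _ => pow_le_one₀ (abs_nonneg _) (abs_apply_le_one_of_sphere ω i)

theorem abs_sphere_moment_le (n : ι → ℕ) :
    |∫ ω : USphere ι, ∏ i, (ω : EuclideanSpace ℝ ι) i ^ n i ∂(surfaceMeasure ι)| ≤
      (surfaceMeasure ι).real univ := by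
  have := norm_integral_le_of_norm_le_const (μ := surfaceMeasure ι) (C := 1)
    (f := fun ω : USphere ι => ∏ i, (ω : EuclideanSpace ℝ ι) i ^ n i)
    (Eventually.of_forall fun ω => by
      simpa [Finset.abs_prod, abs_pow] using prod_abs_pow_le_one_of_sphere ω n)
  simpa using this

/-- The quotient is half an even moment of the sphere, and monomials are bounded by 1 there. As the
bound is uniform in n, Gamma factors never reduce a radius of convergence. -/
theorem prod_Gamma_div_Gamma_le [Nonempty ι] (n : ι → ℕ) :
    (∏ i, Real.Gamma (n i + 1 / 2)) / Real.Gamma ((Fintype.card ι : ℝ) / 2 + ∑ i, n i) ≤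
      (surfaceMeasure ι).real univ := by
  have h1 := abs_sphere_moment_le fun i => 2 * n i
  rw [sphere_moment_even] at h1
  have hc : (0 : ℝ) < Fintype.card ι := by exact_mod_cast Fintype.card_pos
  have h2 : 0 ≤ (∏ i, Real.Gamma (n i + 1 / 2)) /
      Real.Gamma ((Fintype.card ι : ℝ) / 2 + ∑ i, n i) := by
    refine div_nonneg (Finset.prod_nonneg fun i _ => ?_) ?_ <;>
    exact (Real.Gamma_pos_of_pos (by positivity)).le
  rw [mul_div_assoc] at h1
  have := (le_abs_self _).trans h1
  linarith

end Polar

/-! ### The analytic factor -/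

section AnalyticFactor

variable {N : ℕ}

/-- Sums of real functions with uniformly summable holomorphic extensions are analytic. -/
theorem analyticOnNhd_tsum_of_complex {ι : Type*} {u : ι → ℝ} (hu : Summable u) {R : ℝ}
    {F : ι → ℂ → ℂ} (hF : ∀ i, Differentiable ℂ (F i))
    (hb : ∀ i, ∀ z : ℂ, ‖z‖ < R → ‖F i z‖ ≤ u i) {f : ι → ℝ → ℝ}
    (hf : ∀ i, ∀ x : ℝ, F i x = f i x) :
    AnalyticOnNhd ℝ (fun x => ∑' i, f i x) (Metric.ball 0 R) := by
  -- Locally uniform limits preserve holomorphy but not real analyticity, hence the complex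
  -- extensions.
  have h1 := Complex.differentiableOn_tsum_of_summable_norm hu (fun i => (hF i).differentiableOn)
    Metric.isOpen_ball (U := Metric.ball 0 R) (fun i z hz => hb i z (by simpa using hz))
  have h2 := h1.analyticOnNhd Metric.isOpen_ball
  have h3 : AnalyticOnNhd ℂ (fun z => ∑' i, F i z) (Complex.ofReal '' Metric.ball 0 R) := by
    refine h2.mono ?_
    rintro _ ⟨x, hx, rfl⟩
    simpa using hx
  have h4 := h3.re_ofReal
  refine h4.congr Metric.isOpen_ball fun x _ => ?_
  simp only [hf, ← Complex.ofReal_tsum, Complex.ofReal_re]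

theorem analyticOnNhd_tsum_mul_pow {ι : Type*} {c : ι → ℝ} {d : ι → ℕ} {R : ℝ}
    (h : ∀ ρ, 0 ≤ ρ → ρ < R → Summable fun i => |c i| * ρ ^ d i) :
    AnalyticOnNhd ℝ (fun x => ∑' i, c i * x ^ d i) (Metric.ball 0 R) := by
  intro x hx
  have hx' : |x| < R := by simpa using hx
  obtain ⟨ρ, h1, h2⟩ := exists_between hx'
  have hρ : 0 ≤ ρ := (abs_nonneg x).trans h1.le
  refine analyticOnNhd_tsum_of_complex (h ρ hρ h2) (R := ρ) (F := fun i z => (c i : ℂ) * z ^ d i)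
    (fun i => by fun_prop) (fun i z hz => ?_) (fun i x => by push_cast; rfl) x (by simpa using h1)
  rw [norm_mul, norm_pow, Complex.norm_real, Real.norm_eq_abs]
  gcongr

/-- The coefficients of the analytic factor as a function of the energy `w = N v`. -/
noncomputable def factorCoeff (N k : ℕ) (J : Conf N → ℝ) (I : Fin N → ℕ) : ℝ :=
  (-1) ^ (∑ j : Fin N with j.val < k, I j) * taylorCoeff J (fun j => 2 * I j) *
    ((∏ j, Real.Gamma (I j + 1 / 2)) / Real.Gamma ((N : ℝ) / 2 + (∑ j, I j : ℕ)))

/-- The analytic factor as a function of the energy `w = N v`. -/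
noncomputable def energyFactor (N k : ℕ) (J : Conf N → ℝ) (w : ℝ) : ℝ :=
  ∑' I : Fin N → ℕ, factorCoeff N k J I * w ^ (∑ j, I j)

theorem Gamma_natCast_add_half (n : ℕ) :
    Real.Gamma (n + 1 / 2) = (2 * n).factorial / n.factorial * √Real.pi / 4 ^ n := by
  induction n with
  | zero =>
    have := Real.Gamma_one_half_eq
    norm_num at this ⊢
    exact this
  | succ n ih =>
    have h1 : ((n + 1 : ℕ) : ℝ) + 1 / 2 = (n + 1 / 2) + 1 := by push_cast; ring
    rw [h1, Real.Gamma_add_one (by positivity), ih]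
    have h2 : (2 * (n + 1)).factorial = (2 * n + 2) * ((2 * n + 1) * (2 * n).factorial) := by
      rw [← Nat.factorial_succ, ← Nat.factorial_succ]; rfl
    rw [h2, Nat.factorial_succ]
    push_cast
    field_simp
    ring

/-- Γ(i + 1/2) = √π (2i)!/(4^i i!) converts factorials, powers of π and powers of 4 into
half-integer Gamma values; the powers of N turn v into N v. -/
theorem hAnalyticTerm_eq (hN : 0 < N) (k : ℕ) (J : Conf N → ℝ) (v : ℝ) (I : Fin N → ℕ) :
    hAnalyticTerm N k J v I = (N : ℝ) ^ ((N : ℝ) / 2 - 1) *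
      (factorCoeff N k J I * (N * v) ^ (∑ j, I j)) := by
  have hN' : (0 : ℝ) < N := by exact_mod_cast hN
  have h1 : (N : ℝ) ^ ((N : ℝ) / 2 + (∑ j, I j : ℕ) - 1) =
      (N : ℝ) ^ ((N : ℝ) / 2 - 1) * (N : ℝ) ^ (∑ j, I j) := by
    rw [← Real.rpow_natCast, ← Real.rpow_add hN']
    congr 1; ring
  have h2 : (∏ j, Real.Gamma (I j + 1 / 2)) = (∏ j, ((2 * I j).factorial : ℝ)) /
      (∏ j, ((I j).factorial : ℝ)) * Real.pi ^ ((N : ℝ) / 2) / 4 ^ (∑ j, I j) := by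
    simp only [Gamma_natCast_add_half, Finset.prod_div_distrib, Finset.prod_mul_distrib,
      Finset.prod_pow_eq_pow_sum, Finset.prod_const, Finset.card_univ, Fintype.card_fin]
    congr 2
    rw [Real.sqrt_eq_rpow, ← Real.rpow_natCast, ← Real.rpow_mul Real.pi_pos.le]
    congr 1; ring
  rw [hAnalyticTerm, factorCoeff, h1, h2, div_pow, mul_pow]
  field_simp

theorem hAnalytic_eq (hN : 0 < N) (k : ℕ) (J : Conf N → ℝ) (v : ℝ) :
    hAnalytic N k J v = (N : ℝ) ^ ((N : ℝ) / 2 - 1) * energyFactor N k J (N * v) := by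
  simp only [hAnalytic, hAnalyticTerm_eq hN, tsum_mul_left, energyFactor]

theorem two_mul_index_injective : Function.Injective fun (I : Fin N → ℕ) j => 2 * I j :=
  fun I I' h => funext fun j => by have := congrFun h j; simp only at this; omega

/-- At the point with all coordinates √ρ the monomial x^(2I) is ρ^|I|, and the Gamma quotient is
bounded. This is why the radius R in x becomes R² in energy. -/
theorem summable_factorCoeff (hN : 0 < N) (k : ℕ) {J : Conf N → ℝ} {R : ℝ}
    (hJ : ∀ x ∈ polydisc N R, Summable fun I => taylorCoeff J I * monom x I) {ρ : ℝ}
    (hρ0 : 0 ≤ ρ) (hρ : ρ < R ^ 2) (hR : 0 < R) :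
    Summable fun I => |factorCoeff N k J I| * ρ ^ (∑ j, I j) := by
  have : Nonempty (Fin N) := ⟨⟨0, hN⟩⟩
  set x : Conf N := WithLp.toLp 2 fun _ => √ρ with hx
  have hxR : x ∈ polydisc N R := fun i => by
    simp only [hx]
    rw [abs_of_nonneg (Real.sqrt_nonneg _), Real.sqrt_lt' hR]
    exact hρ
  have h1 := ((hJ x hxR).norm.comp_injective two_mul_index_injective).mul_left
    ((surfaceMeasure (Fin N)).real univ)
  refine Summable.of_nonneg_of_le (fun I => by positivity) (fun I => ?_) h1
  have hmon : monom x (fun j => 2 * I j) = ρ ^ (∑ j, I j) := by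
    simp only [monom, hx, pow_mul, Real.sq_sqrt hρ0, Finset.prod_pow_eq_pow_sum]
  have h2 := prod_Gamma_div_Gamma_le I
  have h3 : 0 ≤ (∏ i, Real.Gamma (I i + 1 / 2)) /
      Real.Gamma ((Fintype.card (Fin N) : ℝ) / 2 + ∑ i, I i) := by
    have hc : (0 : ℝ) < Fintype.card (Fin N) := by exact_mod_cast Fintype.card_pos
    refine div_nonneg (Finset.prod_nonneg fun i _ => ?_) ?_ <;>
    exact (Real.Gamma_pos_of_pos (by positivity)).le
  rw [Fintype.card_fin] at h2 h3
  push_cast at h2 h3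
  simp only [Function.comp_apply, hmon, factorCoeff, abs_mul, abs_pow, abs_neg, abs_one, one_pow,
    one_mul, norm_mul, Real.norm_eq_abs, abs_of_nonneg hρ0]
  push_cast
  rw [abs_of_nonneg h3]
  calc _ ≤ |taylorCoeff J fun j => 2 * I j| * (surfaceMeasure (Fin N)).real univ * ρ ^ (∑ j, I j) := by
        gcongr
    _ = _ := by ring

theorem analyticOnNhd_energyFactor (hN : 0 < N) (k : ℕ) {J : Conf N → ℝ} {R : ℝ} (hR : 0 < R)
    (hJ : ∀ x ∈ polydisc N R, Summable fun I => taylorCoeff J I * monom x I) :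
    AnalyticOnNhd ℝ (energyFactor N k J) (Metric.ball 0 (R ^ 2)) :=
  analyticOnNhd_tsum_mul_pow fun _ h0 h1 => summable_factorCoeff hN k hJ h0 h1 hR

theorem summable_hAnalyticTerm (hN : 0 < N) (k : ℕ) {J : Conf N → ℝ} {R : ℝ} (hR : 0 < R)
    (hJ : ∀ x ∈ polydisc N R, Summable fun I => taylorCoeff J I * monom x I) {v : ℝ}
    (hv : |v| < R ^ 2 / N) : Summable (hAnalyticTerm N k J v) := by
  have hN' : (0 : ℝ) < N := by exact_mod_cast hN
  simp only [funext (hAnalyticTerm_eq hN k J v)]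
  refine Summable.mul_left _ ?_
  have h := summable_factorCoeff hN k hJ (ρ := |N * v|) (abs_nonneg _) (by
    rw [abs_mul, Nat.abs_cast, mul_comm]; exact (lt_div_iff₀ hN').1 hv) hR
  refine Summable.of_norm_bounded h fun I => ?_
  simp [abs_mul]

theorem analyticOnNhd_hAnalytic (hN : 0 < N) (k : ℕ) {J : Conf N → ℝ} {R : ℝ} (hR : 0 < R)
    (hJ : ∀ x ∈ polydisc N R, Summable fun I => taylorCoeff J I * monom x I) :
    AnalyticOnNhd ℝ (hAnalytic N k J) (Metric.ball 0 (R ^ 2 / N)) := by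
  have hN' : (0 : ℝ) < N := by exact_mod_cast hN
  simp only [funext (hAnalytic_eq hN k J)]
  intro v hv
  refine analyticAt_const.fun_mul ?_
  refine AnalyticAt.fun_comp (g := energyFactor N k J) ?_ (by fun_prop)
  refine analyticOnNhd_energyFactor hN k hR hJ _ ?_
  rw [mem_ball_zero_iff, Real.norm_eq_abs] at hv ⊢
  rw [abs_mul, Nat.abs_cast, mul_comm]
  exact (lt_div_iff₀ hN').1 hv

theorem hAnalytic_zero_ne (hN : 0 < N) (k : ℕ) {J : Conf N → ℝ} (hJ : taylorCoeff J 0 ≠ 0) :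
    hAnalytic N k J 0 ≠ 0 := by
  have hN' : (0 : ℝ) < N := by exact_mod_cast hN
  rw [hAnalytic_eq hN]
  refine mul_ne_zero (Real.rpow_pos_of_pos hN' _).ne' ?_
  rw [energyFactor, tsum_eq_single 0]
  · have h1 : (fun j : Fin N => 2 * (0 : Fin N → ℕ) j) = 0 := by ext; simp
    simp only [factorCoeff, h1]
    have h2 : 0 < Real.Gamma ((N : ℝ) / 2 + ((∑ j, (0 : Fin N → ℕ) j : ℕ) : ℝ)) :=
      Real.Gamma_pos_of_pos (by positivity)
    have h3 : ∏ j : Fin N, Real.Gamma ((((0 : Fin N → ℕ) j : ℕ) : ℝ) + 1 / 2) ≠ 0 :=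
      Finset.prod_ne_zero_iff.2 fun i _ => (Real.Gamma_pos_of_pos (by positivity)).ne'
    have h4 : (N * 0 : ℝ) ^ (∑ j, (0 : Fin N → ℕ) j) ≠ 0 := by simp
    refine mul_ne_zero (mul_ne_zero (mul_ne_zero (by simp) hJ) (div_ne_zero h3 h2.ne')) h4
  · intro I hI
    have : ∑ j, I j ≠ 0 := fun h => hI (by
      ext j; simpa using (Finset.sum_eq_zero_iff.1 h) j (Finset.mem_univ j))
    simp [this]

end AnalyticFactor

/-! ### Nonanalyticity at zero energy -/

section Nonanalytic

/-- For m = 0 the logarithm has no finite limit. For larger m the function must vanish at 0, and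
dividing it by v (via `dslope`) lowers m. -/
theorem not_analyticAt_pow_mul_log (m : ℕ) (g : ℝ → ℝ) (hg : AnalyticAt ℝ g 0) :
    ¬ ∀ᶠ v in 𝓝[≠] (0 : ℝ), g v = v ^ m * Real.log |v| := by
  induction m generalizing g with
  | zero =>
    intro h
    have h1 : Tendsto g (𝓝[≠] 0) (𝓝 (g 0)) := hg.continuousAt.tendsto.mono_left nhdsWithin_le_nhds
    have h2 : Tendsto Real.log (𝓝[≠] 0) (𝓝 (g 0)) := by
      refine h1.congr' (h.mono fun v hv => ?_)
      simpa using hv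
    exact not_tendsto_nhds_of_tendsto_atBot Real.tendsto_log_nhdsNE_zero _ h2
  | succ m ih =>
    intro h
    have h1 : Tendsto g (𝓝[>] 0) (𝓝 (g 0)) := hg.continuousAt.tendsto.mono_left nhdsWithin_le_nhds
    have hGT : 𝓝[>] (0 : ℝ) ≤ 𝓝[≠] 0 := nhdsWithin_mono _ fun x hx => ne_of_gt hx
    have h2 : Tendsto g (𝓝[>] 0) (𝓝 0) := by
      have h3 := tendsto_log_mul_rpow_nhdsGT_zero (r := ((m + 1 : ℕ) : ℝ)) (by positivity)
      refine h3.congr' ?_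
      filter_upwards [hGT h, self_mem_nhdsWithin] with v hv hv0
      rw [hv, abs_of_pos hv0, Real.rpow_natCast, mul_comm]
    have hg0 : g 0 = 0 := tendsto_nhds_unique h1 h2
    obtain ⟨p, hp⟩ := hg
    refine ih (dslope g 0) hp.has_fpower_series_dslope_fslope.analyticAt ?_
    filter_upwards [h, self_mem_nhdsWithin] with v hv hv0
    have hv0' : v ≠ 0 := hv0
    rw [dslope_of_ne _ hv0', slope_def_field, hg0, hv, pow_succ]
    field_simp
    ring

/-- Isolated zeros: a function analytic at 0 vanishes either near 0 or nowhere on a punctured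
neighbourhood. The two filters will be the two sides of 0. -/
theorem not_analyticAt_of_zero_side {g : ℝ → ℝ} (hg : AnalyticAt ℝ g 0) {l₁ l₂ : Filter ℝ}
    [l₁.NeBot] [l₂.NeBot] (h₁ : l₁ ≤ 𝓝[≠] 0) (h₂ : l₂ ≤ 𝓝[≠] 0) (hz : ∀ᶠ v in l₁, g v = 0)
    (hn : ∀ᶠ v in l₂, g v ≠ 0) : False := by
  rcases hg.eventually_eq_zero_or_eventually_ne_zero with h | h
  · obtain ⟨v, hv, hv'⟩ := (hn.and (h₂ (nhdsWithin_le_nhds h))).exists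
    exact hv hv'
  · obtain ⟨v, hv, hv'⟩ := (hz.and (h₁ h)).exists
    exact hv' hv

theorem hNonanalytic_not_analyticAt (N κ : ℕ) (g : ℝ → ℝ) (hg : AnalyticAt ℝ g 0) :
    ¬ g =ᶠ[𝓝[≠] 0] hNonanalytic N κ := by
  intro h
  have hGT : 𝓝[>] (0 : ℝ) ≤ 𝓝[≠] 0 := nhdsWithin_mono _ fun x hx => ne_of_gt hx
  have hLT : 𝓝[<] (0 : ℝ) ≤ 𝓝[≠] 0 := nhdsWithin_mono _ fun x hx => ne_of_lt hx
  by_cases hκ : Even κ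
  · refine not_analyticAt_of_zero_side hg hLT hGT ?_ ?_
    · filter_upwards [hLT h, self_mem_nhdsWithin] with v hv hv0
      rw [hv, hNonanalytic, if_pos hκ, heaviside, if_neg (not_le.2 hv0), mul_zero]
    · filter_upwards [hGT h, self_mem_nhdsWithin] with v hv hv0
      rw [hv, hNonanalytic, if_pos hκ, heaviside, if_pos (le_of_lt hv0), mul_one]
      exact mul_ne_zero (pow_ne_zero _ (by norm_num)) (Real.rpow_pos_of_pos hv0 _).ne'
  by_cases hN : Even N
  · refine not_analyticAt_pow_mul_log ((N - 2) / 2) (fun v => (-1) ^ ((κ + 1) / 2) * Real.pi * g v)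
      (analyticAt_const.fun_mul hg) ?_
    filter_upwards [h] with v hv
    rw [hv, hNonanalytic, if_neg hκ, if_pos hN]
    have h1 : ((-1 : ℝ) ^ ((κ + 1) / 2)) * (-1) ^ ((κ + 1) / 2) = 1 := by
      rw [← mul_pow]; norm_num
    calc _ = (((-1 : ℝ) ^ ((κ + 1) / 2)) * (-1) ^ ((κ + 1) / 2)) * (v ^ ((N - 2) / 2) *
          (Real.pi * (Real.log |v| / Real.pi))) := by ring
      _ = _ := by rw [h1, mul_div_cancel₀ _ Real.pi_ne_zero, one_mul]
  · refine not_analyticAt_of_zero_side hg hGT hLT ?_ ?_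
    · filter_upwards [hGT h, self_mem_nhdsWithin] with v hv hv0
      have hv0' : 0 < v := hv0
      rw [hv, hNonanalytic, if_neg hκ, if_neg hN, heaviside, if_neg (by linarith), mul_zero]
    · filter_upwards [hLT h, self_mem_nhdsWithin] with v hv hv0
      have hv0' : v < 0 := hv0
      rw [hv, hNonanalytic, if_neg hκ, if_neg hN, heaviside, if_pos (by linarith), mul_one]
      exact mul_ne_zero (zpow_ne_zero _ (by norm_num))
        (Real.rpow_pos_of_pos (neg_pos.2 hv0') _).ne'

theorem omegaNonanalytic_not_analyticAt {N k : ℕ} {J : Conf N → ℝ}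
    (h0 : hAnalytic N k J 0 ≠ 0) (ha : AnalyticAt ℝ (hAnalytic N k J) 0) :
    ¬ ∃ g : ℝ → ℝ, AnalyticAt ℝ g 0 ∧ g =ᶠ[𝓝[≠] 0] omegaNonanalytic N k J := by
  rintro ⟨g, hg, h⟩
  refine hNonanalytic_not_analyticAt N (k % 4) (fun v => g v / hAnalytic N k J v)
    (hg.fun_div ha h0) ?_
  filter_upwards [h, nhdsWithin_le_nhds (ha.continuousAt.eventually_ne h0)] with v hv hv0
  rw [hv, omegaNonanalytic, mul_div_cancel_left₀ _ hv0]

end Nonanalytic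

/-! ### The model integrals `∫ s^(α-1) (s+w)^(β-1) ds` -/

section ModelIntegral

/-- The range of `s` for which `s` and `t = s + w` are positive and `s + t ≤ ρ`. -/
def levelRange (ρ w : ℝ) : Set ℝ := Ioc (max 0 (-w)) ((ρ - w) / 2)

/-- The model integral `∫ s^(α-1) t^(β-1) ds` over the level `t - s = w`. -/
noncomputable def modelIntegral (ρ α β w : ℝ) : ℝ :=
  ∫ s in levelRange ρ w, s ^ (α - 1) * (s + w) ^ (β - 1)

variable {ρ α β w : ℝ}

theorem levelRange_pos {s : ℝ} (hs : s ∈ levelRange ρ w) : 0 < s ∧ 0 < s + w := by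
  have h := hs.1
  exact ⟨(le_max_left _ _).trans_lt h, by linarith [(le_max_right 0 (-w)).trans_lt h]⟩

theorem levelRange_le {s : ℝ} (hs : s ∈ levelRange ρ w) : s ≤ (ρ - w) / 2 ∧ s + w ≤ (ρ + w) / 2 := by
  have h := hs.2
  exact ⟨h, by linarith⟩

theorem measurableSet_levelRange : MeasurableSet (levelRange ρ w) := measurableSet_Ioc

theorem max_lt_of_abs_lt (hw : |w| < ρ) : max 0 (-w) < (ρ - w) / 2 := by
  have := abs_lt.1 hw
  rcases le_total 0 w with h | h
  · rw [max_eq_left (by linarith)]; linarith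
  · rw [max_eq_right (by linarith)]; linarith

/-- Fundamental theorem of calculus on `levelRange`. -/
theorem integral_levelRange_eq_sub (hw : |w| < ρ) {F f : ℝ → ℝ}
    (hF : ContinuousOn F (Icc (max 0 (-w)) ((ρ - w) / 2)))
    (hd : ∀ s, 0 < s → 0 < s + w → HasDerivAt F (f s) s) (hf : IntegrableOn f (levelRange ρ w)) :
    ∫ s in levelRange ρ w, f s = F ((ρ - w) / 2) - F (max 0 (-w)) := by
  have hle := (max_lt_of_abs_lt hw).le
  rw [levelRange, ← intervalIntegral.integral_of_le hle]
  refine intervalIntegral.integral_eq_sub_of_hasDerivAt_of_le hle hF (fun s hs => ?_)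
    ((intervalIntegrable_iff_integrableOn_Ioc_of_le hle).2 hf)
  have := levelRange_pos (ρ := ρ) (Ioo_subset_Ioc_self hs)
  exact hd s this.1 this.2

theorem continuous_rpow_mul_rpow (hα : 0 < α) (hβ : 0 < β) :
    Continuous fun s : ℝ => s ^ α * (s + w) ^ β :=
  (Real.continuous_rpow_const hα.le).mul
    ((Real.continuous_rpow_const hβ.le).comp (continuous_add_const w))

theorem hasDerivAt_rpow_mul_rpow {s : ℝ} (hs : 0 < s) (hs' : 0 < s + w) :
    HasDerivAt (fun s : ℝ => s ^ α * (s + w) ^ β)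
      (α * (s ^ (α - 1) * (s + w) ^ β) + β * (s ^ α * (s + w) ^ (β - 1))) s := by
  have h1 := (hasDerivAt_id s).rpow_const (p := α) (Or.inl hs.ne')
  have h2 := ((hasDerivAt_id s).add_const w).rpow_const (p := β) (Or.inl hs'.ne')
  refine (h1.mul h2).congr_deriv ?_
  simp only [id_eq]
  ring

/-- The derivative of s^α (s+w)^β is integrable because it is nonnegative with a continuous
primitive; it is a sum of two nonnegative terms and so dominates each. -/
theorem integrableOn_levelRange_succ (hw : |w| < ρ) (hα : 0 < α) (hβ : 0 < β) :
    IntegrableOn (fun s => s ^ (α - 1) * (s + w) ^ β) (levelRange ρ w) ∧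
    IntegrableOn (fun s => s ^ α * (s + w) ^ (β - 1)) (levelRange ρ w) := by
  have hle := (max_lt_of_abs_lt hw).le
  have h1 : IntegrableOn (fun s => α * (s ^ (α - 1) * (s + w) ^ β) +
      β * (s ^ α * (s + w) ^ (β - 1))) (levelRange ρ w) := by
    refine intervalIntegral.integrableOn_deriv_of_nonneg
      (g := fun s : ℝ => s ^ α * (s + w) ^ β) (continuous_rpow_mul_rpow hα hβ).continuousOn
      (fun s hs => ?_) fun s hs => ?_ <;>
    have hp := levelRange_pos (ρ := ρ) (Ioo_subset_Ioc_self hs)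
    · exact hasDerivAt_rpow_mul_rpow hp.1 hp.2
    · have := hp.1
      have := hp.2
      positivity
  constructor
  · refine (h1.const_mul α⁻¹).mono' (Measurable.aestronglyMeasurable (by fun_prop)) ?_
    filter_upwards [ae_restrict_mem measurableSet_levelRange] with s hs
    obtain ⟨h2, h3⟩ := levelRange_pos hs
    rw [Real.norm_of_nonneg (by positivity), ← div_eq_inv_mul, le_div_iff₀ hα, mul_comm]
    have : 0 ≤ β * (s ^ α * (s + w) ^ (β - 1)) := by positivity
    linarith
  · refine (h1.const_mul β⁻¹).mono' (Measurable.aestronglyMeasurable (by fun_prop)) ?_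
    filter_upwards [ae_restrict_mem measurableSet_levelRange] with s hs
    obtain ⟨h2, h3⟩ := levelRange_pos hs
    rw [Real.norm_of_nonneg (by positivity), ← div_eq_inv_mul, le_div_iff₀ hβ, mul_comm]
    have : 0 ≤ α * (s ^ (α - 1) * (s + w) ^ β) := by positivity
    linarith

theorem rpow_mul_rpow_sub {s : ℝ} (hs : 0 < s) (hs' : 0 < s + w) :
    s ^ (α - 1) * (s + w) ^ β - s ^ α * (s + w) ^ (β - 1) =
      w * (s ^ (α - 1) * (s + w) ^ (β - 1)) := by
  have h1 : s ^ α = s ^ (α - 1) * s := by rw [← Real.rpow_add_one hs.ne']; congr 1; ring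
  have h2 : (s + w) ^ β = (s + w) ^ (β - 1) * (s + w) := by
    rw [← Real.rpow_add_one hs'.ne']; congr 1; ring
  rw [h1, h2]; ring

/-- Multiplied by w = (s + w) - s, the integrand is a difference of two integrands with one exponent
raised; so w ≠ 0 suffices. -/
theorem integrableOn_levelRange (hw : |w| < ρ) (hw0 : w ≠ 0) (hα : 0 < α) (hβ : 0 < β) :
    IntegrableOn (fun s => s ^ (α - 1) * (s + w) ^ (β - 1)) (levelRange ρ w) := by
  obtain ⟨h1, h2⟩ := integrableOn_levelRange_succ hw hα hβ
  have h5 : IntegrableOn _ (levelRange ρ w) := (h1.sub h2).const_mul w⁻¹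
  refine h5.congr_fun (fun s hs => ?_) measurableSet_levelRange
  obtain ⟨h3, h4⟩ := levelRange_pos hs
  simp only [Pi.sub_apply]
  rw [rpow_mul_rpow_sub h3 h4, inv_mul_cancel_left₀ hw0]

/-- The integral of the derivative of s^α (s+w)^β. At the lower endpoint s or s + w vanishes, so
only the cut-off endpoint contributes, analytically in w. -/
theorem modelIntegral_parts (hw : |w| < ρ) (hα : 0 < α) (hβ : 0 < β) :
    α * modelIntegral ρ α (β + 1) w + β * modelIntegral ρ (α + 1) β w =
      ((ρ - w) / 2) ^ α * ((ρ + w) / 2) ^ β := by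
  obtain ⟨h1, h2⟩ := integrableOn_levelRange_succ hw hα hβ
  have h3 := integral_levelRange_eq_sub hw (continuous_rpow_mul_rpow hα hβ).continuousOn
    (fun s hs hs' => hasDerivAt_rpow_mul_rpow (α := α) (β := β) hs hs')
    ((h1.const_mul α).add (h2.const_mul β))
  rw [integral_add (h1.const_mul α) (h2.const_mul β), integral_const_mul, integral_const_mul] at h3
  have h4 : (max 0 (-w)) ^ α * (max 0 (-w) + w) ^ β = 0 := by
    rcases le_total 0 w with h | h
    · rw [max_eq_left (by linarith), Real.zero_rpow hα.ne', zero_mul]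
    · rw [max_eq_right (by linarith), neg_add_cancel, Real.zero_rpow hβ.ne', mul_zero]
  have h5 : (ρ - w) / 2 + w = (ρ + w) / 2 := by ring
  simp only [modelIntegral, add_sub_cancel_right]
  rw [h3, h4, h5, sub_zero]

/-- Because (s + w) - s = w under the integral. Together with `modelIntegral_parts` this is a linear
system for the two raised integrals. -/
theorem modelIntegral_sub (hw : |w| < ρ) (hα : 0 < α) (hβ : 0 < β) :
    modelIntegral ρ α (β + 1) w - modelIntegral ρ (α + 1) β w = w * modelIntegral ρ α β w := by
  obtain ⟨h1, h2⟩ := integrableOn_levelRange_succ hw hα hβ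
  simp only [modelIntegral, add_sub_cancel_right]
  rw [← integral_sub h1 h2, ← integral_const_mul]
  refine setIntegral_congr_fun measurableSet_levelRange fun s hs => ?_
  obtain ⟨h3, h4⟩ := levelRange_pos hs
  exact rpow_mul_rpow_sub h3 h4

theorem modelIntegral_succ_left (hw : |w| < ρ) (hα : 0 < α) (hβ : 0 < β) :
    modelIntegral ρ (α + 1) β w =
      (((ρ - w) / 2) ^ α * ((ρ + w) / 2) ^ β - α * w * modelIntegral ρ α β w) / (α + β) := by
  rw [eq_div_iff (by positivity)]
  linear_combination modelIntegral_parts hw hα hβ - α * modelIntegral_sub hw hα hβ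

theorem modelIntegral_succ_right (hw : |w| < ρ) (hα : 0 < α) (hβ : 0 < β) :
    modelIntegral ρ α (β + 1) w =
      (((ρ - w) / 2) ^ α * ((ρ + w) / 2) ^ β + β * w * modelIntegral ρ α β w) / (α + β) := by
  rw [eq_div_iff (by positivity)]
  linear_combination modelIntegral_parts hw hα hβ + β * modelIntegral_sub hw hα hβ

/-- The polynomials in `w` collecting the contributions of the cut-off `s + t = ρ` to the model
integrals. -/
def cutoffPoly {K : Type*} [Field K] (ρ α β w : K) : ℕ → ℕ → K
  | 0, 0 => 0
  | 0, b + 1 => (((ρ + w) / 2) ^ b + (β + b) * w * cutoffPoly ρ α β w 0 b) / (α + β + b)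
  | a + 1, b => (((ρ - w) / 2) ^ a * ((ρ + w) / 2) ^ b -
      (α + a) * w * cutoffPoly ρ α β w a b) / (α + β + a + b)

/-- The recursion makes sense over any field; its complex values are what permits bounding and
summing the cut-off terms on a disc. -/
theorem ofReal_cutoffPoly (ρ α β w : ℝ) (a b : ℕ) :
    ((cutoffPoly ρ α β w a b : ℝ) : ℂ) = cutoffPoly (ρ : ℂ) α β w a b := by
  induction a with
  | zero =>
    induction b with
    | zero => simp [cutoffPoly]
    | succ b ih => simp [cutoffPoly, ← ih]
  | succ a ih => simp [cutoffPoly, ← ih]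

theorem differentiable_cutoffPoly (ρ α β : ℂ) (a b : ℕ) :
    Differentiable ℂ fun w => cutoffPoly ρ α β w a b := by
  induction a with
  | zero =>
    induction b with
    | zero => simp only [cutoffPoly]; fun_prop
    | succ b ih => simp only [cutoffPoly]; fun_prop
  | succ a ih => simp only [cutoffPoly]; fun_prop

theorem analyticAt_cutoffPoly (ρ α β : ℝ) (a b : ℕ) (w : ℝ) :
    AnalyticAt ℝ (fun w => cutoffPoly ρ α β w a b) w := by
  induction a with
  | zero =>
    induction b with
    | zero => simp only [cutoffPoly]; fun_prop
    | succ b ih => simp only [cutoffPoly, div_eq_mul_inv]; fun_prop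
  | succ a ih => simp only [cutoffPoly, div_eq_mul_inv]; fun_prop

/-- Raising a, the recursion multiplies by (α+a)z and divides by α+β+a+b. The surplus β+b of the
denominator absorbs the inhomogeneous term once K R β ≥ 1; raising b likewise leaves the surplus α.
So the constant K does not grow with a and b. -/
theorem norm_cutoffPoly_le {R K : ℝ} (hα : 0 < α) (hβ : 0 < β) (hR : 0 < R) (hKα : 1 ≤ K * R * α)
    (hKβ : 1 ≤ K * R * β) {z : ℂ} (hz : ‖z‖ ≤ R) (hs : ‖((ρ : ℂ) - z) / 2‖ ≤ R)
    (ht : ‖((ρ : ℂ) + z) / 2‖ ≤ R) (a b : ℕ) :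
    ‖cutoffPoly (ρ : ℂ) α β z a b‖ ≤ K * R ^ (a + b) := by
  have hK : 0 ≤ K := by
    by_contra h
    have : K * (R * α) < 0 := mul_neg_of_neg_of_pos (not_le.1 h) (by positivity)
    nlinarith
  have hnorm : ∀ (x : ℝ) (n : ℕ), 0 < x → ‖(x : ℂ) + n‖ = x + n := fun x n hx => by
    have : (x : ℂ) + n = ((x + n : ℝ) : ℂ) := by push_cast; rfl
    rw [this, Complex.norm_real, Real.norm_of_nonneg (by positivity)]
  induction a with
  | zero =>
    induction b with
    | zero => simpa [cutoffPoly] using hK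
    | succ b ih =>
      rw [cutoffPoly, norm_div]
      have hd : ‖(α : ℂ) + β + b‖ = α + β + b := by
        have := hnorm (α + β) b (by positivity)
        push_cast at this; exact this
      rw [hd, div_le_iff₀ (by positivity)]
      calc _ ≤ ‖(((ρ : ℂ) + z) / 2) ^ b‖ + ‖((β : ℂ) + b) * z * cutoffPoly (ρ : ℂ) α β z 0 b‖ :=
            norm_add_le _ _
        _ ≤ R ^ b + (β + b) * R * (K * R ^ (0 + b)) := by
            rw [norm_pow, norm_mul, norm_mul, hnorm β b hβ]
            gcongr
        _ ≤ R ^ b * (K * R * α) + (β + b) * R * (K * R ^ (0 + b)) := by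
            have : R ^ b * 1 ≤ R ^ b * (K * R * α) := by gcongr
            linarith
        _ = _ := by ring
  | succ a ih =>
    rw [cutoffPoly, norm_div]
    have hd : ‖(α : ℂ) + β + a + b‖ = α + β + a + b := by
      have := hnorm (α + β + a) b (by positivity)
      push_cast at this; exact this
    rw [hd, div_le_iff₀ (by positivity)]
    calc _ ≤ ‖(((ρ : ℂ) - z) / 2) ^ a * (((ρ : ℂ) + z) / 2) ^ b‖ +
          ‖((α : ℂ) + a) * z * cutoffPoly (ρ : ℂ) α β z a b‖ := norm_sub_le _ _
      _ ≤ R ^ a * R ^ b + (α + a) * R * (K * R ^ (a + b)) := by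
          rw [norm_mul, norm_pow, norm_pow, norm_mul, norm_mul, hnorm α a hα]
          gcongr
      _ ≤ R ^ a * R ^ b * (K * R * β + K * R * b) + (α + a) * R * (K * R ^ (a + b)) := by
          have h1 : 0 ≤ K * R * b := by positivity
          have : R ^ a * R ^ b * 1 ≤ R ^ a * R ^ b * (K * R * β + K * R * b) := by
            gcongr; linarith
          linarith
      _ = _ := by ring

/-- The Beta quotient `(-1)^a (α)_a (β)_b / (α+β)_{a+b}`. -/
noncomputable def betaRatio (α β : ℝ) (a b : ℕ) : ℝ :=
  (-1) ^ a * (Real.Gamma (α + a) * Real.Gamma (β + b) / Real.Gamma (α + β + (a + b : ℕ))) *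
    (Real.Gamma (α + β) / (Real.Gamma α * Real.Gamma β))

theorem betaRatio_zero (hα : 0 < α) (hβ : 0 < β) : betaRatio α β 0 0 = 1 := by
  have h1 := (Real.Gamma_pos_of_pos hα).ne'
  have h2 := (Real.Gamma_pos_of_pos hβ).ne'
  have h3 := (Real.Gamma_pos_of_pos (add_pos hα hβ)).ne'
  simp only [betaRatio, pow_zero, Nat.cast_zero, add_zero, one_mul]
  field_simp

theorem betaRatio_succ_left (hα : 0 < α) (hβ : 0 < β) (a b : ℕ) :
    betaRatio α β (a + 1) b = -(α + a) / (α + β + a + b) * betaRatio α β a b := by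
  have h1 : α + ((a + 1 : ℕ) : ℝ) = (α + a) + 1 := by push_cast; ring
  have h2 : α + β + ((a + 1 + b : ℕ) : ℝ) = (α + β + (a + b : ℕ)) + 1 := by push_cast; ring
  have h3 := (Real.Gamma_pos_of_pos (by positivity : 0 < α + β + ((a + b : ℕ) : ℝ))).ne'
  have h4 : α + β + ((a + b : ℕ) : ℝ) = α + β + a + b := by push_cast; ring
  simp only [betaRatio]
  rw [h1, h2, Real.Gamma_add_one (by positivity), Real.Gamma_add_one (by positivity), pow_succ]
  rw [h4] at h3 ⊢
  have h5 : α + β + a + b ≠ 0 := by positivity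
  field_simp

theorem betaRatio_succ_right (hα : 0 < α) (hβ : 0 < β) (a b : ℕ) :
    betaRatio α β a (b + 1) = (β + b) / (α + β + a + b) * betaRatio α β a b := by
  have h1 : β + ((b + 1 : ℕ) : ℝ) = (β + b) + 1 := by push_cast; ring
  have h2 : α + β + ((a + (b + 1) : ℕ) : ℝ) = (α + β + (a + b : ℕ)) + 1 := by push_cast; ring
  have h3 := (Real.Gamma_pos_of_pos (by positivity : 0 < α + β + ((a + b : ℕ) : ℝ))).ne'
  have h4 : α + β + ((a + b : ℕ) : ℝ) = α + β + a + b := by push_cast; ring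
  simp only [betaRatio]
  rw [h1, h2, Real.Gamma_add_one (by positivity), Real.Gamma_add_one (by positivity)]
  rw [h4] at h3 ⊢
  have h5 : α + β + a + b ≠ 0 := by positivity
  field_simp

/-- Iteration of the two raising relations, b before a as in `cutoffPoly`: every step multiplies the
original integral by w and a rational number, and sends the boundary term to the polynomial. -/
theorem modelIntegral_add_nat (hw : |w| < ρ) (hα : 0 < α) (hβ : 0 < β) (a b : ℕ) :
    modelIntegral ρ (α + a) (β + b) w = betaRatio α β a b * w ^ (a + b) * modelIntegral ρ α β w +
      ((ρ - w) / 2) ^ α * ((ρ + w) / 2) ^ β * cutoffPoly ρ α β w a b := by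
  have hs : 0 < (ρ - w) / 2 := by linarith [(abs_lt.1 hw).2]
  have ht : 0 < (ρ + w) / 2 := by linarith [(abs_lt.1 hw).1]
  induction a with
  | zero =>
    induction b with
    | zero => simp [cutoffPoly, betaRatio_zero hα hβ]
    | succ b ih =>
      have h1 : β + ((b + 1 : ℕ) : ℝ) = (β + b) + 1 := by push_cast; ring
      rw [Nat.cast_zero, add_zero] at ih ⊢
      rw [h1, modelIntegral_succ_right hw hα (by positivity), ih, betaRatio_succ_right hα hβ,
        cutoffPoly, Real.rpow_add ht, Real.rpow_natCast]
      simp only [Nat.cast_zero, add_zero, zero_add]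
      field_simp
      ring
  | succ a ih =>
    have h1 : α + ((a + 1 : ℕ) : ℝ) = (α + a) + 1 := by push_cast; ring
    have h2 : α + a + (β + b) = α + β + a + b := by ring
    rw [h1, modelIntegral_succ_left hw (by positivity) (by positivity), ih,
      betaRatio_succ_left hα hβ, cutoffPoly, Real.rpow_add hs, Real.rpow_add ht, Real.rpow_natCast,
      Real.rpow_natCast, h2]
    have h5 : α + β + a + b ≠ 0 := by positivity
    field_simp
    ring

end ModelIntegral

/-! ### The four base integrals and their singular parts -/

section BaseValues

variable {ρ α β w : ℝ}

/-- The upper endpoint gives the analytic part; the singularity comes from the lower endpoint max(0,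
-w), which has a kink at w = 0. -/
theorem modelIntegral_one_one (hw : |w| < ρ) (hw0 : w ≠ 0) :
    modelIntegral ρ 1 1 w = (ρ + w) / 2 - w * heaviside w := by
  have h := integral_levelRange_eq_sub hw (F := fun s => s) continuousOn_id
    (fun s _ _ => hasDerivAt_id s) ((integrableOn_levelRange hw hw0 one_pos one_pos).congr_fun
      (fun s _ => by simp) measurableSet_levelRange)
  have h1 : modelIntegral ρ 1 1 w = ∫ s in levelRange ρ w, 1 := by simp [modelIntegral]
  rw [h1, h]
  rcases le_total 0 w with h0 | h0
  · rw [max_eq_left (by linarith), heaviside, if_pos h0]; ring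
  · rw [max_eq_right (by linarith), heaviside, if_neg (not_le.2 (lt_of_le_of_ne h0 hw0))]; ring

theorem modelIntegral_one_half (hw : |w| < ρ) (hw0 : w ≠ 0) :
    modelIntegral ρ 1 (1 / 2) w = 2 * √((ρ + w) / 2) - 2 * (√w * heaviside w) := by
  have hd : ∀ s, 0 < s → 0 < s + w →
      HasDerivAt (fun s => 2 * √(s + w)) (s ^ ((1 : ℝ) - 1) * (s + w) ^ ((1 / 2 : ℝ) - 1)) s := by
    intro s _ hs'
    have := (((hasDerivAt_id s).add_const w).sqrt hs'.ne').const_mul 2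
    refine this.congr_deriv ?_
    have h2 : (1 / 2 : ℝ) - 1 = -(1 / 2) := by norm_num
    rw [sub_self, Real.rpow_zero, h2, Real.rpow_neg hs'.le, ← Real.sqrt_eq_rpow, id]
    have : √(s + w) ≠ 0 := (Real.sqrt_pos.2 hs').ne'
    field_simp
  have h := integral_levelRange_eq_sub hw (by fun_prop) hd
    (integrableOn_levelRange hw hw0 one_pos (by norm_num))
  rw [modelIntegral, h]
  have h3 : (ρ - w) / 2 + w = (ρ + w) / 2 := by ring
  rw [h3]
  rcases le_total 0 w with h0 | h0
  · rw [max_eq_left (by linarith), heaviside, if_pos h0]; simp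
  · rw [max_eq_right (by linarith), heaviside, if_neg (not_le.2 (lt_of_le_of_ne h0 hw0))]; simp

theorem modelIntegral_half_one (hw : |w| < ρ) (hw0 : w ≠ 0) :
    modelIntegral ρ (1 / 2) 1 w = 2 * √((ρ - w) / 2) - 2 * (√(-w) * heaviside (-w)) := by
  have hd : ∀ s, 0 < s → 0 < s + w →
      HasDerivAt (fun s => 2 * √s) (s ^ ((1 / 2 : ℝ) - 1) * (s + w) ^ ((1 : ℝ) - 1)) s := by
    intro s hs _
    have := ((hasDerivAt_id s).sqrt hs.ne').const_mul 2
    refine this.congr_deriv ?_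
    have h2 : (1 / 2 : ℝ) - 1 = -(1 / 2) := by norm_num
    rw [sub_self, Real.rpow_zero, h2, Real.rpow_neg hs.le, ← Real.sqrt_eq_rpow, id]
    have : √s ≠ 0 := (Real.sqrt_pos.2 hs).ne'
    field_simp
  have h := integral_levelRange_eq_sub hw (by fun_prop) hd
    (integrableOn_levelRange hw hw0 (by norm_num) one_pos)
  rw [modelIntegral, h]
  rcases le_total 0 w with h0 | h0
  · rw [max_eq_left (by linarith), heaviside,
      if_neg (not_le.2 (neg_lt_zero.2 (lt_of_le_of_ne h0 hw0.symm)))]; simp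
  · rw [max_eq_right (by linarith), heaviside, if_pos (by linarith)]; simp

/-- A primitive is 2 log(√s + √(s+w)). At the lower endpoint one root is zero and the other is √|w|,
whence the logarithm. -/
theorem modelIntegral_half_half (hw : |w| < ρ) (hw0 : w ≠ 0) :
    modelIntegral ρ (1 / 2) (1 / 2) w =
      2 * Real.log (√((ρ - w) / 2) + √((ρ + w) / 2)) - Real.log |w| := by
  have hd : ∀ s, 0 < s → 0 < s + w → HasDerivAt (fun s => 2 * Real.log (√s + √(s + w)))
      (s ^ ((1 / 2 : ℝ) - 1) * (s + w) ^ ((1 / 2 : ℝ) - 1)) s := by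
    intro s hs hs'
    have e1 : 0 < √s := Real.sqrt_pos.2 hs
    have e2 : 0 < √(s + w) := Real.sqrt_pos.2 hs'
    have := ((((hasDerivAt_id s).sqrt hs.ne').add
      (((hasDerivAt_id s).add_const w).sqrt hs'.ne')).log (add_pos e1 e2).ne').const_mul 2
    refine this.congr_deriv ?_
    have h2 : (1 / 2 : ℝ) - 1 = -(1 / 2) := by norm_num
    rw [h2, Real.rpow_neg hs.le, Real.rpow_neg hs'.le, ← Real.sqrt_eq_rpow, ← Real.sqrt_eq_rpow]
    simp only [id, Pi.add_apply]
    field_simp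
    ring
  have hc : ContinuousOn (fun s => 2 * Real.log (√s + √(s + w)))
      (Icc (max 0 (-w)) ((ρ - w) / 2)) := by
    refine continuousOn_const.mul (ContinuousOn.log (by fun_prop) fun s hs => ?_)
    have h1 : 0 ≤ s := (le_max_left _ _).trans hs.1
    have h2 : 0 ≤ s + w := by linarith [(le_max_right 0 (-w)).trans hs.1]
    rcases h1.lt_or_eq with h3 | h3
    · have := Real.sqrt_pos.2 h3
      positivity
    · have : 0 < s + w := lt_of_le_of_ne h2 (by rw [← h3, zero_add]; exact hw0.symm)
      have := Real.sqrt_pos.2 this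
      positivity
  have h := integral_levelRange_eq_sub hw hc hd
    (integrableOn_levelRange hw hw0 (by norm_num) (by norm_num))
  rw [modelIntegral, h]
  have h3 : (ρ - w) / 2 + w = (ρ + w) / 2 := by ring
  rw [h3]
  congr 1
  rcases le_total 0 w with h0 | h0
  · rw [max_eq_left (by linarith), abs_of_nonneg h0]
    simp only [Real.sqrt_zero, zero_add]
    rw [Real.log_sqrt h0]; ring
  · rw [max_eq_right (by linarith), abs_of_nonpos h0]
    simp only [neg_add_cancel, Real.sqrt_zero, add_zero]
    rw [Real.log_sqrt (by linarith)]; ring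

theorem AnalyticAt.rpow_const_of_ne {E : Type*} [NormedAddCommGroup E] [NormedSpace ℝ E]
    {f : E → ℝ} {x : E} (hf : AnalyticAt ℝ f x) (hx : f x ≠ 0) (p : ℝ) :
    AnalyticAt ℝ (fun y => f y ^ p) x :=
  (ContDiffAt.rpow_const_of_ne (n := ⊤) hf.contDiffAt hx).analyticAt

theorem analyticAt_cutoff (hw : |w| < ρ) (p q : ℝ) :
    AnalyticAt ℝ (fun w => ((ρ - w) / 2) ^ p * ((ρ + w) / 2) ^ q) w := by
  have hs : 0 < (ρ - w) / 2 := by linarith [(abs_lt.1 hw).2]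
  have ht : 0 < (ρ + w) / 2 := by linarith [(abs_lt.1 hw).1]
  have h1 : AnalyticAt ℝ (fun w => (ρ - w) / 2) w := by simp only [div_eq_mul_inv]; fun_prop
  have h2 : AnalyticAt ℝ (fun w => (ρ + w) / 2) w := by simp only [div_eq_mul_inv]; fun_prop
  exact (h1.rpow_const_of_ne hs.ne' p).fun_mul (h2.rpow_const_of_ne ht.ne' q)

/-- The Gamma normalization cancels the Beta quotient down to the sign (-1)^a, so all monomials have
the same singular function up to a signed power of w. -/
theorem exists_modelIntegral_add_nat_decomposition (hα : 0 < α) (hβ : 0 < β) (a b : ℕ)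
    {n₀ E₀ : ℝ → ℝ} (hE₀ : AnalyticOnNhd ℝ E₀ (Metric.ball 0 ρ))
    (h : ∀ w, |w| < ρ → w ≠ 0 → modelIntegral ρ α β w *
      (Real.Gamma (α + β) / (Real.Gamma α * Real.Gamma β)) = n₀ w + E₀ w) :
    ∃ E : ℝ → ℝ, AnalyticOnNhd ℝ E (Metric.ball 0 ρ) ∧ ∀ w, |w| < ρ → w ≠ 0 →
      modelIntegral ρ (α + a) (β + b) w * (Real.Gamma (α + β + (a + b : ℕ)) /
        (Real.Gamma (α + a) * Real.Gamma (β + b))) = (-1) ^ a * w ^ (a + b) * n₀ w + E w := by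
  set Γ' := Real.Gamma (α + β + (a + b : ℕ)) / (Real.Gamma (α + a) * Real.Gamma (β + b)) with hΓ'
  refine ⟨fun w => (-1) ^ a * w ^ (a + b) * E₀ w +
    ((ρ - w) / 2) ^ α * ((ρ + w) / 2) ^ β * cutoffPoly ρ α β w a b * Γ', fun w hw => ?_,
    fun w hw hw0 => ?_⟩
  · have hw' : |w| < ρ := by simpa using hw
    exact ((analyticAt_const.fun_mul (analyticAt_id.fun_pow _)).fun_mul (hE₀ w hw)).fun_add
      (((analyticAt_cutoff hw' α β).fun_mul (analyticAt_cutoffPoly ρ α β a b w)).fun_mul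
        analyticAt_const)
  · have h1 : betaRatio α β a b * Γ' =
        (-1) ^ a * (Real.Gamma (α + β) / (Real.Gamma α * Real.Gamma β)) := by
      have e1 := (Real.Gamma_pos_of_pos (by positivity : 0 < α + a)).ne'
      have e2 := (Real.Gamma_pos_of_pos (by positivity : 0 < β + b)).ne'
      have e3 := (Real.Gamma_pos_of_pos (by positivity : 0 < α + β + (a + b : ℕ))).ne'
      rw [hΓ', betaRatio]
      field_simp
    rw [modelIntegral_add_nat hw hα hβ]
    linear_combination w ^ (a + b) * modelIntegral ρ α β w * h1 + (-1) ^ a * w ^ (a + b) * h w hw hw0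

theorem neg_one_pow_mod_two (a : ℕ) : (-1 : ℝ) ^ (a % 2) = (-1) ^ a := by
  conv_rhs => rw [← Nat.div_add_mod a 2, pow_add, pow_mul]
  norm_num

theorem sqrt_mul_heaviside_mul_pow (n : ℕ) (hw : w ≠ 0) :
    w ^ n * (√w * heaviside w) = w ^ ((n : ℝ) + 1 / 2) * heaviside w := by
  unfold heaviside
  split_ifs with h
  · have : 0 < w := lt_of_le_of_ne h hw.symm
    rw [Real.rpow_add this, Real.rpow_natCast, Real.sqrt_eq_rpow]; ring
  · simp

/-- The singular part of the normalized model integral with half-integer exponents. -/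
theorem exists_modelIntegral_decomposition {k m : ℕ} (hk : 0 < k) (hm : 0 < m) (ρ : ℝ) :
    ∃ E : ℝ → ℝ, AnalyticOnNhd ℝ E (Metric.ball 0 ρ) ∧ ∀ w, |w| < ρ → w ≠ 0 →
      modelIntegral ρ (k / 2) (m / 2) w * (Real.Gamma ((k + m : ℕ) / 2) /
        (Real.Gamma (k / 2) * Real.Gamma (m / 2))) = hNonanalytic (k + m) (k % 4) w + E w := by
  have hst : ∀ w ∈ Metric.ball (0 : ℝ) ρ, 0 < (ρ - w) / 2 ∧ 0 < (ρ + w) / 2 := fun w hw => by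
    have hw' : |w| < ρ := by simpa using hw
    exact ⟨by linarith [(abs_lt.1 hw').2], by linarith [(abs_lt.1 hw').1]⟩
  have hsa : ∀ w, AnalyticAt ℝ (fun w => (ρ - w) / 2) w := fun w => by
    simp only [div_eq_mul_inv]; fun_prop
  have hta : ∀ w, AnalyticAt ℝ (fun w => (ρ + w) / 2) w := fun w => by
    simp only [div_eq_mul_inv]; fun_prop
  have hsr : ∀ w ∈ Metric.ball (0 : ℝ) ρ, AnalyticAt ℝ (fun w => √((ρ - w) / 2)) w :=
    fun w hw => (ContDiffAt.sqrt (n := ⊤) (hsa w).contDiffAt (hst w hw).1.ne').analyticAt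
  have htr : ∀ w ∈ Metric.ball (0 : ℝ) ρ, AnalyticAt ℝ (fun w => √((ρ + w) / 2)) w :=
    fun w hw => (ContDiffAt.sqrt (n := ⊤) (hta w).contDiffAt (hst w hw).2.ne').analyticAt
  have hΓ : Real.Gamma (3 / 2) = 1 / 2 * √Real.pi := by
    have := Real.Gamma_add_one (s := 1 / 2) (by norm_num)
    rw [Real.Gamma_one_half_eq] at this
    rw [← this]; norm_num
  have hπ : 0 < √Real.pi := Real.sqrt_pos.2 Real.pi_pos
  -- The parities of k and m choose the base exponents, 1 for even and 1/2 for odd. The sign (-1)^a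
  -- depends on a modulo 2, that is, on k modulo 4 within its parity class.
  rcases Nat.even_or_odd' k with ⟨a, rfl | rfl⟩ <;> rcases Nat.even_or_odd' m with ⟨b, rfl | rfl⟩
  · obtain ⟨a, rfl⟩ : ∃ a', a = a' + 1 := ⟨a - 1, by omega⟩
    obtain ⟨b, rfl⟩ : ∃ b', b = b' + 1 := ⟨b - 1, by omega⟩
    obtain ⟨E, hE, h⟩ := exists_modelIntegral_add_nat_decomposition (ρ := ρ) one_pos one_pos a b
      (n₀ := fun w => -(w * heaviside w)) (E₀ := fun w => (ρ + w) / 2) (fun w _ => hta w)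
      (fun w hw hw0 => by
        rw [modelIntegral_one_one hw hw0]; norm_num; ring)
    refine ⟨E, hE, fun w hw hw0 => ?_⟩
    have hkα : ((2 * (a + 1) : ℕ) : ℝ) / 2 = 1 + a := by push_cast; ring
    have hmβ : ((2 * (b + 1) : ℕ) : ℝ) / 2 = 1 + b := by push_cast; ring
    have hkm : ((2 * (a + 1) + (2 * (b + 1)) : ℕ) : ℝ) / 2 = 1 + 1 + (a + b : ℕ) := by push_cast; ring
    rw [hkα, hmβ, hkm, h w hw hw0]
    congr 1
    symm
    · have e1 : (2 * (a + 1)) % 4 = 2 * ((a + 1) % 2) := by omega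
      have e2 : (((2 * (a + 1) + 2 * (b + 1) : ℕ) : ℝ) - 2) / 2 = ((a + b + 1 : ℕ) : ℝ) := by
        push_cast; ring
      rw [hNonanalytic, e1, if_pos (even_two_mul _), e2, Nat.mul_div_cancel_left _ two_pos,
        neg_one_pow_mod_two, Real.rpow_natCast]
      ring
  · obtain ⟨a, rfl⟩ : ∃ a', a = a' + 1 := ⟨a - 1, by omega⟩
    obtain ⟨E, hE, h⟩ := exists_modelIntegral_add_nat_decomposition (ρ := ρ) one_pos
      (by norm_num : (0 : ℝ) < 1 / 2) a b
      (n₀ := fun w => -(√w * heaviside w)) (E₀ := fun w => √((ρ + w) / 2)) htr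
      (fun w hw hw0 => by
        have e : (1 : ℝ) + 1 / 2 = 3 / 2 := by norm_num
        rw [modelIntegral_one_half hw hw0, e, hΓ, Real.Gamma_one, Real.Gamma_one_half_eq]
        field_simp; ring)
    refine ⟨E, hE, fun w hw hw0 => ?_⟩
    have hkα : ((2 * (a + 1) : ℕ) : ℝ) / 2 = 1 + a := by push_cast; ring
    have hmβ : ((2 * b + 1 : ℕ) : ℝ) / 2 = 1 / 2 + b := by push_cast; ring
    have hkm : ((2 * (a + 1) + (2 * b + 1) : ℕ) : ℝ) / 2 = 1 + 1 / 2 + (a + b : ℕ) := by push_cast; ring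
    rw [hkα, hmβ, hkm, h w hw hw0]
    congr 1
    symm
    · have e1 : (2 * (a + 1)) % 4 = 2 * ((a + 1) % 2) := by omega
      have e2 : (((2 * (a + 1) + (2 * b + 1) : ℕ) : ℝ) - 2) / 2 = ((a + b : ℕ) : ℝ) + 1 / 2 := by
        push_cast; ring
      have e3 := sqrt_mul_heaviside_mul_pow (a + b) hw0
      rw [hNonanalytic, e1, if_pos (even_two_mul _), e2, Nat.mul_div_cancel_left _ two_pos,
        neg_one_pow_mod_two, mul_assoc, ← e3]
      ring
  · obtain ⟨b, rfl⟩ : ∃ b', b = b' + 1 := ⟨b - 1, by omega⟩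
    obtain ⟨E, hE, h⟩ := exists_modelIntegral_add_nat_decomposition (ρ := ρ)
      (by norm_num : (0 : ℝ) < 1 / 2) one_pos a b
      (n₀ := fun w => -(√(-w) * heaviside (-w))) (E₀ := fun w => √((ρ - w) / 2)) hsr
      (fun w hw hw0 => by
        have e : (1 / 2 : ℝ) + 1 = 3 / 2 := by norm_num
        rw [modelIntegral_half_one hw hw0, e, hΓ, Real.Gamma_one, Real.Gamma_one_half_eq]
        field_simp; ring)
    refine ⟨E, hE, fun w hw hw0 => ?_⟩
    have hkα : ((2 * a + 1 : ℕ) : ℝ) / 2 = 1 / 2 + a := by push_cast; ring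
    have hmβ : ((2 * (b + 1) : ℕ) : ℝ) / 2 = 1 + b := by push_cast; ring
    have hkm : ((2 * a + 1 + (2 * (b + 1)) : ℕ) : ℝ) / 2 = 1 / 2 + 1 + (a + b : ℕ) := by push_cast; ring
    rw [hkα, hmβ, hkm, h w hw hw0]
    congr 1
    symm
    · have e1 : (2 * a + 1) % 4 = 2 * (a % 2) + 1 := by omega
      have e2 : (((2 * a + 1 + 2 * (b + 1) : ℕ) : ℝ) - 2) / 2 = ((a + b : ℕ) : ℝ) + 1 / 2 := by
        push_cast; ring
      have e3 := sqrt_mul_heaviside_mul_pow (a + b) (neg_ne_zero.2 hw0)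
      -- Replacing k by k mod 4 changes (N - k)/2 by an even number, so the parity is that of m/2 =
      -- b + 1. The factor (-w)^(a+b) contributes (-1)^(a+b), and the product is -(-1)^a.
      have e4 : (((2 * a + 1 + 2 * (b + 1) : ℕ) : ℤ) - ((2 * (a % 2) + 1 : ℕ) : ℤ)) / 2 =
          ((2 * (a / 2) + (b + 1) : ℕ) : ℤ) := by omega
      have e5 : ¬ Even (2 * a + 1 + 2 * (b + 1)) := by
        rw [Nat.not_even_iff_odd]; exact ⟨a + b + 1, by ring⟩
      have e6 : ¬ Even (2 * (a % 2) + 1) := by simp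
      rw [hNonanalytic, e1, if_neg e6, if_neg e5, e4, zpow_natCast, e2, mul_assoc, ← e3,
        neg_pow w, pow_add, pow_mul, pow_add (-1 : ℝ) a b]
      have e7 : ((-1 : ℝ) ^ a) * (-1) ^ a = 1 := by rw [← mul_pow]; norm_num
      have e8 : ((-1 : ℝ) ^ b) * (-1) ^ b = 1 := by rw [← mul_pow]; norm_num
      have e9 : ((-1 : ℝ) ^ 2) ^ (a / 2) = 1 := by norm_num
      rw [e9, pow_succ]
      linear_combination (-(-1) ^ a * w ^ (a + b) * (√(-w) * heaviside (-w))) * e8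
  · obtain ⟨E, hE, h⟩ := exists_modelIntegral_add_nat_decomposition (ρ := ρ)
      (by norm_num : (0 : ℝ) < 1 / 2) (by norm_num : (0 : ℝ) < 1 / 2) a b
      (n₀ := fun w => -(Real.log |w| / Real.pi))
      (E₀ := fun w => 2 * Real.log (√((ρ - w) / 2) + √((ρ + w) / 2)) / Real.pi)
      (fun w hw => by
        have e1 := Real.sqrt_pos.2 (hst w hw).1
        have e2 := Real.sqrt_pos.2 (hst w hw).2
        simp only [div_eq_mul_inv _ Real.pi]
        refine (analyticAt_const.fun_mul ?_).fun_mul analyticAt_const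
        exact (ContDiffAt.log (n := ⊤) ((hsr w hw).fun_add (htr w hw)).contDiffAt
          (add_pos e1 e2).ne').analyticAt)
      (fun w hw hw0 => by
        have e : (1 / 2 : ℝ) + 1 / 2 = 1 := by norm_num
        rw [modelIntegral_half_half hw hw0, e, Real.Gamma_one, Real.Gamma_one_half_eq,
          Real.mul_self_sqrt Real.pi_pos.le]
        field_simp; ring)
    refine ⟨E, hE, fun w hw hw0 => ?_⟩
    have hkα : ((2 * a + 1 : ℕ) : ℝ) / 2 = 1 / 2 + a := by push_cast; ring
    have hmβ : ((2 * b + 1 : ℕ) : ℝ) / 2 = 1 / 2 + b := by push_cast; ring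
    have hkm : ((2 * a + 1 + (2 * b + 1) : ℕ) : ℝ) / 2 = 1 / 2 + 1 / 2 + (a + b : ℕ) := by push_cast; ring
    rw [hkα, hmβ, hkm, h w hw hw0]
    congr 1
    symm
    · have e1 : (2 * a + 1) % 4 = 2 * (a % 2) + 1 := by omega
      have e2 : (2 * a + 1 + (2 * b + 1) - 2) / 2 = a + b := by omega
      have e5 : Even (2 * a + 1 + (2 * b + 1)) := ⟨a + b + 1, by ring⟩
      have e6 : ¬ Even (2 * (a % 2) + 1) := by simp
      have e7 : (2 * (a % 2) + 1 + 1) / 2 = a % 2 + 1 := by omega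
      rw [hNonanalytic, e1, if_neg e6, if_pos e5, e2, e7, pow_succ, neg_one_pow_mod_two]
      ring

end BaseValues

/-! ### Summing the contributions of all monomials -/

section SeriesIntegral

theorem abs_betaRatio_le_one {α β : ℝ} (hα : 0 < α) (hβ : 0 < β) (a b : ℕ) :
    |betaRatio α β a b| ≤ 1 := by
  induction a with
  | zero =>
    induction b with
    | zero => rw [betaRatio_zero hα hβ, abs_one]
    | succ b ih =>
      rw [betaRatio_succ_right hα hβ, abs_mul]
      refine mul_le_one₀ ?_ (abs_nonneg _) ih
      rw [abs_of_nonneg (by positivity), div_le_one (by positivity)]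
      push_cast; linarith
  | succ a ih =>
    rw [betaRatio_succ_left hα hβ, abs_mul]
    refine mul_le_one₀ ?_ (abs_nonneg _) ih
    rw [neg_div, abs_neg, abs_of_nonneg (by positivity), div_le_one (by positivity)]
    have : (0 : ℝ) ≤ b := b.cast_nonneg
    linarith

/-- The singular part of a level integral with a density given by a power series. -/
theorem exists_series_integral_decomposition {ι : Type*} [Countable ι] {k m : ℕ} (hk : 0 < k)
    (hm : 0 < m) {c : ι → ℝ} {a b : ι → ℕ} {R ρ : ℝ} (hρ : 0 < ρ) (hρR : ρ ≤ R)
    (hc : Summable fun i => |c i| * R ^ (a i + b i)) {M : ℝ → ℝ → ℝ}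
    (hM : ∀ s t, 0 < s → 0 < t → s ≤ R → t ≤ R → HasSum (fun i => c i * (s ^ a i * t ^ b i)) (M s t)) :
    ∃ E : ℝ → ℝ, AnalyticOnNhd ℝ E (Metric.ball 0 ρ) ∧ ∀ w, |w| < ρ → w ≠ 0 →
      ∫ s in levelRange ρ w, s ^ ((k : ℝ) / 2 - 1) * (s + w) ^ ((m : ℝ) / 2 - 1) * M s (s + w) =
        hNonanalytic (k + m) (k % 4) w * (∑' i, (-1) ^ a i * c i *
          (Real.Gamma (k / 2 + a i) * Real.Gamma (m / 2 + b i) /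
            Real.Gamma ((k + m : ℕ) / 2 + (a i + b i : ℕ))) * w ^ (a i + b i)) + E w := by
  have hR : 0 < R := hρ.trans_le hρR
  obtain ⟨E₀, hE₀, hU⟩ := exists_modelIntegral_decomposition hk hm ρ
  set α : ℝ := k / 2 with hα'
  set β : ℝ := m / 2 with hβ'
  have hα : 0 < α := by rw [hα']; positivity
  have hβ : 0 < β := by rw [hβ']; positivity
  have hαβ : ((k + m : ℕ) : ℝ) / 2 = α + β := by rw [hα', hβ']; push_cast; ring
  rw [hαβ] at hU ⊢
  have hΓα := (Real.Gamma_pos_of_pos hα).ne'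
  have hΓβ := (Real.Gamma_pos_of_pos hβ).ne'
  have hΓ := (Real.Gamma_pos_of_pos (add_pos hα hβ)).ne'
  -- The Beta value of the base exponents; dividing the coefficients by it leaves `betaRatio`, which
  -- is bounded by 1.
  set B := Real.Gamma α * Real.Gamma β / Real.Gamma (α + β) with hB
  have hcoef : ∀ i, (-1) ^ a i * c i * (Real.Gamma (α + a i) * Real.Gamma (β + b i) /
      Real.Gamma (α + β + (a i + b i : ℕ))) = c i * (betaRatio α β (a i) (b i) * B) := fun i => by
    rw [betaRatio, hB]; field_simp
  simp only [hcoef]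
  have hcR : ∀ ρ', 0 ≤ ρ' → ρ' ≤ R → Summable fun i => |c i| * ρ' ^ (a i + b i) :=
    fun ρ' h0 h1 => Summable.of_nonneg_of_le (fun i => by positivity) (fun i => by gcongr) hc
  have hS : ∀ ρ', 0 ≤ ρ' → ρ' < R →
      Summable fun i => |c i * (betaRatio α β (a i) (b i) * B)| * ρ' ^ (a i + b i) := by
    intro ρ' h0 h1
    refine Summable.of_nonneg_of_le (fun i => by positivity) (fun i => ?_)
      ((hcR ρ' h0 h1.le).mul_right |B|)
    rw [abs_mul, abs_mul]
    calc _ ≤ |c i| * (1 * |B|) * ρ' ^ (a i + b i) := by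
          gcongr; exact abs_betaRatio_le_one hα hβ _ _
      _ = _ := by ring
  set S : ℝ → ℝ := fun w => ∑' i, c i * (betaRatio α β (a i) (b i) * B) * w ^ (a i + b i) with hSdef
  have hSa : AnalyticOnNhd ℝ S (Metric.ball 0 R) := analyticOnNhd_tsum_mul_pow hS
  set Y : ℝ → ℝ := fun w => ∑' i, c i * cutoffPoly ρ α β w (a i) (b i) with hYdef
  obtain ⟨K, hKα, hKβ⟩ : ∃ K : ℝ, 1 ≤ K * R * α ∧ 1 ≤ K * R * β := by
    refine ⟨1 / (R * α) + 1 / (R * β), ?_, ?_⟩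
    · have : (1 / (R * α) + 1 / (R * β)) * R * α = 1 + α / β := by field_simp
      rw [this]; have : 0 < α / β := by positivity
      linarith
    · have : (1 / (R * α) + 1 / (R * β)) * R * β = 1 + β / α := by field_simp; ring
      rw [this]; have : 0 < β / α := by positivity
      linarith
  -- For |z| < ρ ≤ R also |(ρ ± z)/2| ≤ R, so a single summable majorant serves the whole disc.
  have hbound : ∀ i, ∀ z : ℂ, ‖z‖ < ρ →
      ‖(c i : ℂ) * cutoffPoly (ρ : ℂ) α β z (a i) (b i)‖ ≤ K * (|c i| * R ^ (a i + b i)) := by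
    intro i z hz
    have h1 : ‖(ρ : ℂ)‖ = ρ := by rw [Complex.norm_real, Real.norm_of_nonneg hρ.le]
    have h2 : ‖((ρ : ℂ) - z) / 2‖ ≤ R := by
      rw [norm_div, Complex.norm_ofNat]
      have := norm_sub_le (ρ : ℂ) z
      linarith
    have h3 : ‖((ρ : ℂ) + z) / 2‖ ≤ R := by
      rw [norm_div, Complex.norm_ofNat]
      have := norm_add_le (ρ : ℂ) z
      linarith
    rw [norm_mul, Complex.norm_real, Real.norm_eq_abs]
    calc _ ≤ |c i| * (K * R ^ (a i + b i)) := by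
          gcongr; exact norm_cutoffPoly_le hα hβ hR hKα hKβ (hz.le.trans hρR) h2 h3 _ _
      _ = _ := by ring
  have hYa : AnalyticOnNhd ℝ Y (Metric.ball 0 ρ) :=
    analyticOnNhd_tsum_of_complex (hc.mul_left K)
      (F := fun i z => (c i : ℂ) * cutoffPoly (ρ : ℂ) α β z (a i) (b i))
      (fun i => (differentiable_cutoffPoly _ _ _ _ _).const_mul _) hbound
      (fun i x => by rw [Complex.ofReal_mul, ofReal_cutoffPoly])
  -- The analytic remainder of the base integral is multiplied by the common series S; Y collects
  -- the cut-off terms.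
  refine ⟨fun w => E₀ w * S w + ((ρ - w) / 2) ^ α * ((ρ + w) / 2) ^ β * Y w, fun w hw => ?_,
    fun w hw hw0 => ?_⟩
  · have hw' : |w| < ρ := by simpa using hw
    exact ((hE₀ w hw).fun_mul (hSa w (Metric.ball_subset_ball hρR hw))).fun_add
      ((analyticAt_cutoff hw' α β).fun_mul (hYa w hw))
  have hbase := integrableOn_levelRange hw hw0 hα hβ
  have hbw := abs_lt.1 hw
  have hle : ∀ s ∈ levelRange ρ w, 0 < s ∧ 0 < s + w ∧ s ≤ R ∧ s + w ≤ R := fun s hs => by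
    obtain ⟨h1, h2⟩ := levelRange_pos hs
    obtain ⟨h3, h4⟩ := levelRange_le hs
    exact ⟨h1, h2, by linarith, by linarith⟩
  have hexp : ∀ i, ∀ s ∈ levelRange ρ w, s ^ (α - 1) * (s + w) ^ (β - 1) *
      (c i * (s ^ a i * (s + w) ^ b i)) =
      c i * (s ^ (α + a i - 1) * (s + w) ^ (β + b i - 1)) := fun i s hs => by
    obtain ⟨h1, h2, -, -⟩ := hle s hs
    have e1 : s ^ (α + a i - 1) = s ^ (α - 1) * s ^ a i := by
      rw [← Real.rpow_natCast, ← Real.rpow_add h1]; congr 1; ring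
    have e2 : (s + w) ^ (β + b i - 1) = (s + w) ^ (β - 1) * (s + w) ^ b i := by
      rw [← Real.rpow_natCast (s + w), ← Real.rpow_add h2]; congr 1; ring
    rw [e1, e2]; ring
  have hsum := hasSum_integral_of_dominated_convergence (μ := volume.restrict (levelRange ρ w))
    (F := fun i s => c i * (s ^ (α + a i - 1) * (s + w) ^ (β + b i - 1)))
    (f := fun s => s ^ (α - 1) * (s + w) ^ (β - 1) * M s (s + w))
    (fun i s => |c i| * R ^ (a i + b i) * (s ^ (α - 1) * (s + w) ^ (β - 1)))
    (fun i => Measurable.aestronglyMeasurable (by fun_prop))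
    (fun i => by
      filter_upwards [ae_restrict_mem measurableSet_levelRange] with s hs
      obtain ⟨h1, h2, h3, h4⟩ := hle s hs
      rw [← hexp i s hs, norm_mul, norm_mul (c i), Real.norm_eq_abs (c i),
        Real.norm_of_nonneg (by positivity), Real.norm_of_nonneg (by positivity), mul_comm, pow_add]
      gcongr)
    (by
      filter_upwards with s
      exact hc.mul_right _)
    (by
      simp only [tsum_mul_right]
      exact hbase.const_mul _)
    (by
      filter_upwards [ae_restrict_mem measurableSet_levelRange] with s hs
      obtain ⟨h1, h2, h3, h4⟩ := hle s hs
      refine ((hM s (s + w) h1 h2 h3 h4).mul_left _).congr_fun fun i => (hexp i s hs).symm)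
  have h1 : ∀ i, ∫ s in levelRange ρ w, c i * (s ^ (α + a i - 1) * (s + w) ^ (β + b i - 1)) =
      c i * (betaRatio α β (a i) (b i) * B) * w ^ (a i + b i) * (modelIntegral ρ α β w / B) +
      ((ρ - w) / 2) ^ α * ((ρ + w) / 2) ^ β * (c i * cutoffPoly ρ α β w (a i) (b i)) := by
    intro i
    have hB0 : B ≠ 0 := by rw [hB]; positivity
    rw [integral_const_mul]
    have := modelIntegral_add_nat hw hα hβ (a i) (b i)
    rw [modelIntegral] at this
    rw [this]
    field_simp
  have h2 : HasSum (fun i => c i * (betaRatio α β (a i) (b i) * B) * w ^ (a i + b i)) (S w) :=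
    (Summable.of_norm_bounded (hS |w| (abs_nonneg _) (hw.trans_le hρR)) fun i => by
      rw [norm_mul, norm_pow]; rfl).hasSum
  have h3 : HasSum (fun i => c i * cutoffPoly ρ α β w (a i) (b i)) (Y w) :=
    (Summable.of_norm_bounded (hc.mul_left K) fun i => by
      have h := hbound i (w : ℂ) (by simpa using hw)
      rw [← ofReal_cutoffPoly, ← Complex.ofReal_mul, Complex.norm_real] at h
      exact h).hasSum
  have h4 := (h2.mul_right (modelIntegral ρ α β w / B)).add
    (h3.mul_left (((ρ - w) / 2) ^ α * ((ρ + w) / 2) ^ β))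
  rw [(hsum.congr_fun fun i => (h1 i).symm).unique h4]
  have h5 := hU w hw hw0
  have h6 : modelIntegral ρ α β w / B = hNonanalytic (k + m) (k % 4) w + E₀ w := by
    rw [← h5, hB]; field_simp
  rw [h6]; ring

end SeriesIntegral

/-! ### Slicing the quadrant by energy levels -/

section Level

theorem mem_levelRange_iff {ρ w s : ℝ} :
    s ∈ levelRange ρ w ↔ 0 < s ∧ 0 < s + w ∧ s + (s + w) ≤ ρ := by
  simp only [levelRange, mem_Ioc, max_lt_iff]
  constructor
  · rintro ⟨⟨h1, h2⟩, h3⟩; exact ⟨h1, by linarith, by linarith⟩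
  · rintro ⟨h1, h2, h3⟩; exact ⟨⟨h1, by linarith⟩, by linarith⟩

/-- Integration over the quadrant, organized by the levels of `t - s`. -/
theorem lintegral_level {g : ℝ → ℝ → ENNReal} (hg : Measurable (Function.uncurry g)) (ρ : ℝ)
    {A : Set ℝ} (hA : MeasurableSet A) :
    ∫⁻ s in Ioi (0 : ℝ), ∫⁻ t in Ioi (0 : ℝ),
        {p : ℝ × ℝ | p.1 + p.2 ≤ ρ ∧ p.2 - p.1 ∈ A}.indicator (Function.uncurry g) (s, t) =
      ∫⁻ w in A, ∫⁻ s in levelRange ρ w, g s (s + w) := by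
  set T : Set (ℝ × ℝ) := {p | (0 < p.1 ∧ 0 < p.2) ∧ p.1 + p.2 ≤ ρ ∧ p.2 - p.1 ∈ A} with hT
  have hTm : MeasurableSet T := by
    refine ((measurableSet_lt measurable_const measurable_fst).inter
      (measurableSet_lt measurable_const measurable_snd)).inter
      ((measurableSet_le (measurable_fst.add measurable_snd) measurable_const).inter ?_)
    exact (measurable_snd.sub measurable_fst) hA
  have hG : Measurable (T.indicator (Function.uncurry g)) := hg.indicator hTm
  -- For fixed s the translation t = s + w replaces t by the energy, after which the order of
  -- integration can be exchanged.
  have h1 : ∀ s ∈ Ioi (0 : ℝ), ∫⁻ t in Ioi (0 : ℝ),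
      {p : ℝ × ℝ | p.1 + p.2 ≤ ρ ∧ p.2 - p.1 ∈ A}.indicator (Function.uncurry g) (s, t) =
      ∫⁻ w, T.indicator (Function.uncurry g) (s, s + w) := by
    intro s hs
    rw [lintegral_add_left_eq_self (fun t => T.indicator (Function.uncurry g) (s, t)) s,
      ← lintegral_indicator measurableSet_Ioi]
    refine lintegral_congr fun t => ?_
    have hs' : 0 < s := hs
    have hmem : (s, t) ∈ T ↔ 0 < t ∧ s + t ≤ ρ ∧ t - s ∈ A := by simp [hT, hs']
    clear_value T
    simp only [indicator, mem_ofPred_eq, mem_Ioi, hmem]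
    split_ifs <;> first | rfl | (exfalso; tauto)
  have h2 : ∀ s : ℝ, s ∉ Ioi (0 : ℝ) → ∫⁻ w, T.indicator (Function.uncurry g) (s, s + w) = 0 := by
    intro s hs
    have hs' : ¬ 0 < s := hs
    simp [indicator, hT, hs']
  rw [setLIntegral_congr_fun measurableSet_Ioi h1, ← lintegral_indicator measurableSet_Ioi]
  have h3 : (Ioi (0 : ℝ)).indicator (fun s => ∫⁻ w, T.indicator (Function.uncurry g) (s, s + w)) =
      fun s => ∫⁻ w, T.indicator (Function.uncurry g) (s, s + w) := by
    funext s
    by_cases hs : s ∈ Ioi (0 : ℝ)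
    · rw [indicator_of_mem hs]
    · rw [indicator_of_notMem hs, h2 s hs]
  have hG' : Measurable fun q : ℝ × ℝ => T.indicator (Function.uncurry g) (q.1, q.1 + q.2) :=
    hG.comp (measurable_fst.prodMk (measurable_fst.add measurable_snd))
  rw [h3]
  beta_reduce
  rw [lintegral_lintegral_swap hG'.aemeasurable, ← lintegral_indicator hA]
  refine lintegral_congr fun w => ?_
  by_cases hw : w ∈ A
  · rw [indicator_of_mem hw, ← lintegral_indicator measurableSet_levelRange]
    refine lintegral_congr fun s => ?_
    have : (s, s + w) ∈ T ↔ s ∈ levelRange ρ w := by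
      rw [mem_levelRange_iff]
      simp [hT, hw, and_assoc]
    by_cases hs : s ∈ levelRange ρ w
    · rw [indicator_of_mem hs, indicator_of_mem (this.2 hs)]; rfl
    · rw [indicator_of_notMem hs, indicator_of_notMem (mt this.1 hs)]
  · rw [indicator_of_notMem hw]
    simp [indicator, hT, hw]

end Level

/-! ### Splitting the coordinates into two blocks -/

section Glue

variable {ι : Type*} [Fintype ι] (p : ι → Prop) [DecidablePred p]

/-- The linear map putting together the coordinates satisfying `p` and the remaining ones. -/
noncomputable def glue :
    EuclideanSpace ℝ {i // p i} × EuclideanSpace ℝ {i // ¬ p i} →L[ℝ] EuclideanSpace ℝ ι :=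
  LinearMap.toContinuousLinearMap
    { toFun := fun y => WithLp.toLp 2 fun i => if h : p i then y.1 ⟨i, h⟩ else y.2 ⟨i, h⟩
      map_add' := fun y z => by ext i; by_cases h : p i <;> simp [h]
      map_smul' := fun c y => by ext i; by_cases h : p i <;> simp [h] }

variable {p}

theorem glue_apply (y : EuclideanSpace ℝ {i // p i} × EuclideanSpace ℝ {i // ¬ p i}) (i : ι) :
    glue p y i = if h : p i then y.1 ⟨i, h⟩ else y.2 ⟨i, h⟩ := rfl

theorem glue_apply_pos (y : EuclideanSpace ℝ {i // p i} × EuclideanSpace ℝ {i // ¬ p i})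
    (i : {i // p i}) : glue p y i = y.1 i := by rw [glue_apply, dif_pos i.2]

theorem glue_apply_neg (y : EuclideanSpace ℝ {i // p i} × EuclideanSpace ℝ {i // ¬ p i})
    (i : {i // ¬ p i}) : glue p y i = y.2 i := by rw [glue_apply, dif_neg i.2]

theorem lintegral_glue {f : EuclideanSpace ℝ ι → ENNReal} (hf : Measurable f) :
    ∫⁻ x, f x = ∫⁻ y : EuclideanSpace ℝ {i // p i} × EuclideanSpace ℝ {i // ¬ p i},
      f (glue p y) := by
  have h1 := (EuclideanSpace.volume_preserving_symm_measurableEquiv_toLp {i // p i}).prod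
    (EuclideanSpace.volume_preserving_symm_measurableEquiv_toLp {i // ¬ p i})
  have h2 := (volume_preserving_piEquivPiSubtypeProd (fun _ : ι => ℝ) p).symm
  have h3 := (EuclideanSpace.volume_preserving_symm_measurableEquiv_toLp ι).symm
  have h4 := h3.comp (h2.comp h1)
  rw [← h4.lintegral_comp hf]
  rfl

theorem lintegral_polar_swap {κ : Type*} [Fintype κ] [Nonempty κ]
    {f : EuclideanSpace ℝ κ → ENNReal} (hf : Measurable f) :
    ∫⁻ x, f x = ∫⁻ s in Ioi (0 : ℝ), ENNReal.ofReal (1 / 2 * s ^ ((Fintype.card κ : ℝ) / 2 - 1)) *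
      ∫⁻ ω : USphere κ, f (√s • (ω : EuclideanSpace ℝ κ)) ∂(surfaceMeasure κ) := by
  have hm : Measurable fun q : USphere κ × ℝ =>
      ENNReal.ofReal (1 / 2 * q.2 ^ ((Fintype.card κ : ℝ) / 2 - 1)) *
        f (√q.2 • (q.1 : EuclideanSpace ℝ κ)) :=
    Measurable.mul (by fun_prop) (hf.comp (by fun_prop))
  rw [lintegral_polar hf, lintegral_lintegral_swap hm.aemeasurable]
  refine lintegral_congr fun s => ?_
  have hs : Measurable fun ω : USphere κ => f (√s • (ω : EuclideanSpace ℝ κ)) :=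
    hf.comp (by fun_prop)
  rw [lintegral_const_mul _ hs]

/-- Bipolar coordinates on a product of two Euclidean spaces. -/
theorem lintegral_polar_prod {κ κ' : Type*} [Fintype κ] [Fintype κ'] [Nonempty κ] [Nonempty κ']
    {h : EuclideanSpace ℝ κ × EuclideanSpace ℝ κ' → ENNReal} (hh : Measurable h) :
    ∫⁻ y, h y = ∫⁻ s in Ioi (0 : ℝ), ∫⁻ t in Ioi (0 : ℝ),
      ENNReal.ofReal (1 / 2 * s ^ ((Fintype.card κ : ℝ) / 2 - 1)) *
      (ENNReal.ofReal (1 / 2 * t ^ ((Fintype.card κ' : ℝ) / 2 - 1)) *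
        ∫⁻ ω : USphere κ × USphere κ', h (√s • (ω.1 : EuclideanSpace ℝ κ),
          √t • (ω.2 : EuclideanSpace ℝ κ')) ∂(surfaceMeasure κ).prod (surfaceMeasure κ')) := by
  rw [Measure.volume_eq_prod, lintegral_prod _ hh.aemeasurable,
    lintegral_polar_swap hh.lintegral_prod_right']
  refine lintegral_congr fun s => ?_
  have hm1 : Measurable fun q : USphere κ × EuclideanSpace ℝ κ' =>
      h (√s • (q.1 : EuclideanSpace ℝ κ), q.2) := hh.comp (by fun_prop)
  have hm2 : Measurable fun q : ℝ × (USphere κ × USphere κ') =>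
      h (√s • (q.2.1 : EuclideanSpace ℝ κ), √q.1 • (q.2.2 : EuclideanSpace ℝ κ')) :=
    hh.comp (by fun_prop)
  have hm3 : Measurable fun t : ℝ =>
      ENNReal.ofReal (1 / 2 * t ^ ((Fintype.card κ' : ℝ) / 2 - 1)) *
        ∫⁻ ω : USphere κ × USphere κ', h (√s • (ω.1 : EuclideanSpace ℝ κ),
          √t • (ω.2 : EuclideanSpace ℝ κ')) ∂(surfaceMeasure κ).prod (surfaceMeasure κ') :=
    Measurable.mul (by fun_prop) hm2.lintegral_prod_right'
  rw [lintegral_const_mul _ hm3, lintegral_lintegral_swap hm1.aemeasurable,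
    lintegral_polar_swap hm1.lintegral_prod_left']
  congr 1
  refine lintegral_congr fun t => ?_
  have hm4 : Measurable fun q : USphere κ × USphere κ' =>
      h (√s • (q.1 : EuclideanSpace ℝ κ), √t • (q.2 : EuclideanSpace ℝ κ')) :=
    hh.comp (by fun_prop)
  rw [lintegral_prod_symm _ hm4.aemeasurable]

end Glue

/-! ### Bipolar coordinates adapted to the Morse form -/

section Bipolar

variable {N : ℕ} {k : ℕ}

/-- The directions spanned by the first `k` coordinates. -/
abbrev NegSphere (N k : ℕ) : Type := USphere {i : Fin N // i.val < k}

/-- The directions spanned by the coordinates after the first `k`. -/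
abbrev PosSphere (N k : ℕ) : Type := USphere {i : Fin N // ¬ i.val < k}

/-- The product of the surface measures of the two spheres. -/
noncomputable abbrev bipolarMeasure (N k : ℕ) : Measure (NegSphere N k × PosSphere N k) :=
  (surfaceMeasure {i : Fin N // i.val < k}).prod (surfaceMeasure {i : Fin N // ¬ i.val < k})

/-- The point with negative part `√s ω₁` and positive part `√t ω₂`. -/
noncomputable def bipolarPoint (s t : ℝ) (ω : NegSphere N k × PosSphere N k) : Conf N :=
  glue (fun i : Fin N => i.val < k) (√s • (ω.1 : EuclideanSpace ℝ _),
    √t • (ω.2 : EuclideanSpace ℝ _))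

/-- The average of `J` over the directions. -/
noncomputable def shellIntegral (k : ℕ) (J : Conf N → ℝ) (s t : ℝ) : ℝ :=
  1 / 4 * ∫ ω, J (bipolarPoint s t ω) ∂bipolarMeasure N k

theorem continuous_bipolarPoint :
    Continuous fun q : (ℝ × ℝ) × (NegSphere N k × PosSphere N k) =>
      bipolarPoint q.1.1 q.1.2 q.2 := by
  unfold bipolarPoint
  fun_prop

theorem card_neg (hk : k ≤ N) : Fintype.card {i : Fin N // i.val < k} = k := by
  rw [Fintype.card_subtype]
  simp [Fin.card_filter_val_lt, hk]

theorem card_pos_index (hk : k ≤ N) : Fintype.card {i : Fin N // ¬ i.val < k} = N - k := by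
  rw [Fintype.card_subtype_compl, card_neg hk, Fintype.card_fin]

theorem sum_sq_sphere {ι : Type*} [Fintype ι] (ω : USphere ι) :
    ∑ i, (ω : EuclideanSpace ℝ ι) i ^ 2 = 1 := by
  have h := EuclideanSpace.norm_sq_eq (ω : EuclideanSpace ℝ ι)
  have hnorm : ‖(ω : EuclideanSpace ℝ ι)‖ = 1 := by simp
  rw [hnorm] at h
  simpa using h.symm

theorem bipolarPoint_neg (s t : ℝ) (ω : NegSphere N k × PosSphere N k)
    (i : {i : Fin N // i.val < k}) :
    bipolarPoint s t ω i = √s * (ω.1 : EuclideanSpace ℝ _) i := by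
  rw [bipolarPoint, glue_apply_pos]; rfl

theorem bipolarPoint_pos (s t : ℝ) (ω : NegSphere N k × PosSphere N k)
    (i : {i : Fin N // ¬ i.val < k}) :
    bipolarPoint s t ω i = √t * (ω.2 : EuclideanSpace ℝ _) i := by
  rw [bipolarPoint, glue_apply_neg]; rfl

theorem norm_sq_bipolarPoint {s t : ℝ} (hs : 0 ≤ s) (ht : 0 ≤ t)
    (ω : NegSphere N k × PosSphere N k) : ‖bipolarPoint s t ω‖ ^ 2 = s + t := by
  rw [EuclideanSpace.norm_sq_eq]
  simp only [Real.norm_eq_abs, sq_abs]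
  rw [← Fintype.sum_subtype_add_sum_subtype (fun i : Fin N => i.val < k)]
  simp only [bipolarPoint_neg, bipolarPoint_pos, mul_pow, Real.sq_sqrt hs, Real.sq_sqrt ht,
    ← Finset.mul_sum, sum_sq_sphere, mul_one]

theorem morseForm_bipolarPoint {s t : ℝ} (hs : 0 ≤ s) (ht : 0 ≤ t)
    (ω : NegSphere N k × PosSphere N k) : morseForm k (bipolarPoint s t ω) = t - s := by
  rw [morseForm_eq_sum, ← Fintype.sum_subtype_add_sum_subtype (fun i : Fin N => i.val < k)]
  have h1 : ∀ i : {i : Fin N // i.val < k}, (if i.1.val < k then (-1 : ℝ) else 1) = -1 :=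
    fun i => if_pos i.2
  have h2 : ∀ i : {i : Fin N // ¬ i.val < k}, (if i.1.val < k then (-1 : ℝ) else 1) = 1 :=
    fun i => if_neg i.2
  simp only [h1, h2, bipolarPoint_neg, bipolarPoint_pos, mul_pow, Real.sq_sqrt hs, Real.sq_sqrt ht,
    ← Finset.mul_sum, sum_sq_sphere, mul_one]
  ring

theorem continuous_morseForm (k : ℕ) : Continuous (morseForm (N := N) k) := by
  rw [funext (morseForm_eq_sum k)]
  fun_prop

theorem measurable_shellIntegral {J : Conf N → ℝ} (hJ : Measurable J) :
    Measurable (Function.uncurry (shellIntegral k J)) := by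
  have h1 : Measurable fun q : (ℝ × ℝ) × (NegSphere N k × PosSphere N k) =>
      J (bipolarPoint q.1.1 q.1.2 q.2) := hJ.comp continuous_bipolarPoint.measurable
  exact (h1.stronglyMeasurable.integral_prod_right' (ν := bipolarMeasure N k)).measurable.const_mul _

theorem measurable_bipolarPoint (s t : ℝ) :
    Measurable (bipolarPoint s t : NegSphere N k × PosSphere N k → Conf N) :=
  (continuous_bipolarPoint.comp (Continuous.prodMk_right (s, t))).measurable

theorem bipolarPoint_mem_closedBall_iff {r : ℝ} (hr : 0 ≤ r) {s t : ℝ} (hs : 0 ≤ s) (ht : 0 ≤ t)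
    (ω : NegSphere N k × PosSphere N k) :
    bipolarPoint s t ω ∈ Metric.closedBall 0 r ↔ s + t ≤ r ^ 2 := by
  rw [mem_closedBall_zero_iff, ← norm_sq_bipolarPoint hs ht ω, pow_le_pow_iff_left₀
    (norm_nonneg _) hr two_ne_zero]

theorem integrable_bipolarPoint {J : Conf N → ℝ} (hJ : Measurable J) {r : ℝ} (hr : 0 ≤ r)
    (hJc : ContinuousOn J (Metric.closedBall 0 r)) {s t : ℝ} (hs : 0 ≤ s) (ht : 0 ≤ t)
    (hst : s + t ≤ r ^ 2) :
    Integrable (fun ω => J (bipolarPoint s t ω)) (bipolarMeasure N k) := by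
  obtain ⟨C, hC⟩ := (isCompact_closedBall (0 : Conf N) r).exists_bound_of_continuousOn hJc
  exact Integrable.of_bound (C := C) (hJ.comp (measurable_bipolarPoint s t)).aestronglyMeasurable
    (Eventually.of_forall fun ω => hC _ ((bipolarPoint_mem_closedBall_iff hr hs ht ω).2 hst))

theorem shellIntegral_nonneg {J : Conf N → ℝ} (hJ : ∀ x, 0 ≤ J x) (s t : ℝ) :
    0 ≤ shellIntegral k J s t :=
  mul_nonneg (by norm_num) (integral_nonneg fun _ => hJ _)

/-- The weighted volume of a set of levels, in bipolar coordinates. -/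
theorem lintegral_closedBall_eq_level (hk : 0 < k) (hkN : k < N) {J : Conf N → ℝ}
    (hJ : Measurable J) (hJ0 : ∀ x, 0 ≤ J x) {r : ℝ} (hr : 0 ≤ r)
    (hJc : ContinuousOn J (Metric.closedBall 0 r)) {A : Set ℝ} (hA : MeasurableSet A) :
    ∫⁻ x in Metric.closedBall 0 r ∩ morseForm k ⁻¹' A, ENNReal.ofReal (J x) =
      ∫⁻ w in A, ∫⁻ s in levelRange (r ^ 2) w, ENNReal.ofReal
        (s ^ ((k : ℝ) / 2 - 1) * (s + w) ^ (((N - k : ℕ) : ℝ) / 2 - 1) *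
          shellIntegral k J s (s + w)) := by
  have : Nonempty {i : Fin N // i.val < k} := ⟨⟨⟨0, by omega⟩, hk⟩⟩
  have : Nonempty {i : Fin N // ¬ i.val < k} := ⟨⟨⟨k, hkN⟩, lt_irrefl k⟩⟩
  have hset : MeasurableSet (Metric.closedBall (0 : Conf N) r ∩ morseForm k ⁻¹' A) :=
    measurableSet_closedBall.inter ((continuous_morseForm k).measurable hA)
  have hfm := (hJ.ennreal_ofReal).indicator hset
  have hfm' : Measurable fun y => (Metric.closedBall (0 : Conf N) r ∩ morseForm k ⁻¹' A).indicator
      (fun x => ENNReal.ofReal (J x)) (glue (fun i : Fin N => i.val < k) y) :=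
    hfm.comp (glue _).continuous.measurable
  rw [← lintegral_indicator hset, lintegral_glue (p := fun i : Fin N => i.val < k) hfm,
    lintegral_polar_prod hfm', card_neg hkN.le, card_pos_index hkN.le]
  set g : ℝ → ℝ → ENNReal := fun s t => ENNReal.ofReal (1 / 2 * s ^ ((k : ℝ) / 2 - 1)) *
    (ENNReal.ofReal (1 / 2 * t ^ (((N - k : ℕ) : ℝ) / 2 - 1)) *
      ∫⁻ ω, ENNReal.ofReal (J (bipolarPoint s t ω)) ∂bipolarMeasure N k) with hg
  have hgm : Measurable (Function.uncurry g) := by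
    have h1 : Measurable fun q : (ℝ × ℝ) × (NegSphere N k × PosSphere N k) =>
      ENNReal.ofReal (J (bipolarPoint q.1.1 q.1.2 q.2)) :=
        (hJ.comp continuous_bipolarPoint.measurable).ennreal_ofReal
    have h2 := h1.lintegral_prod_right' (ν := bipolarMeasure N k)
    exact Measurable.mul (by fun_prop) (Measurable.mul (by fun_prop) h2)
  have hlev := lintegral_level hgm (r ^ 2) hA
  rw [← setLIntegral_congr_fun measurableSet_Ioi fun s hs =>
    setLIntegral_congr_fun measurableSet_Ioi fun t ht => ?_, hlev]
  rotate_left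
  · have hs' : 0 < s := hs
    have ht' : 0 < t := ht
    have hmem : ∀ ω : NegSphere N k × PosSphere N k, (bipolarPoint s t ω ∈
        Metric.closedBall (0 : Conf N) r ∩ morseForm k ⁻¹' A) ↔ s + t ≤ r ^ 2 ∧ t - s ∈ A := by
      intro ω
      rw [mem_inter_iff, bipolarPoint_mem_closedBall_iff hr hs'.le ht'.le, mem_preimage,
        morseForm_bipolarPoint hs'.le ht'.le]
    change _ = ENNReal.ofReal _ * (ENNReal.ofReal _ * ∫⁻ ω, indicator _ _ (bipolarPoint s t ω) ∂_)
    by_cases hst : s + t ≤ r ^ 2 ∧ t - s ∈ A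
    · rw [indicator_of_mem (show (s, t) ∈ {p : ℝ × ℝ | p.1 + p.2 ≤ r ^ 2 ∧ p.2 - p.1 ∈ A} from hst)]
      simp only [indicator_of_mem ((hmem _).2 hst)]
      rfl
    · rw [indicator_of_notMem (show (s, t) ∉ {p : ℝ × ℝ | p.1 + p.2 ≤ r ^ 2 ∧ p.2 - p.1 ∈ A} from hst)]
      simp only [indicator_of_notMem (mt (hmem _).1 hst), lintegral_zero, mul_zero]
  · refine setLIntegral_congr_fun hA fun w _ => setLIntegral_congr_fun measurableSet_levelRange
      fun s hs => ?_
    obtain ⟨h1, h2, h3⟩ := mem_levelRange_iff.1 hs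
    simp only [hg]
    -- The two radial weights each carry a factor 1/2; their product is the 1/4 in `shellIntegral`.
    rw [← ofReal_integral_eq_lintegral_ofReal (integrable_bipolarPoint hJ hr hJc h1.le h2.le h3)
      (Eventually.of_forall fun ω => hJ0 _), ← ENNReal.ofReal_mul (by positivity),
      ← ENNReal.ofReal_mul (by positivity), shellIntegral]
    congr 1
    ring

end Bipolar

/-! ### Power series of the sphere averages -/

section Moments

variable {N : ℕ} {k : ℕ} {J : Conf N → ℝ} {R R₁ : ℝ}

theorem summable_taylorCoeff_mul_pow
    (h : ∀ x ∈ polydisc N R, Summable fun I => taylorCoeff J I * monom x I) (h0 : 0 ≤ R₁)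
    (hR : R₁ < R) : Summable fun I : Fin N → ℕ => |taylorCoeff J I| * R₁ ^ (∑ j, I j) := by
  have h1 := (h (WithLp.toLp 2 fun _ => R₁) fun i => by
    simpa only [abs_of_nonneg h0] using hR).norm
  refine h1.congr fun I => ?_
  simp [monom, Finset.prod_pow_eq_pow_sum, abs_of_nonneg h0]

/-- Termwise integration of the Taylor series along a bounded family of points. -/
theorem hasSum_integral_monom {X : Type*} [MeasurableSpace X] {μ : Measure X} [IsFiniteMeasure μ]
    (h : ∀ x ∈ polydisc N R, HasSum (fun I => taylorCoeff J I * monom x I) (J x)) (h0 : 0 ≤ R₁)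
    (hR : R₁ < R) {x : X → Conf N} (hx : Measurable x) (hb : ∀ ω i, |x ω i| ≤ R₁) :
    HasSum (fun I => taylorCoeff J I * ∫ ω, monom (x ω) I ∂μ) (∫ ω, J (x ω) ∂μ) := by
  have hs := summable_taylorCoeff_mul_pow (fun x hx => (h x hx).summable) h0 hR
  have h1 := hasSum_integral_of_dominated_convergence (μ := μ)
    (F := fun I ω => taylorCoeff J I * monom (x ω) I) (f := fun ω => J (x ω))
    (fun I _ => |taylorCoeff J I| * R₁ ^ (∑ j, I j))
    (fun I => by
      refine Measurable.aestronglyMeasurable ?_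
      unfold monom
      fun_prop)
    (fun I => Eventually.of_forall fun ω => by
      rw [norm_mul, Real.norm_eq_abs, Real.norm_eq_abs, monom, Finset.abs_prod,
        ← Finset.prod_pow_eq_pow_sum]
      gcongr with i
      rw [abs_pow]
      gcongr
      exact hb ω i)
    (Eventually.of_forall fun _ => hs) (integrable_const _)
    (Eventually.of_forall fun ω => h _ fun i => (hb ω i).trans_lt hR)
  simpa only [integral_const_mul] using h1

theorem hasSum_integral_monom_even {X : Type*} [MeasurableSpace X] {μ : Measure X}
    [IsFiniteMeasure μ]
    (h : ∀ x ∈ polydisc N R, HasSum (fun I => taylorCoeff J I * monom x I) (J x)) (h0 : 0 ≤ R₁)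
    (hR : R₁ < R) {x : X → Conf N} (hx : Measurable x) (hb : ∀ ω i, |x ω i| ≤ R₁)
    (hodd : ∀ I : Fin N → ℕ, (∃ j, Odd (I j)) → ∫ ω, monom (x ω) I ∂μ = 0) :
    HasSum (fun I : Fin N → ℕ => taylorCoeff J (fun j => 2 * I j) *
      ∫ ω, monom (x ω) (fun j => 2 * I j) ∂μ) (∫ ω, J (x ω) ∂μ) := by
  refine (two_mul_index_injective.hasSum_iff fun I hI => ?_).2
    (hasSum_integral_monom h h0 hR hx hb)
  rw [hodd I, mul_zero]
  by_contra! hc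
  refine hI ⟨fun j => I j / 2, funext fun j => ?_⟩
  have := Nat.not_odd_iff_even.1 (hc j)
  exact Nat.mul_div_cancel' this.two_dvd

theorem integral_monom_smul_sphere (s : ℝ) (I : Fin N → ℕ) :
    ∫ ω : USphere (Fin N), monom (√s • (ω : Conf N)) I ∂surfaceMeasure (Fin N) =
      √s ^ (∑ j, I j) * ∫ ω : USphere (Fin N), ∏ j, (ω : Conf N) j ^ I j ∂surfaceMeasure (Fin N) := by
  rw [← integral_const_mul]
  refine integral_congr_ae (Eventually.of_forall fun ω => ?_)
  simp [monom, mul_pow, Finset.prod_mul_distrib, Finset.prod_pow_eq_pow_sum]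

/-- The spherical mean of `J` is the analytic factor. -/
theorem hasSum_sphere_integral (hN : 0 < N)
    (h : ∀ x ∈ polydisc N R, HasSum (fun I => taylorCoeff J I * monom x I) (J x)) (hR : 0 < R)
    {s : ℝ} (hs : 0 ≤ s) (hsR : s < R ^ 2) :
    HasSum (fun I => factorCoeff N 0 J I * s ^ (∑ j, I j))
      (1 / 2 * ∫ ω : USphere (Fin N), J (√s • (ω : Conf N)) ∂surfaceMeasure (Fin N)) := by
  have : Nonempty (Fin N) := ⟨⟨0, hN⟩⟩
  have h1 := hasSum_integral_monom_even (μ := surfaceMeasure (Fin N))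
    (x := fun ω : USphere (Fin N) => √s • (ω : Conf N)) h
    (Real.sqrt_nonneg s) ((Real.sqrt_lt' hR).2 hsR) (by fun_prop)
    (fun ω i => by
      rw [PiLp.smul_apply, smul_eq_mul, abs_mul, abs_of_nonneg (Real.sqrt_nonneg s)]
      exact mul_le_of_le_one_right (Real.sqrt_nonneg s) (abs_apply_le_one_of_sphere ω i))
    (fun I ⟨j, hj⟩ => by rw [integral_monom_smul_sphere, sphere_moment_odd hj, mul_zero])
  refine (h1.mul_left (1 / 2)).congr_fun fun I => ?_
  rw [integral_monom_smul_sphere, sphere_moment_even, ← Finset.mul_sum, pow_mul, Real.sq_sqrt hs,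
    factorCoeff]
  simp only [not_lt_zero, Finset.filter_false, Finset.sum_empty, pow_zero, Fintype.card_fin]
  push_cast
  ring

/-- The coefficients of the expansion of `shellIntegral`. -/
noncomputable def shellCoeff (k : ℕ) (J : Conf N → ℝ) (I : Fin N → ℕ) : ℝ :=
  taylorCoeff J (fun j => 2 * I j) * ((∏ j, Real.Gamma (I j + 1 / 2)) /
    (Real.Gamma ((k : ℝ) / 2 + (∑ j : {j : Fin N // j.val < k}, I j : ℕ)) *
      Real.Gamma (((N - k : ℕ) : ℝ) / 2 + (∑ j : {j : Fin N // ¬ j.val < k}, I j : ℕ))))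

theorem integral_monom_bipolarPoint (s t : ℝ) (I : Fin N → ℕ) :
    ∫ ω, monom (bipolarPoint s t ω) I ∂bipolarMeasure N k =
      √s ^ (∑ j : {j : Fin N // j.val < k}, I j) * √t ^ (∑ j : {j : Fin N // ¬ j.val < k}, I j) *
      ((∫ ω : NegSphere N k, ∏ j : {i : Fin N // i.val < k}, ω.1 j ^ I j ∂surfaceMeasure _) *
        ∫ ω : PosSphere N k, ∏ j : {i : Fin N // ¬ i.val < k}, ω.1 j ^ I j ∂surfaceMeasure _) := by
  rw [← integral_prod_mul (fun ω : NegSphere N k => ∏ j : {i : Fin N // i.val < k}, ω.1 j ^ I j)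
    (fun ω : PosSphere N k => ∏ j : {i : Fin N // ¬ i.val < k}, ω.1 j ^ I j), ← integral_const_mul]
  refine integral_congr_ae (Eventually.of_forall fun ω => ?_)
  simp only [monom]
  rw [← Fintype.prod_subtype_mul_prod_subtype (fun i : Fin N => i.val < k)]
  simp only [bipolarPoint_neg, bipolarPoint_pos, mul_pow, Finset.prod_mul_distrib,
    Finset.prod_pow_eq_pow_sum]
  ring

/-- Even moments of the product of spheres factorize, and the factors 2 of the two moments cancel
the 1/4. Points with s, t ≤ R₁ < R² have coordinates at most √R₁ < R, inside the polydisc of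
convergence. -/
theorem hasSum_shellIntegral (hk : 0 < k) (hkN : k < N)
    (h : ∀ x ∈ polydisc N R, HasSum (fun I => taylorCoeff J I * monom x I) (J x))
    (hR : 0 < R) (hRR : R₁ < R ^ 2) {s t : ℝ} (hs : 0 ≤ s) (ht : 0 ≤ t) (hsR : s ≤ R₁)
    (htR : t ≤ R₁) :
    HasSum (fun I => shellCoeff k J I * (s ^ (∑ j : {j : Fin N // j.val < k}, I j) *
      t ^ (∑ j : {j : Fin N // ¬ j.val < k}, I j))) (shellIntegral k J s t) := by
  have : Nonempty {i : Fin N // i.val < k} := ⟨⟨⟨0, by omega⟩, hk⟩⟩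
  have : Nonempty {i : Fin N // ¬ i.val < k} := ⟨⟨⟨k, hkN⟩, lt_irrefl k⟩⟩
  have hb : ∀ (u x : ℝ), u ≤ R₁ → |x| ≤ 1 → |√u * x| ≤ √R₁ := fun u x hu hx => by
    rw [abs_mul, abs_of_nonneg (Real.sqrt_nonneg u)]
    exact (mul_le_of_le_one_right (Real.sqrt_nonneg u) hx).trans (Real.sqrt_le_sqrt hu)
  have h1 := hasSum_integral_monom_even (μ := bipolarMeasure N k)
    (x := bipolarPoint s t) h (Real.sqrt_nonneg R₁) ((Real.sqrt_lt' hR).2 hRR)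
    (measurable_bipolarPoint s t)
    (fun ω i => by
      by_cases hi : i.val < k
      · rw [bipolarPoint_neg s t ω ⟨i, hi⟩]
        exact hb _ _ hsR (abs_apply_le_one_of_sphere _ _)
      · rw [bipolarPoint_pos s t ω ⟨i, hi⟩]
        exact hb _ _ htR (abs_apply_le_one_of_sphere _ _))
    (fun I ⟨j, hj⟩ => by
      rw [integral_monom_bipolarPoint]
      by_cases hi : j.val < k
      · rw [sphere_moment_odd (n := fun i : {i : Fin N // i.val < k} => I i) (j := ⟨j, hi⟩) hj]
        ring
      · rw [sphere_moment_odd (n := fun i : {i : Fin N // ¬ i.val < k} => I i) (j := ⟨j, hi⟩) hj]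
        ring)
  refine (h1.mul_left (1 / 4)).congr_fun fun I => ?_
  rw [integral_monom_bipolarPoint,
    sphere_moment_even (fun i : {i : Fin N // i.val < k} => I i),
    sphere_moment_even (fun i : {i : Fin N // ¬ i.val < k} => I i), ← Finset.mul_sum,
    ← Finset.mul_sum, pow_mul, pow_mul, Real.sq_sqrt hs, Real.sq_sqrt ht, shellCoeff,
    card_neg hkN.le, card_pos_index hkN.le,
    ← Fintype.prod_subtype_mul_prod_subtype (fun i : Fin N => i.val < k)]
  push_cast
  ring

theorem summable_shellCoeff (hk : 0 < k) (hkN : k < N)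
    (h : ∀ x ∈ polydisc N R, Summable fun I => taylorCoeff J I * monom x I) (hR₁ : 0 ≤ R₁)
    (hR : 0 < R) (hRR : R₁ < R ^ 2) :
    Summable fun I => |shellCoeff k J I| * R₁ ^ ((∑ j : {j : Fin N // j.val < k}, I j) +
      ∑ j : {j : Fin N // ¬ j.val < k}, I j) := by
  have : Nonempty {i : Fin N // i.val < k} := ⟨⟨⟨0, by omega⟩, hk⟩⟩
  have : Nonempty {i : Fin N // ¬ i.val < k} := ⟨⟨⟨k, hkN⟩, lt_irrefl k⟩⟩
  have h1 := (((summable_taylorCoeff_mul_pow h (Real.sqrt_nonneg R₁)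
    ((Real.sqrt_lt' hR).2 hRR)).comp_injective two_mul_index_injective).mul_left
    ((surfaceMeasure {i : Fin N // i.val < k}).real univ *
      (surfaceMeasure {i : Fin N // ¬ i.val < k}).real univ))
  refine Summable.of_nonneg_of_le (fun I => by positivity) (fun I => ?_) h1
  have e1 := prod_Gamma_div_Gamma_le fun i : {i : Fin N // i.val < k} => I i
  have e2 := prod_Gamma_div_Gamma_le fun i : {i : Fin N // ¬ i.val < k} => I i
  rw [card_neg hkN.le] at e1
  rw [card_pos_index hkN.le] at e2
  have hk' : (0 : ℝ) < k := by exact_mod_cast hk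
  have hm' : (0 : ℝ) < (N - k : ℕ) := by exact_mod_cast Nat.sub_pos_of_lt hkN
  have p1 : 0 ≤ (∏ i : {i : Fin N // i.val < k}, Real.Gamma (I i + 1 / 2)) /
      Real.Gamma ((k : ℝ) / 2 + (∑ i : {i : Fin N // i.val < k}, I i : ℕ)) :=
    div_nonneg (Finset.prod_nonneg fun i _ => (Real.Gamma_pos_of_pos (by positivity)).le)
      (Real.Gamma_pos_of_pos (by positivity)).le
  have p2 : 0 ≤ (∏ i : {i : Fin N // ¬ i.val < k}, Real.Gamma (I i + 1 / 2)) /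
      Real.Gamma (((N - k : ℕ) : ℝ) / 2 + (∑ i : {i : Fin N // ¬ i.val < k}, I i : ℕ)) :=
    div_nonneg (Finset.prod_nonneg fun i _ => (Real.Gamma_pos_of_pos (by positivity)).le)
      (Real.Gamma_pos_of_pos (by positivity)).le
  have e3 := mul_le_mul e1 e2 (by push_cast at p2 ⊢; exact p2) measureReal_nonneg
  have e4 : (∑ j : {j : Fin N // j.val < k}, I j) + ∑ j : {j : Fin N // ¬ j.val < k}, I j =
      ∑ j, I j := Fintype.sum_subtype_add_sum_subtype (fun i : Fin N => i.val < k) I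
  simp only [Function.comp_apply]
  rw [e4, ← Finset.mul_sum, pow_mul, Real.sq_sqrt hR₁, shellCoeff,
    ← Fintype.prod_subtype_mul_prod_subtype (fun i : Fin N => i.val < k), mul_div_mul_comm, abs_mul,
    abs_of_nonneg (mul_nonneg p1 p2), mul_comm |taylorCoeff _ _|, mul_assoc]
  push_cast at e3 ⊢
  gcongr

end Moments

/-! ### The density for 0 < k < N -/

section MixedIndex

variable {N : ℕ} {k : ℕ} {J : Conf N → ℝ} {r : ℝ}

/-- The integrand of the density of states at energy `w`. -/
noncomputable def levelIntegrand (k : ℕ) (J : Conf N → ℝ) (w s : ℝ) : ℝ :=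
  s ^ ((k : ℝ) / 2 - 1) * (s + w) ^ (((N - k : ℕ) : ℝ) / 2 - 1) * shellIntegral k J s (s + w)

theorem integrableOn_levelIntegrand (hk : 0 < k) (hkN : k < N) (hJ : Measurable J) (hr : 0 ≤ r)
    (hJc : ContinuousOn J (Metric.closedBall 0 r)) {w : ℝ} (hw : |w| < r ^ 2) (hw0 : w ≠ 0) :
    IntegrableOn (levelIntegrand k J w) (levelRange (r ^ 2) w) := by
  obtain ⟨C, hC⟩ := (isCompact_closedBall (0 : Conf N) r).exists_bound_of_continuousOn hJc
  have hk' : (0 : ℝ) < k := by exact_mod_cast hk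
  have hm' : (0 : ℝ) < (N - k : ℕ) := by exact_mod_cast Nat.sub_pos_of_lt hkN
  have hbase := integrableOn_levelRange hw hw0 (half_pos hk') (half_pos hm')
  refine Integrable.mono' (hbase.mul_const (1 / 4 * (C * (bipolarMeasure N k).real univ)))
    (Measurable.aestronglyMeasurable ?_) ?_
  · have : Measurable fun s : ℝ => shellIntegral k J s (s + w) :=
      (measurable_shellIntegral hJ).comp (measurable_id.prodMk (measurable_id.add_const w))
    unfold levelIntegrand
    fun_prop
  · filter_upwards [ae_restrict_mem measurableSet_levelRange] with s hs
    obtain ⟨h1, h2, h3⟩ := mem_levelRange_iff.1 hs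
    rw [levelIntegrand, norm_mul, Real.norm_of_nonneg (by positivity), shellIntegral, norm_mul,
      Real.norm_of_nonneg (by norm_num : (0 : ℝ) ≤ 1 / 4)]
    gcongr
    exact norm_integral_le_of_norm_le_const (Eventually.of_forall fun ω =>
      hC _ ((bipolarPoint_mem_closedBall_iff hr h1.le h2.le ω).2 h3))

theorem levelRange_eq_union {ρ₀ ρ w : ℝ} (hρ : ρ₀ ≤ ρ) (hw : |w| < ρ₀) :
    levelRange ρ w = levelRange ρ₀ w ∪ Ioc ((ρ₀ - w) / 2) ((ρ - w) / 2) :=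
  (Ioc_union_Ioc_eq_Ioc (max_lt_of_abs_lt hw).le (by linarith)).symm

/-- The level w is parametrized by τ = s + t, so that s = (τ - w)/2 and t = (τ + w)/2. As long as
both are positive, their roots and real powers are analytic in (τ, w). -/
theorem analyticAt_level_param {Y Z : Type*} [NormedAddCommGroup Y] [NormedSpace ℝ Y]
    [NormedAddCommGroup Z] [NormedSpace ℝ Z] {g : Y × Z → ℝ} {c a b τ w : ℝ} {y : Y} {z : Z}
    (hs : 0 < (τ - w) / 2) (ht : 0 < (τ + w) / 2)
    (hg : AnalyticAt ℝ g (√((τ - w) / 2) • y, √((τ + w) / 2) • z)) :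
    AnalyticAt ℝ (fun q : (ℝ × (Y × Z)) × ℝ => c * (((q.1.1 - q.2) / 2) ^ a *
      ((q.1.1 + q.2) / 2) ^ b * g (√((q.1.1 - q.2) / 2) • q.1.2.1, √((q.1.1 + q.2) / 2) • q.1.2.2)))
      ((τ, (y, z)), w) := by
  have a1 : AnalyticAt ℝ (fun q : (ℝ × (Y × Z)) × ℝ => (q.1.1 - q.2) / 2) ((τ, (y, z)), w) :=
    ContDiffAt.analyticAt (by fun_prop)
  have a2 : AnalyticAt ℝ (fun q : (ℝ × (Y × Z)) × ℝ => (q.1.1 + q.2) / 2) ((τ, (y, z)), w) :=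
    ContDiffAt.analyticAt (by fun_prop)
  have b1 : AnalyticAt ℝ (fun q : (ℝ × (Y × Z)) × ℝ => √((q.1.1 - q.2) / 2)) ((τ, (y, z)), w) :=
    (ContDiffAt.sqrt (n := ⊤) a1.contDiffAt hs.ne').analyticAt
  have b2 : AnalyticAt ℝ (fun q : (ℝ × (Y × Z)) × ℝ => √((q.1.1 + q.2) / 2)) ((τ, (y, z)), w) :=
    (ContDiffAt.sqrt (n := ⊤) a2.contDiffAt ht.ne').analyticAt
  have c₁ : AnalyticAt ℝ (fun q : (ℝ × (Y × Z)) × ℝ => (√((q.1.1 - q.2) / 2) • q.1.2.1,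
      √((q.1.1 + q.2) / 2) • q.1.2.2)) ((τ, (y, z)), w) :=
    (b1.fun_smul (ContDiffAt.analyticAt (by fun_prop))).prod
      (b2.fun_smul (ContDiffAt.analyticAt (by fun_prop)))
  exact analyticAt_const.fun_mul (((a1.rpow_const_of_ne hs.ne' _).fun_mul
    (a2.rpow_const_of_ne ht.ne' _)).fun_mul (AnalyticAt.fun_comp (g := g) hg c₁))

/-- The part of the density of states away from the critical point is analytic. -/
theorem analyticOnNhd_outer {ρ₀ : ℝ} (hρ : ρ₀ ≤ r ^ 2) (hr : 0 ≤ r)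
    (hJa : AnalyticOnNhd ℝ J (Metric.closedBall 0 r)) :
    AnalyticOnNhd ℝ (fun w => ∫ s in Ioc ((ρ₀ - w) / 2) ((r ^ 2 - w) / 2), levelIntegrand k J w s)
      (Metric.ball 0 ρ₀) := by
  intro w₀ hw₀
  have hw₀' : |w₀| < ρ₀ := by simpa using hw₀
  let E := ℝ × (EuclideanSpace ℝ {i : Fin N // i.val < k} × EuclideanSpace ℝ {i : Fin N // ¬ i.val < k})
  -- In the variable s the range of integration moves with w; in τ = s + t it is fixed. The constant
  -- is the 1/4 of `shellIntegral` times ds/dτ = 1/2.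
  let F : E × ℝ → ℝ := fun q => 1 / 8 * (((q.1.1 - q.2) / 2) ^ ((k : ℝ) / 2 - 1) *
    ((q.1.1 + q.2) / 2) ^ (((N - k : ℕ) : ℝ) / 2 - 1) *
      J (glue (fun i : Fin N => i.val < k) (√((q.1.1 - q.2) / 2) • q.1.2.1,
        √((q.1.1 + q.2) / 2) • q.1.2.2)))
  let e : ℝ × (NegSphere N k × PosSphere N k) → E := fun x => (x.1, (x.2.1.1, x.2.2.1))
  let K : Set (ℝ × (NegSphere N k × PosSphere N k)) := Icc ρ₀ (r ^ 2) ×ˢ univ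
  have he : Continuous e := by fun_prop
  have hFe : ∀ x w, F (e x, w) = 1 / 8 * (((x.1 - w) / 2) ^ ((k : ℝ) / 2 - 1) *
      ((x.1 + w) / 2) ^ (((N - k : ℕ) : ℝ) / 2 - 1) *
        J (bipolarPoint ((x.1 - w) / 2) ((x.1 + w) / 2) x.2)) := fun x w => rfl
  have hF : ∀ w ∈ Metric.ball 0 ρ₀, ∀ x ∈ K, AnalyticAt ℝ F (e x, w) := by
    intro w hw x hx
    have hw' : |w| < ρ₀ := by simpa using hw
    have hbw := abs_lt.1 hw'
    have hs : 0 < (x.1 - w) / 2 := by linarith [hx.1.1]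
    have ht : 0 < (x.1 + w) / 2 := by linarith [hx.1.1]
    have hmem : bipolarPoint ((x.1 - w) / 2) ((x.1 + w) / 2) x.2 ∈ Metric.closedBall (0 : Conf N) r :=
      (bipolarPoint_mem_closedBall_iff hr hs.le ht.le _).2 (by linarith [hx.1.2])
    exact analyticAt_level_param hs ht (g := fun p => J (glue (fun i : Fin N => i.val < k) p))
      (AnalyticAt.fun_comp (g := J) (hJa _ hmem) (ContinuousLinearMap.analyticAt _ _))
  have hK : IsCompact K := isCompact_Icc.prod isCompact_univ
  have hKm : MeasurableSet K := measurableSet_Icc.prod .univ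
  have hmain := analyticAt_setIntegral_of_isCompact (μ := volume.prod (bipolarMeasure N k))
    hK hKm he (hF w₀ hw₀)
  refine hmain.congr ?_
  filter_upwards [Metric.isOpen_ball.mem_nhds hw₀] with w hw
  have hInt : IntegrableOn (fun x => F (e x, w)) K (volume.prod (bipolarMeasure N k)) :=
    ContinuousOn.integrableOn_compact hK fun x hx =>
      ((hF w hw x hx).continuousAt.comp (f := fun x => (e x, w)) (by fun_prop)).continuousWithinAt
  rw [setIntegral_prod _ hInt, integral_Icc_eq_integral_Ioc,
    ← intervalIntegral.integral_of_le hρ, ← intervalIntegral.integral_of_le (by linarith)]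
  have h1 := intervalIntegral.integral_comp_div_sub (a := ρ₀) (b := r ^ 2)
    (fun s => levelIntegrand k J w s) (two_ne_zero (α := ℝ)) (w / 2)
  simp only [← sub_div] at h1
  have h2 : ∀ x : ℝ, ∫ ω in univ, F (e (x, ω), w) ∂bipolarMeasure N k =
      1 / 2 * levelIntegrand k J w ((x - w) / 2) := by
    intro x
    simp only [Measure.restrict_univ, hFe, integral_const_mul, levelIntegrand, shellIntegral]
    have : (x - w) / 2 + w = (x + w) / 2 := by ring
    rw [this]; ring
  simp only [h2]
  rw [intervalIntegral.integral_const_mul, h1, smul_eq_mul]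
  ring

/-- For s + t ≤ ρ₀ the Taylor series of J is available and yields the singular part; the shell ρ₀ <
s + t ≤ r² avoids the critical point and adds an analytic function only. -/
theorem exists_integral_level_decomposition (hk : 0 < k) (hkN : k < N) (hJ : Measurable J)
    (hr : 0 < r) (hJa : AnalyticOnNhd ℝ J (Metric.closedBall 0 r)) :
    ∃ ε > 0, ε ≤ r ^ 2 ∧ ∃ F : ℝ → ℝ, AnalyticOnNhd ℝ F (Metric.ball 0 ε) ∧
      ∀ w, |w| < ε → w ≠ 0 → ∫ s in levelRange (r ^ 2) w, levelIntegrand k J w s =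
        F w + hNonanalytic N (k % 4) w * energyFactor N k J w := by
  obtain ⟨R, hR, h⟩ := (hJa 0 (by simpa using hr.le)).exists_hasSum_taylorCoeff
  have hr2 : 0 < r ^ 2 := by positivity
  have hR2 : 0 < R ^ 2 := by positivity
  set R₁ := R ^ 2 / 2 with hR₁
  have hR₁0 : 0 < R₁ := by positivity
  have hRR : R₁ < R ^ 2 := by linarith
  set ρ₀ := min R₁ (r ^ 2) with hρ₀
  have hρ₀0 : 0 < ρ₀ := lt_min hR₁0 hr2
  obtain ⟨E, hE, hdec⟩ := exists_series_integral_decomposition hk (Nat.sub_pos_of_lt hkN) hρ₀0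
    (min_le_left _ _) (summable_shellCoeff hk hkN (fun x hx => (h x hx).summable) hR₁0.le hR hRR)
    (M := shellIntegral k J) (fun s t hs ht hs' ht' =>
      hasSum_shellIntegral hk hkN h hR hRR hs.le ht.le hs' ht')
  refine ⟨ρ₀, hρ₀0, min_le_right _ _, fun w => E w +
    ∫ s in Ioc ((ρ₀ - w) / 2) ((r ^ 2 - w) / 2), levelIntegrand k J w s,
    fun w hw => (hE w hw).fun_add (analyticOnNhd_outer (min_le_right _ _) hr.le hJa w hw),
    fun w hw hw0 => ?_⟩
  have hInt := integrableOn_levelIntegrand hk hkN hJ hr.le hJa.continuousOn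
    (hw.trans_le (min_le_right _ _)) hw0
  have hdisj : Disjoint (levelRange ρ₀ w) (Ioc ((ρ₀ - w) / 2) ((r ^ 2 - w) / 2)) :=
    Ioc_disjoint_Ioc_of_le le_rfl
  rw [levelRange_eq_union (min_le_right R₁ (r ^ 2) : ρ₀ ≤ r ^ 2) hw] at hInt ⊢
  rw [setIntegral_union hdisj measurableSet_Ioc hInt.left_of_union hInt.right_of_union]
  have h1 := hdec w hw hw0
  -- The Gamma denominators of the two sphere moments cancel against the numerators from the Beta
  -- integral, leaving the coefficient for the full dimension N.
  have h2 : ∀ I : Fin N → ℕ, (-1) ^ (∑ j : {j : Fin N // j.val < k}, I j) * shellCoeff k J I *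
      (Real.Gamma (k / 2 + (∑ j : {j : Fin N // j.val < k}, I j : ℕ)) *
        Real.Gamma ((N - k : ℕ) / 2 + (∑ j : {j : Fin N // ¬ j.val < k}, I j : ℕ)) /
          Real.Gamma ((k + (N - k) : ℕ) / 2 + ((∑ j : {j : Fin N // j.val < k}, I j) +
            ∑ j : {j : Fin N // ¬ j.val < k}, I j : ℕ))) *
      w ^ ((∑ j : {j : Fin N // j.val < k}, I j) + ∑ j : {j : Fin N // ¬ j.val < k}, I j) =
      factorCoeff N k J I * w ^ (∑ j, I j) := by
    intro I
    have hk' : (0 : ℝ) < k := by exact_mod_cast hk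
    have hm' : (0 : ℝ) < (N - k : ℕ) := by exact_mod_cast Nat.sub_pos_of_lt hkN
    have e4 : (∑ j : {j : Fin N // j.val < k}, I j) + ∑ j : {j : Fin N // ¬ j.val < k}, I j =
        ∑ j, I j := Fintype.sum_subtype_add_sum_subtype (fun i : Fin N => i.val < k) I
    have e5 : ∑ j : Fin N with j.val < k, I j = ∑ j : {j : Fin N // j.val < k}, I j :=
      Finset.sum_subtype _ (by simp) _
    have g1 := (Real.Gamma_pos_of_pos
      (by positivity : 0 < (k : ℝ) / 2 + (∑ j : {j : Fin N // j.val < k}, I j : ℕ))).ne'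
    have g2 := (Real.Gamma_pos_of_pos (by positivity : 0 < ((N - k : ℕ) : ℝ) / 2 +
      (∑ j : {j : Fin N // ¬ j.val < k}, I j : ℕ))).ne'
    rw [e4, Nat.add_sub_cancel' hkN.le, shellCoeff, factorCoeff, e5]
    generalize Real.Gamma ((k : ℝ) / 2 + (∑ j : {j : Fin N // j.val < k}, I j : ℕ)) = x at g1 ⊢
    generalize Real.Gamma (((N - k : ℕ) : ℝ) / 2 +
      (∑ j : {j : Fin N // ¬ j.val < k}, I j : ℕ)) = y at g2 ⊢
    generalize ∏ j, Real.Gamma ((I j : ℝ) + 1 / 2) = z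
    field_simp
  simp only [h2] at h1
  rw [Nat.add_sub_cancel' hkN.le] at h1
  simp only [levelIntegrand] at h1 ⊢
  rw [h1, energyFactor]
  ring

end MixedIndex

/-! ### The energy density of a weighted ball for every index -/

section EnergyDensity

variable {N : ℕ} {k : ℕ} {J : Conf N → ℝ} {r : ℝ}

theorem energyFactor_self_eq (w : ℝ) : energyFactor N N J w = energyFactor N 0 J (-w) := by
  refine tsum_congr fun I => ?_
  simp only [factorCoeff, Fin.is_lt, Finset.filter_true, not_lt_zero, Finset.filter_false,
    Finset.sum_empty, pow_zero, neg_pow w]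
  ring

theorem morseForm_zero_eq (x : Conf N) : morseForm 0 x = ‖x‖ ^ 2 := by
  rw [morseForm_eq_sum, EuclideanSpace.norm_sq_eq]
  simp

theorem morseForm_self_eq (x : Conf N) : morseForm N x = -‖x‖ ^ 2 := by
  rw [morseForm_eq_sum, EuclideanSpace.norm_sq_eq]
  simp

theorem energyFactor_zero_eq_integral (hN : 0 < N) {R : ℝ} (hR : 0 < R)
    (h : ∀ x ∈ polydisc N R, HasSum (fun I => taylorCoeff J I * monom x I) (J x)) {s : ℝ}
    (hs : 0 ≤ s) (hsR : s < R ^ 2) : energyFactor N 0 J s =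
      1 / 2 * ∫ ω : USphere (Fin N), J (√s • (ω : Conf N)) ∂surfaceMeasure (Fin N) :=
  (hasSum_sphere_integral hN h hR hs hsR).tsum_eq

/-- The weighted volume of a set of spherical shells. -/
theorem lintegral_closedBall_radial (hN : 0 < N) (hJ : Measurable J) (hJ0 : ∀ x, 0 ≤ J x)
    (hr : 0 ≤ r) (hJc : ContinuousOn J (Metric.closedBall 0 r)) {R : ℝ} (hR : 0 < R)
    (h : ∀ x ∈ polydisc N R, HasSum (fun I => taylorCoeff J I * monom x I) (J x)) {ε : ℝ}
    (hεr : ε ≤ r ^ 2) (hεR : ε ≤ R ^ 2) {A : Set ℝ} (hA : MeasurableSet A) (hAε : A ⊆ Iio ε) :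
    ∫⁻ x in Metric.closedBall 0 r ∩ (fun x : Conf N => ‖x‖ ^ 2) ⁻¹' A, ENNReal.ofReal (J x) =
      ∫⁻ s in A ∩ Ioi 0, ENNReal.ofReal (s ^ ((N : ℝ) / 2 - 1) * energyFactor N 0 J s) := by
  have : Nonempty (Fin N) := ⟨⟨0, hN⟩⟩
  have hset : MeasurableSet (Metric.closedBall (0 : Conf N) r ∩ (fun x : Conf N => ‖x‖ ^ 2) ⁻¹' A) :=
    measurableSet_closedBall.inter ((by fun_prop : Measurable fun x : Conf N => ‖x‖ ^ 2) hA)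
  rw [← lintegral_indicator hset, lintegral_polar_swap (hJ.ennreal_ofReal.indicator hset),
    ← Measure.restrict_restrict hA, ← lintegral_indicator hA, Fintype.card_fin]
  refine setLIntegral_congr_fun measurableSet_Ioi fun s hs => ?_
  have hs0 : 0 < s := hs
  have hnorm : ∀ ω : USphere (Fin N), ‖√s • (ω : Conf N)‖ ^ 2 = s := fun ω => by
    have : ‖(ω : Conf N)‖ = 1 := by simp
    rw [norm_smul, this, mul_one, Real.norm_eq_abs, sq_abs, Real.sq_sqrt hs0.le]
  by_cases hsA : s ∈ A
  · have hsε : s < ε := hAε hsA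
    have hball : ∀ ω : USphere (Fin N), √s • (ω : Conf N) ∈ Metric.closedBall (0 : Conf N) r :=
      fun ω => by
        rw [mem_closedBall_zero_iff, ← pow_le_pow_iff_left₀ (norm_nonneg _) hr two_ne_zero, hnorm]
        exact hsε.le.trans hεr
    have hmem : ∀ ω : USphere (Fin N), √s • (ω : Conf N) ∈
        Metric.closedBall (0 : Conf N) r ∩ (fun x : Conf N => ‖x‖ ^ 2) ⁻¹' A := fun ω =>
      ⟨hball ω, by rw [mem_preimage, hnorm]; exact hsA⟩
    simp only [indicator_of_mem (hmem _), indicator_of_mem hsA]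
    obtain ⟨C, hC⟩ := (isCompact_closedBall (0 : Conf N) r).exists_bound_of_continuousOn hJc
    have hInt : Integrable (fun ω : USphere (Fin N) => J (√s • (ω : Conf N)))
        (surfaceMeasure (Fin N)) :=
      Integrable.of_bound (C := C) (hJ.comp (by fun_prop)).aestronglyMeasurable
        (Eventually.of_forall fun ω => hC _ (hball ω))
    rw [← ofReal_integral_eq_lintegral_ofReal hInt (Eventually.of_forall fun ω => hJ0 _),
      ← ENNReal.ofReal_mul (by positivity),
      energyFactor_zero_eq_integral hN hR h hs0.le (hsε.trans_le hεR)]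
    congr 1
    ring
  · have hmem : ∀ ω : USphere (Fin N), √s • (ω : Conf N) ∉
        Metric.closedBall (0 : Conf N) r ∩ (fun x : Conf N => ‖x‖ ^ 2) ⁻¹' A := fun ω hω => by
      have := hω.2
      rw [mem_preimage, hnorm] at this
      exact hsA this
    simp only [indicator_of_notMem (hmem _), indicator_of_notMem hsA, lintegral_zero, mul_zero]

theorem hNonanalytic_zero_index {w : ℝ} (hw : w ≠ 0) :
    hNonanalytic N 0 w = (Ioi (0 : ℝ)).indicator (fun s => s ^ ((N : ℝ) / 2 - 1)) w := by
  have e : ((N : ℝ) - 2) / 2 = N / 2 - 1 := by ring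
  rcases lt_or_gt_of_ne hw with h | h
  · rw [indicator_of_notMem (by simpa using h.le)]
    simp [hNonanalytic, heaviside, not_le.2 h]
  · rw [indicator_of_mem (by simpa using h)]
    simp [hNonanalytic, heaviside, h.le, e]

/-- At a maximum the density lives on w < 0, whereas for even N the singular function is supported
on w ≥ 0. The two differ by the polynomial (-w)^(N/2-1), which joins the analytic part; for odd N
they agree. -/
theorem exists_hNonanalytic_full_index (hN : 0 < N) : ∃ P : ℝ → ℝ, (∀ w, AnalyticAt ℝ P w) ∧
    ∀ w, w ≠ 0 → P w + hNonanalytic N (N % 4) w =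
      (Iio (0 : ℝ)).indicator (fun s => (-s) ^ ((N : ℝ) / 2 - 1)) w := by
  rcases Nat.even_or_odd' N with ⟨n, rfl | rfl⟩
  · obtain ⟨n, rfl⟩ : ∃ n', n = n' + 1 := ⟨n - 1, by omega⟩
    refine ⟨fun w => (-w) ^ n, fun w => by fun_prop, fun w hw => ?_⟩
    have e1 : (2 * (n + 1)) % 4 = 2 * ((n + 1) % 2) := by omega
    have e2 : (((2 * (n + 1) : ℕ) : ℝ) - 2) / 2 = (n : ℝ) := by push_cast; ring
    have e3 : ((2 * (n + 1) : ℕ) : ℝ) / 2 - 1 = (n : ℝ) := by push_cast; ring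
    rw [hNonanalytic, e1, if_pos (even_two_mul _), e2, e3, Nat.mul_div_cancel_left _ two_pos,
      neg_one_pow_mod_two, Real.rpow_natCast]
    simp only [Real.rpow_natCast]
    rcases lt_or_gt_of_ne hw with h | h
    · rw [indicator_of_mem (by simpa using h), heaviside, if_neg (not_le.2 h)]
      ring
    · rw [indicator_of_notMem (by simpa using h.le), heaviside, if_pos h.le, neg_pow w]
      ring
  · refine ⟨fun _ => 0, fun w => analyticAt_const, fun w hw => ?_⟩
    have e4 : (((2 * n + 1 : ℕ) : ℤ) - (((2 * n + 1) % 4 : ℕ) : ℤ)) / 2 = ((2 * (n / 2) : ℕ) : ℤ) := by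
      omega
    have e5 : ¬ Even (2 * n + 1) := by simp
    have e6 : ¬ Even ((2 * n + 1) % 4) := by
      rw [Nat.not_even_iff_odd]; exact ⟨n % 2, by omega⟩
    have e7 : (((2 * n + 1 : ℕ) : ℝ) - 2) / 2 = ((2 * n + 1 : ℕ) : ℝ) / 2 - 1 := by ring
    rw [hNonanalytic, if_neg e6, if_neg e5, e4, zpow_natCast, pow_mul, e7, zero_add]
    rcases lt_or_gt_of_ne hw with h | h
    · rw [indicator_of_mem (by simpa using h), heaviside, if_pos (by linarith)]
      norm_num
    · rw [indicator_of_notMem (by simpa using h.le), heaviside, if_neg (by linarith)]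
      ring

theorem setLIntegral_eq_of_eq_indicator {A S : Set ℝ} (hA : MeasurableSet A) (hS : MeasurableSet S)
    {D g : ℝ → ℝ} (h : ∀ w ∈ A, w ≠ 0 → D w = S.indicator g w) :
    ∫⁻ w in A, ENNReal.ofReal (D w) = ∫⁻ w in A ∩ S, ENNReal.ofReal (g w) := by
  rw [inter_comm, ← Measure.restrict_restrict hS, ← lintegral_indicator hS]
  refine lintegral_congr_ae ?_
  filter_upwards [ae_restrict_mem hA, ae_restrict_of_ae (Measure.ae_ne volume (0 : ℝ))] with w hw hw0
  rw [h w hw hw0]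
  by_cases hwS : w ∈ S
  · rw [indicator_of_mem hwS, indicator_of_mem hwS]
  · rw [indicator_of_notMem hwS, indicator_of_notMem hwS, ENNReal.ofReal_zero]

/-- The density, with respect to the energy, of the weighted volume of a ball. -/
theorem exists_energy_density (hN : 0 < N) (hkN : k ≤ N) (hJ : Measurable J) (hJ0 : ∀ x, 0 ≤ J x)
    (hr : 0 < r) (hJa : AnalyticOnNhd ℝ J (Metric.closedBall 0 r)) :
    ∃ ε > 0, ∃ F : ℝ → ℝ, AnalyticOnNhd ℝ F (Metric.ball 0 ε) ∧
      AnalyticOnNhd ℝ (energyFactor N k J) (Metric.ball 0 ε) ∧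
      (∀ w, |w| < ε → w ≠ 0 → 0 ≤ F w + hNonanalytic N (k % 4) w * energyFactor N k J w) ∧
      ∀ A ⊆ Metric.ball 0 ε, MeasurableSet A →
        ∫⁻ x in Metric.closedBall 0 r ∩ morseForm k ⁻¹' A, ENNReal.ofReal (J x) =
          ∫⁻ w in A, ENNReal.ofReal (F w + hNonanalytic N (k % 4) w * energyFactor N k J w) := by
  obtain ⟨R, hR, h⟩ := (hJa 0 (by simpa using hr.le)).exists_hasSum_taylorCoeff
  have hr2 : 0 < r ^ 2 := by positivity
  have hR2 : 0 < R ^ 2 := by positivity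
  have hfac : ∀ k, AnalyticOnNhd ℝ (energyFactor N k J) (Metric.ball 0 (R ^ 2)) := fun k =>
    analyticOnNhd_energyFactor hN k hR fun x hx => (h x hx).summable
  have hfac0 : ∀ s, 0 ≤ s → s < R ^ 2 → 0 ≤ energyFactor N 0 J s := fun s hs hsR => by
    rw [energyFactor_zero_eq_integral hN hR h hs hsR]
    exact mul_nonneg (by norm_num) (integral_nonneg fun _ => hJ0 _)
  have hmin : 0 < min (r ^ 2) (R ^ 2) := lt_min hr2 hR2
  -- At a minimum or a maximum one coordinate block is empty and bipolar coordinates degenerate;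
  -- ordinary polar coordinates give the density directly.
  rcases Nat.eq_zero_or_pos k with rfl | hk
  · have hD : ∀ w, w ≠ 0 → 0 + hNonanalytic N (0 % 4) w * energyFactor N 0 J w =
        (Ioi (0 : ℝ)).indicator (fun s => s ^ ((N : ℝ) / 2 - 1) * energyFactor N 0 J s) w := by
      intro w hw0
      rw [zero_add, Nat.zero_mod, hNonanalytic_zero_index hw0]
      simp only [indicator]
      split_ifs <;> simp
    refine ⟨min (r ^ 2) (R ^ 2), hmin, fun _ => 0, fun _ _ => analyticAt_const,
      (hfac 0).mono (Metric.ball_subset_ball (min_le_right _ _)), fun w hw hw0 => ?_,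
      fun A hA hAm => ?_⟩
    · rw [hD w hw0]
      by_cases hw' : 0 < w
      · rw [indicator_of_mem (by simpa using hw')]
        have : w < R ^ 2 := (le_abs_self w).trans_lt (hw.trans_le (min_le_right _ _))
        exact mul_nonneg (Real.rpow_nonneg hw'.le _) (hfac0 _ hw'.le this)
      · rw [indicator_of_notMem (by simpa using hw')]
    · rw [setLIntegral_eq_of_eq_indicator hAm measurableSet_Ioi fun w _ hw0 => hD w hw0,
        ← lintegral_closedBall_radial hN hJ hJ0 hr.le hJa.continuousOn hR h (min_le_left _ _)
          (min_le_right _ _) hAm fun w hw => (abs_lt.1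
            (by rw [← Real.norm_eq_abs]; exact mem_ball_zero_iff.1 (hA hw))).2]
      rw [show (morseForm 0 : Conf N → ℝ) = fun x => ‖x‖ ^ 2 from funext morseForm_zero_eq]
  rcases hkN.eq_or_lt with rfl | hkN
  · obtain ⟨P, hP, hPe⟩ := exists_hNonanalytic_full_index hN
    have hD : ∀ w, w ≠ 0 → P w * energyFactor k k J w +
        hNonanalytic k (k % 4) w * energyFactor k k J w =
        (Iio (0 : ℝ)).indicator (fun s => (-s) ^ ((k : ℝ) / 2 - 1) * energyFactor k 0 J (-s)) w := by
      intro w hw0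
      rw [← add_mul, hPe w hw0, energyFactor_self_eq]
      simp only [indicator]
      split_ifs <;> simp
    refine ⟨min (r ^ 2) (R ^ 2), hmin, fun w => P w * energyFactor k k J w, fun w hw =>
      (hP w).fun_mul (hfac k w (Metric.ball_subset_ball (min_le_right _ _) hw)),
      (hfac k).mono (Metric.ball_subset_ball (min_le_right _ _)), fun w hw hw0 => ?_,
      fun A hA hAm => ?_⟩
    · rw [hD w hw0]
      by_cases hw' : w < 0
      · rw [indicator_of_mem (by simpa using hw')]
        have : -w < R ^ 2 := (neg_le_abs w).trans_lt (hw.trans_le (min_le_right _ _))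
        exact mul_nonneg (Real.rpow_nonneg (by linarith) _) (hfac0 _ (by linarith) this)
      · rw [indicator_of_notMem (by simpa using hw')]
    · rw [setLIntegral_eq_of_eq_indicator hAm measurableSet_Iio fun w _ hw0 => hD w hw0]
      have h1 := lintegral_closedBall_radial hN hJ hJ0 hr.le hJa.continuousOn hR h (min_le_left _ _)
        (min_le_right _ _) (A := Neg.neg ⁻¹' A) (hAm.preimage measurable_neg) fun w hw => by
          have := (abs_lt.1 (show |-w| < min (r ^ 2) (R ^ 2) from mem_ball_zero_iff.1 (hA hw))).1
          exact neg_lt_neg_iff.1 this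
      have h2 : morseForm k ⁻¹' A = (fun x : Conf k => ‖x‖ ^ 2) ⁻¹' (Neg.neg ⁻¹' A) := by
        ext x
        simp only [mem_preimage, morseForm_self_eq]
      rw [h2, h1, ← (Measure.measurePreserving_neg (volume : Measure ℝ)).setLIntegral_comp_preimage_emb
        (MeasurableEquiv.neg ℝ).measurableEmbedding]
      have h3 : Neg.neg ⁻¹' (Neg.neg ⁻¹' A ∩ Ioi (0 : ℝ)) = A ∩ Iio 0 := by ext w; simp
      rw [h3]
  · obtain ⟨ε, hε, hεr, F, hF, hdec⟩ := exists_integral_level_decomposition hk hkN hJ hr hJa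
    have hnn : ∀ w, ∀ s ∈ levelRange (r ^ 2) w, 0 ≤ levelIntegrand k J w s := fun w s hs => by
      obtain ⟨h1, h2⟩ := levelRange_pos hs
      have := shellIntegral_nonneg (k := k) hJ0 s (s + w)
      unfold levelIntegrand
      positivity
    refine ⟨min ε (R ^ 2), lt_min hε hR2, F, hF.mono (Metric.ball_subset_ball (min_le_left _ _)),
      (hfac k).mono (Metric.ball_subset_ball (min_le_right _ _)), fun w hw hw0 => ?_,
      fun A hA hAm => ?_⟩
    · rw [← hdec w (hw.trans_le (min_le_left _ _)) hw0]
      exact setIntegral_nonneg measurableSet_levelRange (hnn w)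
    · rw [lintegral_closedBall_eq_level hk hkN hJ hJ0 hr.le hJa.continuousOn hAm]
      refine lintegral_congr_ae ?_
      filter_upwards [ae_restrict_mem hAm, ae_restrict_of_ae (Measure.ae_ne volume (0 : ℝ))]
        with w hw hw0
      have hwε : |w| < ε := (show |w| < min ε (R ^ 2) from mem_ball_zero_iff.1 (hA hw)).trans_le (min_le_left _ _)
      rw [← hdec w hwε hw0, ofReal_integral_eq_lintegral_ofReal
        (integrableOn_levelIntegrand hk hkN hJ hr.le hJa.continuousOn (hwε.trans_le hεr) hw0)
        ((ae_restrict_iff' measurableSet_levelRange).2 (Eventually.of_forall (hnn w)))]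
      rfl

end EnergyDensity

/-! ### Jacobian determinants and volumes in a chart -/

section ChartJacobian

variable {N : ℕ} {k : ℕ} {V : Conf N → ℝ} {G : Set (Conf N)} {qc : Conf N}
  {q : OpenPartialHomeomorph (Conf N) (Conf N)}

theorem measurable_jacobianDet (q : Conf N → Conf N) : Measurable (jacobianDet q) := by
  have h := ContinuousLinearMap.continuous_det (𝕜 := ℝ) (E := Conf N) |>.measurable.comp
    (measurable_fderiv ℝ q)
  exact continuous_abs.measurable.comp h

/-- By the Leibniz formula the determinant is a polynomial in the matrix entries, which are
analytic. -/
theorem AnalyticAt.det_fderiv {f : Conf N → Conf N} {x : Conf N} (hf : AnalyticAt ℝ f x) :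
    AnalyticAt ℝ (fun y => (fderiv ℝ f y).det) x := by
  have h : ∀ A : Conf N →L[ℝ] Conf N, A.det = ∑ σ : Equiv.Perm (Fin N),
      ((Equiv.Perm.sign σ : ℤ) : ℝ) * ∏ i, A (EuclideanSpace.single i 1) (σ i) := fun A => by
    rw [ContinuousLinearMap.det, ← LinearMap.det_toMatrix (EuclideanSpace.basisFun (Fin N) ℝ).toBasis,
      Matrix.det_apply']
    simp [LinearMap.toMatrix_apply]
  simp only [h]
  have hentry : ∀ i j : Fin N,
      AnalyticAt ℝ (fun y => fderiv ℝ f y (EuclideanSpace.single i 1) j) x := fun i j => by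
    have h1 := (ContDiffAt.clm_apply (n := ⊤) hf.fderiv.contDiffAt
      (contDiffAt_const (c := EuclideanSpace.single i (1 : ℝ)))).analyticAt
    exact ((EuclideanSpace.proj j : Conf N →L[ℝ] ℝ).analyticAt _).fun_comp h1
  refine Finset.analyticAt_fun_sum _ fun σ _ => analyticAt_const.fun_mul ?_
  exact Finset.analyticAt_fun_prod _ fun i _ => hentry i (σ i)

theorem IsMorseChart.det_fderiv_ne_zero (hq : IsMorseChart V G qc k q) {x : Conf N}
    (hx : x ∈ q.source) : (fderiv ℝ q x).det ≠ 0 := by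
  have h1 := (hq.analytic x hx).differentiableAt.hasFDerivAt
  have h2 := (hq.analytic_symm (q x) (q.map_source hx)).differentiableAt.hasFDerivAt
  have h3 := h2.comp x h1
  have h4 : HasFDerivAt (q.symm ∘ q) (ContinuousLinearMap.id ℝ (Conf N)) x := by
    refine (hasFDerivAt_id x).congr_of_eventuallyEq ?_
    filter_upwards [q.open_source.mem_nhds hx] with y hy
    exact q.left_inv hy
  have h5 : LinearMap.det ((fderiv ℝ q.symm (q x) : Conf N →ₗ[ℝ] Conf N) ∘ₗ
      (fderiv ℝ q x : Conf N →ₗ[ℝ] Conf N)) = LinearMap.det LinearMap.id :=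
    congrArg ContinuousLinearMap.det (h3.unique h4)
  intro h0
  rw [ContinuousLinearMap.det] at h0
  rw [LinearMap.det_comp, h0, mul_zero, LinearMap.det_id] at h5
  exact zero_ne_one h5

/-- The absolute value is harmless: |det| = √(det²), and the determinant of a chart never vanishes.
-/
theorem IsMorseChart.analyticOnNhd_jacobianDet (hq : IsMorseChart V G qc k q) :
    AnalyticOnNhd ℝ (jacobianDet q) q.source := by
  intro x hx
  have h1 := (hq.analytic x hx).det_fderiv
  have h2 := (ContDiffAt.sqrt (n := ⊤) (h1.fun_pow 2).contDiffAt
    (pow_ne_zero 2 (hq.det_fderiv_ne_zero hx))).analyticAt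
  refine h2.congr (Eventually.of_forall fun y => ?_)
  simp only [jacobianDet, Real.sqrt_sq_eq_abs]

/-- The volume of a set of levels inside the chart. -/
theorem IsMorseChart.volume_level (hq : IsMorseChart V G qc k q) {r : ℝ}
    (hr : Metric.closedBall 0 r ⊆ q.source) {A : Set ℝ} (hA : MeasurableSet A) :
    MeasurableSet (q '' (Metric.closedBall 0 r ∩ morseForm k ⁻¹' A)) ∧
    volume (q '' (Metric.closedBall 0 r ∩ morseForm k ⁻¹' A)) =
      ∫⁻ x in Metric.closedBall 0 r ∩ morseForm k ⁻¹' A, ENNReal.ofReal (jacobianDet q x) := by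
  have hset : MeasurableSet (Metric.closedBall (0 : Conf N) r ∩ morseForm k ⁻¹' A) :=
    measurableSet_closedBall.inter ((continuous_morseForm k).measurable hA)
  have hsub : Metric.closedBall (0 : Conf N) r ∩ morseForm k ⁻¹' A ⊆ q.source :=
    inter_subset_left.trans hr
  have hinj := q.injOn.mono hsub
  exact ⟨hset.image_of_continuousOn_injOn (q.continuousOn.mono hsub) hinj,
    (lintegral_abs_det_fderiv_eq_addHaar_image volume hset (fun x hx =>
      (hq.analytic x (hsub hx)).differentiableAt.hasFDerivAt.hasFDerivWithinAt) hinj).symm⟩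

theorem IsMorseChart.sep_image_eq (hq : IsMorseChart V G qc k q) (hN : 0 < N) {r : ℝ}
    (hr : Metric.closedBall 0 r ⊆ q.source) (A : Set ℝ) :
    {p ∈ q '' Metric.closedBall 0 r | V p / N ∈ A} =
      q '' (Metric.closedBall 0 r ∩ morseForm k ⁻¹' ((fun v : ℝ => N * v) '' A)) := by
  have hN' : (N : ℝ) ≠ 0 := by exact_mod_cast hN.ne'
  ext p
  constructor
  · rintro ⟨⟨x, hx, rfl⟩, hA⟩
    refine ⟨x, ⟨hx, V (q x) / N, hA, ?_⟩, rfl⟩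
    simp only
    rw [mul_div_cancel₀ _ hN']
    exact hq.normal_form x (hr hx)
  · rintro ⟨x, ⟨hx, v, hv, hvx⟩, rfl⟩
    refine ⟨⟨x, hx, rfl⟩, ?_⟩
    have h1 : V (q x) = morseForm k x := hq.normal_form x (hr hx)
    simp only at hvx
    rw [h1, ← hvx, mul_div_cancel_left₀ _ hN']
    exact hv

end ChartJacobian

/-! ### Rescaling the energy and densities of states -/

section DensityOfStates

variable {N : ℕ} {V : Conf N → ℝ}

theorem measurable_heaviside : Measurable heaviside :=
  Measurable.ite measurableSet_Ici measurable_const measurable_const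

theorem measurable_hNonanalytic (N κ : ℕ) : Measurable (hNonanalytic N κ) := by
  unfold hNonanalytic
  have := measurable_heaviside
  split_ifs
  · exact Measurable.mul (by fun_prop) measurable_heaviside
  · exact Measurable.mul (by fun_prop) ((Real.measurable_log.comp continuous_abs.measurable).div_const _)
  · exact Measurable.mul (by fun_prop) (measurable_heaviside.comp measurable_neg)

/-- The behaviour of the nonanalytic factor under rescaling. -/
theorem exists_hNonanalytic_mul (hN : 0 < N) (κ : ℕ) : ∃ P : ℝ → ℝ, (∀ v, AnalyticAt ℝ P v) ∧
    ∀ v, v ≠ 0 → hNonanalytic N κ (N * v) =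
      (N : ℝ) ^ ((N : ℝ) / 2 - 1) * (hNonanalytic N κ v + P v) := by
  have hN' : (0 : ℝ) < N := by exact_mod_cast hN
  have e : ((N : ℝ) - 2) / 2 = N / 2 - 1 := by ring
  have hh : ∀ v, heaviside (N * v) = heaviside v := fun v => by
    simp only [heaviside, mul_nonneg_iff_of_pos_left hN']
  have hpow : ∀ v, ((N : ℝ) * v) ^ ((N : ℝ) / 2 - 1) * heaviside v =
      (N : ℝ) ^ ((N : ℝ) / 2 - 1) * (v ^ ((N : ℝ) / 2 - 1) * heaviside v) := fun v => by
    unfold heaviside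
    split_ifs with h
    · rw [Real.mul_rpow hN'.le h]; ring
    · simp
  by_cases hκ : Even κ
  · refine ⟨fun _ => 0, fun _ => analyticAt_const, fun v _ => ?_⟩
    simp only [hNonanalytic, if_pos hκ, e]
    rw [hh, mul_assoc, hpow]; ring
  by_cases hNe : Even N
  -- Since log |N v| = log N + log |v|, rescaling the logarithmic case adds a monomial, whereas the
  -- other cases are homogeneous.
  · refine ⟨fun v => (-1) ^ ((κ + 1) / 2) * v ^ ((N - 2) / 2 : ℕ) * (Real.log N / Real.pi),
      fun v => by fun_prop, fun v hv => ?_⟩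
    have e2 : (N : ℝ) / 2 - 1 = (((N - 2) / 2 : ℕ) : ℝ) := by
      obtain ⟨n, rfl⟩ := hNe
      obtain ⟨n, rfl⟩ : ∃ n', n = n' + 1 := ⟨n - 1, by omega⟩
      have : (n + 1 + (n + 1) - 2) / 2 = n := by omega
      rw [this]; push_cast; ring
    simp only [hNonanalytic, if_neg hκ, if_pos hNe]
    rw [e2, Real.rpow_natCast, abs_mul, Real.log_mul (abs_ne_zero.2 hN'.ne') (abs_ne_zero.2 hv),
      mul_pow, Nat.abs_cast]
    ring
  · refine ⟨fun _ => 0, fun _ => analyticAt_const, fun v _ => ?_⟩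
    simp only [hNonanalytic, if_neg hκ, if_neg hNe, e]
    rw [← mul_neg, hh, mul_assoc, hpow]; ring

theorem IsDensityOfStates.mono {U : Set (Conf N)} {S S' : Set ℝ} {Ω : ℝ → ℝ}
    (h : IsDensityOfStates V U S Ω) (hS : S' ⊆ S) : IsDensityOfStates V U S' Ω where
  integrable := h.integrable.mono_set hS
  volume_ne_top := ne_top_of_le_ne_top h.volume_ne_top (measure_mono fun _ hp => ⟨hp.1, hS hp.2⟩)
  integral_eq A hA hAm := h.integral_eq A (hA.trans hS) hAm

theorem isDensityOfStates_of_lintegral (hN : 0 < N) {U : Set (Conf N)} {S : Set ℝ}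
    (hS : MeasurableSet S) {Ω : ℝ → ℝ} (hm : AEStronglyMeasurable Ω (volume.restrict S))
    (h0 : ∀ᵐ v ∂volume.restrict S, 0 ≤ Ω v) (hU : volume U ≠ ⊤)
    (h : ∀ A ⊆ S, MeasurableSet A →
      volume {p ∈ U | V p / N ∈ A} = ENNReal.ofReal N * ∫⁻ v in A, ENNReal.ofReal (Ω v)) :
    IsDensityOfStates V U S Ω := by
  have hN' : (0 : ℝ) < N := by exact_mod_cast hN
  have hfin : volume {p ∈ U | V p / N ∈ S} ≠ ⊤ := ne_top_of_le_ne_top hU (measure_mono fun _ hp => hp.1)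
  refine ⟨⟨hm, ?_⟩, hfin, fun A hA hAm => ?_⟩
  · rw [hasFiniteIntegral_iff_ofReal h0]
    rw [h S le_rfl hS] at hfin
    refine lt_top_iff_ne_top.2 fun htop => hfin ?_
    rw [htop, ENNReal.mul_top (by simpa using hN.ne')]
  · rw [integral_eq_lintegral_of_nonneg_ae (ae_restrict_of_ae_restrict_of_subset hA h0)
      (hm.mono_measure (Measure.restrict_mono_set _ hA)), measureReal_def, h A hA hAm,
      ENNReal.toReal_mul, ENNReal.toReal_ofReal hN'.le, mul_div_cancel_left₀ _ hN'.ne']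

theorem lintegral_image_mul (hN : 0 < N) {A : Set ℝ} (hA : MeasurableSet A) (g : ℝ → ENNReal) :
    ∫⁻ w in (fun v : ℝ => N * v) '' A, g w = ENNReal.ofReal N * ∫⁻ v in A, g (N * v) := by
  have hN' : (0 : ℝ) < N := by exact_mod_cast hN
  rw [lintegral_image_eq_lintegral_abs_deriv_mul (f' := fun _ => (N : ℝ)) hA
    (fun v _ => by simpa using ((hasDerivAt_id v).const_mul (N : ℝ)).hasDerivWithinAt)
    (mul_right_injective₀ hN'.ne').injOn]
  simp only [Nat.abs_cast]
  exact lintegral_const_mul' _ _ ENNReal.ofReal_ne_top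

end DensityOfStates

/-! ### Decomposition of the density of states -/

section Decomposition

variable {N : ℕ} {k : ℕ} {V : Conf N → ℝ} {G : Set (Conf N)} {qc : Conf N}
  {q : OpenPartialHomeomorph (Conf N) (Conf N)}

/-- The density of states of the image of a ball under a Morse chart. -/
theorem IsMorseChart.exists_densityOfStates (hq : IsMorseChart V G qc k q) (hN : 0 < N)
    (hkN : k ≤ N) {r : ℝ} (hr : 0 < r) (hrq : Metric.closedBall 0 r ⊆ q.source) :
    ∃ ε > 0, ∃ Ωa : ℝ → ℝ, AnalyticOnNhd ℝ Ωa (Ioo (-ε) ε) ∧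
      IsDensityOfStates V (q '' Metric.closedBall 0 r) (Ioo (-ε) ε)
        (fun v => Ωa v + omegaNonanalytic N k (jacobianDet q) v) := by
  have hN' : (0 : ℝ) < N := by exact_mod_cast hN
  set J := jacobianDet q with hJ
  obtain ⟨ε, hε, F, hF, hfac, hnn, hdens⟩ := exists_energy_density (k := k) hN hkN
    (measurable_jacobianDet q) (fun x => abs_nonneg _) hr (hq.analyticOnNhd_jacobianDet.mono hrq)
  obtain ⟨P, hP, hPe⟩ := exists_hNonanalytic_mul hN (k % 4)
  have hmem : ∀ v ∈ Ioo (-(ε / N)) (ε / N), N * v ∈ Metric.ball (0 : ℝ) ε := fun v hv => by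
    have h1 : |v| < ε / N := abs_lt.2 hv
    rw [mem_ball_zero_iff, Real.norm_eq_abs, abs_mul, Nat.abs_cast, mul_comm]
    exact (lt_div_iff₀ hN').1 h1
  have hFN : ∀ {f : ℝ → ℝ}, AnalyticOnNhd ℝ f (Metric.ball 0 ε) →
      AnalyticOnNhd ℝ (fun v => f (N * v)) (Ioo (-(ε / N)) (ε / N)) := fun {f} hf v hv =>
    AnalyticAt.fun_comp (g := f) (hf _ (hmem v hv)) (by fun_prop)
  have hha : AnalyticOnNhd ℝ (hAnalytic N k J) (Ioo (-(ε / N)) (ε / N)) := by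
    rw [funext (hAnalytic_eq hN k J)]
    exact fun v hv => analyticAt_const.fun_mul (hFN hfac v hv)
  have hΩa : AnalyticOnNhd ℝ (fun v => F (N * v) + hAnalytic N k J v * P v)
      (Ioo (-(ε / N)) (ε / N)) := fun v hv =>
    (hFN hF v hv).fun_add ((hha v hv).fun_mul (hP v))
  -- The factor N^(N/2-1) from rescaling the singular function is the one between `energyFactor` and
  -- `hAnalytic`; the polynomial P is counted as analytic.
  have hΩ : ∀ v, v ≠ 0 → F (N * v) + hAnalytic N k J v * P v + omegaNonanalytic N k J v =
      F (N * v) + hNonanalytic N (k % 4) (N * v) * energyFactor N k J (N * v) := fun v hv => by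
    rw [hPe v hv, omegaNonanalytic, hAnalytic_eq hN]; ring
  -- At v = 0 the singular function takes a conventional value such as log 0; a null set does not
  -- matter for the density.
  have hne : ∀ᵐ v ∂volume.restrict (Ioo (-(ε / N)) (ε / N)), v ≠ 0 :=
    ae_restrict_of_ae (Measure.ae_ne volume (0 : ℝ))
  refine ⟨ε / N, by positivity, _, hΩa, isDensityOfStates_of_lintegral hN measurableSet_Ioo
    ?_ ?_ ?_ fun A hA hAm => ?_⟩
  · exact (hΩa.continuousOn.aestronglyMeasurable measurableSet_Ioo).add
      ((hha.continuousOn.aestronglyMeasurable measurableSet_Ioo).mul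
        (measurable_hNonanalytic _ _).aestronglyMeasurable)
  · filter_upwards [ae_restrict_mem measurableSet_Ioo, hne] with v hv hv0
    rw [hΩ v hv0]
    exact hnn _ (by simpa using hmem v hv) (mul_ne_zero hN'.ne' hv0)
  · exact ((isCompact_closedBall (0 : Conf N) r).image_of_continuousOn
      (q.continuousOn.mono hrq)).measure_lt_top.ne
  · have hAm' : MeasurableSet ((fun v : ℝ => N * v) '' A) :=
      (measurableEmbedding_mulLeft₀ hN'.ne').measurableSet_image.2 hAm
    have hA' : (fun v : ℝ => N * v) '' A ⊆ Metric.ball 0 ε := by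
      rintro _ ⟨v, hv, rfl⟩
      exact hmem v (hA hv)
    rw [hq.sep_image_eq hN hrq, (hq.volume_level hrq hAm').2, hdens _ hA' hAm',
      lintegral_image_mul hN hAm]
    congr 1
    refine lintegral_congr_ae ?_
    filter_upwards [ae_restrict_of_ae (Measure.ae_ne volume (0 : ℝ))] with v hv0
    rw [hΩ v hv0]

/-- Additivity of the volume requires measurability of only one of two disjoint pieces, so nothing
about V outside U₀ is needed beyond the given density. -/
theorem IsDensityOfStates.union {U₀ U : Set (Conf N)} (hU : U₀ ⊆ U) {S : Set ℝ} {Ω₁ Ω₂ : ℝ → ℝ}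
    (h₁ : IsDensityOfStates V U₀ S Ω₁) (h₂ : IsDensityOfStates V (U \ U₀) S Ω₂)
    (hm : ∀ A : Set ℝ, MeasurableSet A → MeasurableSet {p ∈ U₀ | V p / N ∈ A}) :
    IsDensityOfStates V U S (fun v => Ω₁ v + Ω₂ v) := by
  have hsplit : ∀ A : Set ℝ, {p ∈ U | V p / N ∈ A} =
      {p ∈ U₀ | V p / N ∈ A} ∪ {p ∈ U \ U₀ | V p / N ∈ A} := fun A => by
    ext p
    constructor
    · rintro ⟨hp, hA⟩
      by_cases h : p ∈ U₀
      · exact Or.inl ⟨h, hA⟩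
      · exact Or.inr ⟨⟨hp, h⟩, hA⟩
    · rintro (⟨hp, hA⟩ | ⟨hp, hA⟩)
      · exact ⟨hU hp, hA⟩
      · exact ⟨hp.1, hA⟩
  have hdisj : ∀ A : Set ℝ, Disjoint {p ∈ U₀ | V p / N ∈ A} {p ∈ U \ U₀ | V p / N ∈ A} := fun A =>
    disjoint_left.2 fun p hp hp' => hp'.1.2 hp.1
  refine ⟨h₁.integrable.add h₂.integrable, ?_, fun A hA hAm => ?_⟩
  · rw [hsplit]
    exact measure_union_ne_top h₁.volume_ne_top h₂.volume_ne_top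
  · rw [integral_add (h₁.integrable.mono_set hA) (h₂.integrable.mono_set hA),
      h₁.integral_eq A hA hAm, h₂.integral_eq A hA hAm, hsplit A,
      measureReal_union' (hdisj A) (hm A hAm) (h₁.mono hA).volume_ne_top (h₂.mono hA).volume_ne_top,
      add_div]

theorem taylorCoeff_zero (f : Conf N → ℝ) : taylorCoeff f 0 = f 0 := by
  simp [taylorCoeff, mixedPartial]

end Decomposition

/-! ### Assembly of the theorem -/

theorem theorem1 {N : ℕ} (hN : 0 < N) (G : Set (Conf N)) (hG : IsOpen G)
    (V : Conf N → ℝ) (hV : IsMorseOn V G)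
    (qc : Conf N) (hqc : qc ∈ G) (hcrit : ∀ q ∈ G, fderiv ℝ V q = 0 ↔ q = qc)
    (hVqc : V qc = 0) (k : ℕ) (hk : morseIndex V qc = k) :
    (∃ q : OpenPartialHomeomorph (Conf N) (Conf N), IsMorseChart V G qc k q) ∧
    ∀ q : OpenPartialHomeomorph (Conf N) (Conf N), IsMorseChart V G qc k q →
      -- the Taylor expansion of the Jacobian determinant and its zeroth coefficient
      (∀ᶠ x in 𝓝 (0 : Conf N),
        HasSum (fun I => taylorCoeff (jacobianDet q) I * monom x I) (jacobianDet q x)) ∧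
      taylorCoeff (jacobianDet q) 0 = |((1 / 2 : ℝ) • hessian V qc).det| ^ (-1 / 2 : ℝ) ∧
      -- the analytic factor, and its radius of convergence
      AnalyticAt ℝ (hAnalytic N k (jacobianDet q)) 0 ∧
      (∀ R : ℝ, 0 < R →
        (∀ x : Conf N, (∀ i, |x i| < R) →
          Summable fun I => taylorCoeff (jacobianDet q) I * monom x I) →
        (∀ v : ℝ, |v| < R ^ 2 / N → Summable (hAnalyticTerm N k (jacobianDet q) v)) ∧
        AnalyticOnNhd ℝ (hAnalytic N k (jacobianDet q)) (Metric.ball 0 (R ^ 2 / N))) ∧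
      -- the nonanalytic part does not extend analytically across `v = 0`
      (¬ ∃ g : ℝ → ℝ, AnalyticAt ℝ g 0 ∧
        g =ᶠ[𝓝[≠] 0] omegaNonanalytic N k (jacobianDet q)) ∧
      -- the decomposition of the density of states
      ∀ r : ℝ, 0 < r → Metric.closedBall 0 r ⊆ q.source →
        (∃ ε > 0, ∃ Ωa : ℝ → ℝ, AnalyticOnNhd ℝ Ωa (Ioo (-ε) ε) ∧
          IsDensityOfStates V (q '' Metric.closedBall 0 r) (Ioo (-ε) ε)
            (fun v => Ωa v + omegaNonanalytic N k (jacobianDet q) v)) ∧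
        -- the same for larger regions whose remaining part has no singularity at `v = 0`
        ∀ U : Set (Conf N), MeasurableSet U → U ⊆ G → q '' Metric.closedBall 0 r ⊆ U →
          (∃ δ > 0, ∃ Ωr : ℝ → ℝ, AnalyticOnNhd ℝ Ωr (Ioo (-δ) δ) ∧
            IsDensityOfStates V (U \ q '' Metric.closedBall 0 r) (Ioo (-δ) δ) Ωr) →
          ∃ ε > 0, ∃ Ωa : ℝ → ℝ, AnalyticOnNhd ℝ Ωa (Ioo (-ε) ε) ∧
            IsDensityOfStates V U (Ioo (-ε) ε)
              (fun v => Ωa v + omegaNonanalytic N k (jacobianDet q) v) := by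
  have h1 : fderiv ℝ V qc = 0 := (hcrit qc hqc).2 rfl
  have hdet := hV.nondegenerate qc hqc h1
  have hkN : k ≤ N := hk ▸ morseIndex_le V qc
  refine ⟨hk ▸ exists_isMorseChart hG hqc (hV.analytic qc hqc) hVqc h1 hdet, fun q hq => ?_⟩
  have hJa := hq.analyticOnNhd_jacobianDet 0 hq.zero_mem
  obtain ⟨R, hR, hsum⟩ := hJa.exists_hasSum_taylorCoeff
  have hJ0 : taylorCoeff (jacobianDet q) 0 ≠ 0 := by
    rw [taylorCoeff_zero]
    exact abs_ne_zero.2 (hq.det_fderiv_ne_zero hq.zero_mem)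
  have hN' : (0 : ℝ) < N := by exact_mod_cast hN
  have hha : AnalyticAt ℝ (hAnalytic N k (jacobianDet q)) 0 :=
    analyticOnNhd_hAnalytic hN k hR (fun x hx => (hsum x hx).summable) 0
      (Metric.mem_ball_self (by positivity))
  refine ⟨?_, ?_, hha, fun R hR h => ⟨fun v hv => summable_hAnalyticTerm hN k hR h hv,
    analyticOnNhd_hAnalytic hN k hR h⟩,
    omegaNonanalytic_not_analyticAt (hAnalytic_zero_ne hN k hJ0) hha, fun r hr hrq => ⟨?_, ?_⟩⟩
  · filter_upwards [(isOpen_polydisc R).mem_nhds (zero_mem_polydisc hR)] with x hx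
    exact hsum x hx
  -- The zeroth coefficient is J(0) ≥ 0, so J(0)² d = 1 determines it as d^(-1/2).
  · have h2 := abs_det_fderiv_isMorseChart (hV.analytic qc hqc) hVqc h1 hq
    have h3 : 0 ≤ jacobianDet q 0 := abs_nonneg _
    set d := |((1 / 2 : ℝ) • hessian V qc).det| with hd
    have hd0 : 0 < d := lt_of_le_of_ne (abs_nonneg _) fun h => by rw [← h] at h2; simp at h2
    rw [taylorCoeff_zero, neg_div, Real.rpow_neg hd0.le, ← Real.sqrt_eq_rpow, ← one_div, eq_div_iff
      (Real.sqrt_pos.2 hd0).ne', ← pow_left_inj₀ (by positivity) zero_le_one two_ne_zero, mul_pow,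
      Real.sq_sqrt hd0.le, h2, one_pow]
  · exact hq.exists_densityOfStates hN hkN hr hrq
  · rintro U - - hU ⟨δ, hδ, Ωr, hΩr, hdr⟩
    obtain ⟨ε, hε, Ωa, hΩa, hda⟩ := hq.exists_densityOfStates hN hkN hr hrq
    have hsub₁ : Ioo (-min ε δ) (min ε δ) ⊆ Ioo (-ε) ε :=
      Ioo_subset_Ioo (neg_le_neg (min_le_left _ _)) (min_le_left _ _)
    have hsub₂ : Ioo (-min ε δ) (min ε δ) ⊆ Ioo (-δ) δ :=
      Ioo_subset_Ioo (neg_le_neg (min_le_right _ _)) (min_le_right _ _)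
    refine ⟨min ε δ, lt_min hε hδ, fun v => Ωa v + Ωr v, (hΩa.mono hsub₁).add (hΩr.mono hsub₂), ?_⟩
    have h2 := (hda.mono hsub₁).union hU (hdr.mono hsub₂) (fun A hA => by
      rw [hq.sep_image_eq hN hrq]
      exact (hq.volume_level hrq ((measurableEmbedding_mulLeft₀ hN'.ne').measurableSet_image.2 hA)).1)
    convert h2 using 2
    ring
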